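/- **Setting.** A problem is a triple $(f,C,x_0)$: a convex function $f:\mathbb R^n\to\mathbb R$, a closed convex domain $C\subseteq\mathbb R^n$ over which $f$ is minimized, and an initial point $x_0\in C$. A *$\delta$-bounded stochastic inexact gradient oracle* answers its $t$-th call, made at $x$, by a random vector $g$, independent of the other calls, whose law may depend on $t$ and $x$, with $\mathbb E\,g\in\partial f(x)$ and $\mathbb E\|g-\mathbb E\,g\|^2\le\delta^2$. A procedure with $T$ iterations chooses $T$ query points $x_0,\dots,x_{T-1}$ adaptively (possibly with internal randomness), receives the answers $g_0,\dots,g_{T-1}$, and outputs $x_T$. It is *$\varepsilon$-accurate* if $x_T\in C$ almost surely and $\mathbb E f(x_T)-\inf_C f\le\varepsilon$; its *deviation* is $\mathbb E\|x_T-x_T'\|^2$ for two independent runs. It is *first-order iterative* (FOI) if $x_t=x_0-\sum_{i<t}\lambda^{(t)}_i g_i$ for all $t$, with coefficients that may depend on all previous computations; for nonsmooth functions (parts 3 and 4) one requires in addition $\lambda^{(t)}_{t-1}\ne0$. *Averaged SGD* with steps $\eta_t>0$ is $x_{t+1}=\Pi_C(x_t-\eta_tg_t)$ with output a weighted average of $x_1,\dots,x_T$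 (for $C=\mathbb R^n$ there is no projection). **Theorem.** Consider the following four classes of problems and rates $r$. 1. *Smooth:* $\nabla f$ is $L$-Lipschitz, and some minimizer over $C$ is within distance $D$ of $x_0$; $r=\dfrac{\delta^2}{T\varepsilon^2}$. 2. *Smooth, strongly convex:* as in 1, and $f$ is $\mu$-strongly convex on $C$ ($\mu\le L$); $r=\min\{\delta^2/T,\ \varepsilon\}$. 3. *Lipschitz:* $f$ is $G$-Lipschitz on a neighbourhood of $C$, and some minimizer over $C$ is within distance $D$ of $x_0$; $r=\dfrac1{T\varepsilon^2}$. 4. *Lipschitz, strongly convex:* $f$ is $G$-Lipschitz on a neighbourhood of $C$ and $\mu$-strongly convex on $C$; $r=\min\{1/T,\ \varepsilon\}$. Let $L,\mu,G,D>0$. For each class, the deviation is $\Theta(r)$, in the following sense. *Lower bound.* There are $c,\varepsilon_0>0$ and $K\in\mathbb N$, depending only on the parameters $L,\mu,G,D$ of the class, such that for all $0<\varepsilon\le\varepsilon_0$, $\delta>0$ and $T\ge1$ there are a problem of the class with $n\le KT$ and $x_0=0$, where $C=\mathbb R^n$ in 1–3 and $C$ is a ball around $0$ in 4, and a $\delta$-bounded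 stochastic oracle for it (valid at all points of $\mathbb R^n$), for which every FOI algorithm that is $\varepsilon$-accurate after $T$ iterations has deviation at least $c\,r$. *Upper bound.* For every $\Delta>0$ there are $a,B,C_0>0$, depending only on $\Delta$ and the parameters of the class, such that for all $\varepsilon>0$, $0<\delta\le\Delta$ and $T\ge C_0/\varepsilon^2$ (in 1 and 3) or $T\ge C_0/\varepsilon$ (in 2 and 4), on every problem of the class, in any dimension and with any $\delta$-bounded stochastic oracle, averaged SGD is $\varepsilon$-accurate after $T$ iterations with deviation at most $B\,r$. Here $\eta_t=\frac{a}{\varepsilon T}$ with uniform weights in 1 and 3, and $\eta_t=\frac{2}{\mu(t+a)}$ with weights proportional to $t$ in 2 and 4. When $C$ is $\mathbb R^n$ or a ball of positive radius around $x_0$, this SGD is itself an FOI algorithm. *Information-theoretic lower bound in class 1.* There are $c,\varepsilon_0,\kappa>0$, depending only on $L,D$, such that for all $0<\varepsilon\le\varepsilon_0$, $\delta>0$ with $\varepsilon\le\kappa\delta^2$, and $T\ge1$ there are problems $(f_\theta,\mathbb R,0)$, $\theta\in[-1,1]$, of class 1 in dimension one, with $\delta$-bounded stochastic oracles, such that every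 procedure with $T$ iterations (FOI or not) that is $\varepsilon$-accurate for every $\theta\in[-1,1]$ has deviation at least $c\,\dfrac{\delta^2}{T\varepsilon^2}$ for some $\theta\in[-1,1]$. -/

import Mathlib

open MeasureTheory Set
open scoped NNReal ENNReal RealInnerProductSpace

noncomputable section

namespace Repro

/-- The ambient Euclidean space `ℝⁿ`. -/
abbrev E (n : ℕ) : Type := EuclideanSpace ℝ (Fin n)

/-! ### Convex function classes -/

/-- `v` belongs to the subdifferential `∂f(x)` of a function `f : ℝⁿ → ℝ`. -/
def IsSubgradient {n : ℕ} (f : E n → ℝ) (x v : E n) : Prop :=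
  ∀ y, f x + ⟪v, y - x⟫ ≤ f y

/-- A class of optimization problems: the objective `f`, its domain `C` over which it is minimized,
and the initial point `x₀`. -/
abbrev ProblemClass : Type := ∀ n : ℕ, (E n → ℝ) → Set (E n) → E n → Prop

/-- What all problems have in common: the domain is closed and convex and contains the initial
point, and the objective is a (finite) convex function. -/
structure IsConvexProblem {n : ℕ} (f : E n → ℝ) (C : Set (E n)) (x₀ : E n) : Prop where
  isClosed : IsClosed C
  convex : Convex ℝ C
  mem : x₀ ∈ C
  convexOn : ConvexOn ℝ univ f

/-- Some minimizer of `f` over `C` is at distance at most `D` from the initial point. -/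
def HasMinimizerWithin {n : ℕ} (D : ℝ) (f : E n → ℝ) (C : Set (E n)) (x₀ : E n) : Prop :=
  ∃ z ∈ C, IsMinOn f C z ∧ ‖x₀ - z‖ ≤ D

/-- `L`-smooth: differentiable with an `L`-Lipschitz gradient. -/
def IsSmooth {n : ℕ} (L : ℝ≥0) (f : E n → ℝ) : Prop :=
  Differentiable ℝ f ∧ LipschitzWith L (gradient f)

/-- `G`-Lipschitz on (an open neighbourhood of) the domain `C`. The neighbourhood makes all
subgradients at boundary points of `C` bounded by `G`; for `C = ℝⁿ` this is `LipschitzWith G f`. -/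
def IsLipschitzNear {n : ℕ} (G : ℝ≥0) (f : E n → ℝ) (C : Set (E n)) : Prop :=
  ∃ U : Set (E n), IsOpen U ∧ C ⊆ U ∧ LipschitzOnWith G f U

/-- `L`-smooth convex functions with a minimizer within distance `D` of the initial point. -/
def smoothClass (L : ℝ≥0) (D : ℝ) : ProblemClass := fun _ f C x₀ =>
  IsConvexProblem f C x₀ ∧ IsSmooth L f ∧ HasMinimizerWithin D f C x₀

/-- `L`-smooth and `μ`-strongly convex functions with a minimizer within distance `D` of the
initial point. -/
def smoothStrongClass (L : ℝ≥0) (μ D : ℝ) : ProblemClass := fun _ f C x₀ =>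
  IsConvexProblem f C x₀ ∧ IsSmooth L f ∧ StrongConvexOn C μ f ∧ HasMinimizerWithin D f C x₀

/-- `G`-Lipschitz convex functions with a minimizer within distance `D` of the initial point. -/
def lipschitzClass (G : ℝ≥0) (D : ℝ) : ProblemClass := fun _ f C x₀ =>
  IsConvexProblem f C x₀ ∧ IsLipschitzNear G f C ∧ HasMinimizerWithin D f C x₀

/-- `G`-Lipschitz and `μ`-strongly convex functions (on a domain, which is necessarily bounded). -/
def lipschitzStrongClass (G : ℝ≥0) (μ : ℝ) : ProblemClass := fun _ f C x₀ =>
  IsConvexProblem f C x₀ ∧ IsLipschitzNear G f C ∧ StrongConvexOn C μ f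

/-! ### Stochastic gradient oracles -/

/-- A stochastic oracle: the `t`-th call, made at the point `x`, is answered by `out t x s`, where
`s` is a fresh random seed. -/
structure StochasticOracle (n : ℕ) where
  Seed : Type
  [mSeed : MeasurableSpace Seed]
  law : Measure Seed
  [isProb : IsProbabilityMeasure law]
  out : ℕ → E n → Seed → E n
  measurable_out : ∀ t, Measurable (fun p : E n × Seed => out t p.1 p.2)

attribute [instance] StochasticOracle.mSeed StochasticOracle.isProb

/-- `O` is a `δ`-bounded stochastic inexact gradient oracle for `f`, for queries in `S`: the answer
at `x` has as its mean a subgradient of `f` at `x`, and variance at most `δ²`. -/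
def StochasticOracle.IsInexact {n : ℕ} (O : StochasticOracle n) (f : E n → ℝ) (S : Set (E n))
    (δ : ℝ) : Prop :=
  ∀ t : ℕ, ∀ x ∈ S, Integrable (O.out t x) O.law ∧
    IsSubgradient f x (∫ s, O.out t x s ∂O.law) ∧
    ∫⁻ s, ‖O.out t x s - ∫ s', O.out t x s' ∂O.law‖ₑ ^ 2 ∂O.law ≤ ENNReal.ofReal (δ ^ 2)

/-! ### First-order algorithms and their runs -/

/-- A first-order (adaptive, possibly randomized) procedure: `point t h c` is the point produced
after the answers `h 0, …, h (t-1)` of the oracle, with internal randomness `c`. In a run with `T`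
oracle calls the points number `0, …, T-1` are queried and the point number `T` is the output. -/
structure Algorithm (n : ℕ) where
  Coin : Type
  [mCoin : MeasurableSpace Coin]
  coinLaw : Measure Coin
  [isProb : IsProbabilityMeasure coinLaw]
  point : (t : ℕ) → (Fin t → E n) → Coin → E n

attribute [instance] Algorithm.mCoin Algorithm.isProb

namespace Algorithm

variable {n : ℕ}

/-- All maps that make up the algorithm are measurable. -/
def IsMeasurable (A : Algorithm n) : Prop :=
  ∀ t, Measurable (fun p : (Fin t → E n) × A.Coin => A.point t p.1 p.2)

/-- First-order iterative (FOI) algorithm: the point number `t` is `x₀ - ∑_{i<t} λᵢ⁽ᵗ⁾ gᵢ`, where the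
coefficients may depend on everything computed so far. -/
def IsFOI (x₀ : E n) (A : Algorithm n) : Prop :=
  ∀ (t : ℕ) (h : Fin t → E n) (c : A.Coin), ∃ l : Fin t → ℝ,
    A.point t h c = x₀ - ∑ i, l i • h i

/-- FOI algorithm for nonsmooth functions: moreover, the coefficient of the latest gradient is
nonzero. -/
def IsFOILatest (x₀ : E n) (A : Algorithm n) : Prop :=
  ∀ (t : ℕ) (h : Fin t → E n) (c : A.Coin), ∃ l : Fin t → ℝ,
    (∀ i : Fin t, (i : ℕ) + 1 = t → l i ≠ 0) ∧ A.point t h c = x₀ - ∑ i, l i • h i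

/-- The first `t` oracle answers in the run with coin `c` and oracle seeds `s 0, s 1, …`. -/
def answers (A : Algorithm n) (O : StochasticOracle n) (c : A.Coin) (s : ℕ → O.Seed) :
    (t : ℕ) → (Fin t → E n)
  | 0 => Fin.elim0
  | t + 1 => Fin.snoc (α := fun _ => E n) (answers A O c s t)
      (O.out t (A.point t (answers A O c s t) c) (s t))

/-- The law of the randomness of one run: the coin and the seeds of the oracle calls, all
independent. -/
def runLaw (A : Algorithm n) (O : StochasticOracle n) : Measure (A.Coin × (ℕ → O.Seed)) :=
  A.coinLaw.prod (Measure.infinitePi fun _ : ℕ => O.law)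

/-- The output of a run with `T` oracle calls. -/
def output (A : Algorithm n) (O : StochasticOracle n) (T : ℕ) (ω : A.Coin × (ℕ → O.Seed)) : E n :=
  A.point T (A.answers O ω.1 ω.2 T) ω.1

/-- `ε`-accuracy: the output `x` lies in the domain `C` and `𝔼 f(x) - inf_C f ≤ ε`. -/
def IsAccurate (A : Algorithm n) (O : StochasticOracle n) (f : E n → ℝ) (C : Set (E n)) (T : ℕ)
    (ε : ℝ) : Prop :=
  (∀ᵐ ω ∂A.runLaw O, A.output O T ω ∈ C) ∧
    ∫⁻ ω, ENNReal.ofReal (f (A.output O T ω) - sInf (f '' C)) ∂A.runLaw O ≤ ENNReal.ofReal ε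

/-- The deviation `𝔼 ‖x - x'‖²` between the outputs `x`, `x'` of two independent runs. -/
def deviation (A : Algorithm n) (O : StochasticOracle n) (T : ℕ) : ℝ≥0∞ :=
  ∫⁻ p, ‖A.output O T p.1 - A.output O T p.2‖ₑ ^ 2 ∂(A.runLaw O).prod (A.runLaw O)

end Algorithm

/-! ### Averaged (projected) stochastic gradient descent -/

/-- Euclidean projection onto a closed convex set `C` (the identity when `C = ℝⁿ`). -/
def proj {n : ℕ} (C : Set (E n)) (x : E n) : E n :=
  Classical.epsilon fun y => y ∈ C ∧ ∀ z ∈ C, ‖x - y‖ ≤ ‖x - z‖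

/-- The iterates `x_{t+1} = Π_C (x_t - η_t g_t)` for a given sequence `g` of oracle answers. -/
def sgdIterate {n : ℕ} (C : Set (E n)) (x₀ : E n) (η : ℕ → ℝ) (g : ℕ → E n) : ℕ → E n
  | 0 => x₀
  | t + 1 => proj C (sgdIterate C x₀ η g t - η t • g t)

/-- Projected SGD with step sizes `η` that queries its iterates `x₀, …, x_{T-1}` and outputs the
average of `x₁, …, x_T` with weights proportional to `w 1, …, w T`. It uses no coins. -/
def averagedSGD {n : ℕ} (C : Set (E n)) (x₀ : E n) (η w : ℕ → ℝ) (T : ℕ) : Algorithm n where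
  Coin := Unit
  coinLaw := Measure.dirac ()
  point := fun t h _ =>
    let x : ℕ → E n := sgdIterate C x₀ η (fun i => if hi : i < t then h ⟨i, hi⟩ else 0)
    if t = T then (∑ s ∈ Finset.Icc 1 T, w s)⁻¹ • ∑ s ∈ Finset.Icc 1 T, w s • x s else x t

/-! ### Lower and upper bounds on the deviation -/

/-- The domain is `ℝⁿ`. -/
def IsWholeSpace (n : ℕ) (C : Set (E n)) (_ : E n) : Prop := C = univ

/-- The domain is a closed ball of positive radius around the initial point. -/
def IsBallAround (n : ℕ) (C : Set (E n)) (x₀ : E n) : Prop :=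
  ∃ R : ℝ, 0 < R ∧ C = Metric.closedBall x₀ R

/-- The deviation is `Ω(rate)` for the class `𝓕` against all algorithms in `foi`: for every small
`ε`, every `δ` and every number `T` of iterations there are one problem of the class in dimension
`O(T)`, with a domain of the form `dom` and initial point `0`, and one `δ`-bounded stochastic oracle
for it, such that every algorithm of the kind `foi` that is `ε`-accurate there has deviation at least
`c * rate ε δ T`. -/
def DeviationLowerBound (𝓕 : ProblemClass) (dom : ∀ n : ℕ, Set (E n) → E n → Prop)
    (foi : ∀ n : ℕ, E n → Algorithm n → Prop) (rate : ℝ → ℝ → ℕ → ℝ) : Prop :=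
  ∃ c ε₀ : ℝ, ∃ K : ℕ, 0 < c ∧ 0 < ε₀ ∧
    ∀ (ε δ : ℝ) (T : ℕ), 0 < ε → ε ≤ ε₀ → 0 < δ → 1 ≤ T →
      ∃ n : ℕ, n ≤ K * T ∧ ∃ (f : E n → ℝ) (C : Set (E n)) (O : StochasticOracle n),
        𝓕 n f C 0 ∧ dom n C 0 ∧ O.IsInexact f univ δ ∧
        ∀ A : Algorithm n, A.IsMeasurable → foi n 0 A → A.IsAccurate O f C T ε →
          ENNReal.ofReal (c * rate ε δ T) ≤ A.deviation O T

/-- The deviation is `O(rate)` for the class `𝓕` and `T ≥ C₀ * minIter ε` iterations, attained by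
averaged projected SGD with step sizes `step a ε T` (for a constant `a`) and averaging weights `w`,
for `δ` in a bounded range. The constants depend on the class and on this range only. When the domain
is `ℝⁿ` or a ball around the initial point, this algorithm is itself of the kind `foi`. -/
def DeviationUpperBound (𝓕 : ProblemClass) (foi : ∀ n : ℕ, E n → Algorithm n → Prop)
    (minIter : ℝ → ℝ) (step : ℝ → ℝ → ℕ → ℕ → ℝ) (w : ℕ → ℝ) (rate : ℝ → ℝ → ℕ → ℝ) : Prop :=
  ∀ Δ : ℝ, 0 < Δ → ∃ a B C₀ : ℝ, 0 < a ∧ 0 < B ∧ 0 < C₀ ∧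
    ∀ (ε δ : ℝ) (T : ℕ), 0 < ε → 0 < δ → δ ≤ Δ → C₀ * minIter ε ≤ T →
      ∀ (n : ℕ) (f : E n → ℝ) (C : Set (E n)) (x₀ : E n) (O : StochasticOracle n),
        𝓕 n f C x₀ → O.IsInexact f C δ →
          (averagedSGD C x₀ (step a ε T) w T).IsMeasurable ∧
          (IsWholeSpace n C x₀ ∨ IsBallAround n C x₀ →
            foi n x₀ (averagedSGD C x₀ (step a ε T) w T)) ∧
          (averagedSGD C x₀ (step a ε T) w T).IsAccurate O f C T ε ∧
          (averagedSGD C x₀ (step a ε T) w T).deviation O T ≤ ENNReal.ofReal (B * rate ε δ T)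

/-- Information-theoretic lower bound `Ω(rate)` on the deviation in the regime `ε ≲ δ²`, against all
procedures with `T` oracle calls that are `ε`-accurate on a certain family of one-dimensional
problems of the class. -/
def InformationLowerBound (𝓕 : ProblemClass) (rate : ℝ → ℝ → ℕ → ℝ) : Prop :=
  ∃ c ε₀ κ : ℝ, 0 < c ∧ 0 < ε₀ ∧ 0 < κ ∧
    ∀ (ε δ : ℝ) (T : ℕ), 0 < ε → ε ≤ ε₀ → 0 < δ → ε ≤ κ * δ ^ 2 → 1 ≤ T →
      ∃ (F : ℝ → E 1 → ℝ) (O : ℝ → StochasticOracle 1),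
        (∀ θ ∈ Icc (-1 : ℝ) 1, 𝓕 1 (F θ) univ 0 ∧ (O θ).IsInexact (F θ) univ δ) ∧
        ∀ A : Algorithm 1, A.IsMeasurable →
          (∀ θ ∈ Icc (-1 : ℝ) 1, A.IsAccurate (O θ) (F θ) univ T ε) →
          ∃ θ ∈ Icc (-1 : ℝ) 1, ENNReal.ofReal (c * rate ε δ T) ≤ A.deviation (O θ) T

end Repro

end

/-!
**Upper bounds.** The analysis of averaged SGD needs only two deterministic facts about one step,
collected in `StepBounds`: a descent inequality for the distance to the minimizer, and the
near-contraction of the map `x ↦ x - η ∇f(x)`, which is exact for smooth objectives (cocoercivity)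
and holds up to `O(η²)` for Lipschitz ones. The noise is centred and independent of the past, so
resampling the seed of one call (`lintegral_infinitePi_update`) turns them into recursions for the
expected gap and the expected squared distance between two independent runs
(`exists_real_recursion`). Solved for constant steps, they give accuracy `ε` and deviation of order
`T η² = 1 / (T ε²)`, times `δ²` in the smooth case; solved for steps `2 / (μ (t + a))`, they give
deviation of order `1 / T`. Under strong convexity, accuracy alone puts both outputs within
`O(√ε)` of the minimizer (`deviation_le_of_isAccurate`), whence the minimum with `ε`. The projection
onto a ball around the initial point is a homothety about that point (`exists_proj_closedBall_eq`),
so it preserves the form that defines first-order iterative algorithms.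

**Lower bounds against first-order iterative algorithms.** The noise of the `t`-th call lies along
one of two fresh coordinates, chosen by a fair bit. An algorithm that only combines answers can move
in the base direction, as accuracy demands, only if it also moves in the selected coordinates: its
output lies in a subspace on which the base coordinate is proportional to the sum of the selected
ones. Two independent runs select differently in half of the calls and hence cannot cancel there; by
Cauchy–Schwarz, spreading the movement over all `T` calls reduces the deviation by a factor `T` and
no further (`deviation_ge_of_selected`). For smooth objectives the objective depends on the base
coordinate alone or is a quadratic, and the ratio between noise and gradient gives the factor `δ²`.
For nonsmooth objectives the noise only serves to leave a trace of the fair bit, which may be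
arbitrarily small. The objective is a maximum of affine pieces, one for each call, each bit and each
sign of the trace. As the latest coefficient is nonzero, the trace of the latest call is nonzero at
the next query point, so that a piece whose bit is already known is active there (`activePiece_eq`),
and its slope, of a size independent of `δ`, leads along the selected coordinate
(`output_mem_revealedSubmodule`).

**Information-theoretic lower bound.** The objectives are smoothed absolute values of slope `p`, of
order `ε / D`, with minimizers `θ D`, and the oracle answers `±δ` with a bias of order `p / δ`. An
accurate procedure has mean output close to `θ D`, so on a fine grid of parameters some step moves
the mean output by at least the average amount (`exists_step_of_abs_sub_le`). The laws of the
transcripts for neighbouring parameters are so close in `χ²`-divergence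
(`lintegral_likelihood_sq_le`) that the Chapman–Robbins inequality (`sq_integral_sub_le_deviation`)
only permits such a move if the deviation is large. The fineness of the grid cancels out.
-/

namespace Repro

variable {n : ℕ}

/-! ### Euclidean projections -/

lemma proj_spec {C : Set (E n)} (hc : IsClosed C) (hC : Convex ℝ C) (hne : C.Nonempty) (x : E n) :
    proj C x ∈ C ∧ ∀ z ∈ C, ‖x - proj C x‖ ≤ ‖x - z‖ := by
  obtain ⟨v, hv, h⟩ := exists_norm_eq_iInf_of_complete_convex hne hc.isComplete hC x
  have hex : ∃ y, y ∈ C ∧ ∀ z ∈ C, ‖x - y‖ ≤ ‖x - z‖ := by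
    refine ⟨v, hv, fun z hz => ?_⟩
    rw [h]
    exact ciInf_le ⟨0, by rintro _ ⟨w, rfl⟩; exact norm_nonneg _⟩ (⟨z, hz⟩ : C)
  exact Classical.epsilon_spec hex

lemma inner_sub_le_zero_of_isClosest {C : Set (E n)} (hC : Convex ℝ C) {x y : E n} (hy : y ∈ C)
    (h : ∀ z ∈ C, ‖x - y‖ ≤ ‖x - z‖) {z : E n} (hz : z ∈ C) : ⟪x - y, z - y⟫ ≤ 0 := by
  refine (norm_eq_iInf_iff_real_inner_le_zero hC hy).1 ?_ z hz
  have : Nonempty C := ⟨⟨y, hy⟩⟩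
  refine le_antisymm (le_ciInf fun w => h w w.2) ?_
  exact ciInf_le ⟨0, by rintro _ ⟨w, rfl⟩; exact norm_nonneg _⟩ (⟨y, hy⟩ : C)

lemma proj_eq {C : Set (E n)} (hc : IsClosed C) (hC : Convex ℝ C) {x y : E n} (hy : y ∈ C)
    (h : ∀ z ∈ C, ‖x - y‖ ≤ ‖x - z‖) : proj C x = y := by
  obtain ⟨h1, h2⟩ := proj_spec hc hC ⟨y, hy⟩ x
  have a := inner_sub_le_zero_of_isClosest hC hy h h1
  have b := inner_sub_le_zero_of_isClosest hC h1 h2 hy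
  have key : ‖proj C x - y‖ ^ 2 ≤ 0 := by
    have e : ‖proj C x - y‖ ^ 2 = ⟪x - y, proj C x - y⟫ + ⟪x - proj C x, y - proj C x⟫ := by
      rw [← real_inner_self_eq_norm_sq]
      have : y - proj C x = -(proj C x - y) := by abel
      rw [this, inner_neg_right, ← sub_eq_add_neg, ← inner_sub_left]
      congr 1; abel
    linarith
  have : ‖proj C x - y‖ = 0 := by nlinarith [norm_nonneg (proj C x - y)]
  exact sub_eq_zero.1 (norm_eq_zero.1 this)

lemma proj_univ (x : E n) : proj univ x = x :=
  proj_eq isClosed_univ convex_univ (mem_univ x) fun z _ => by simp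

lemma norm_proj_sub_proj_le {C : Set (E n)} (hc : IsClosed C) (hC : Convex ℝ C) (hne : C.Nonempty)
    (x y : E n) : ‖proj C x - proj C y‖ ≤ ‖x - y‖ := by
  obtain ⟨h1, h2⟩ := proj_spec hc hC hne x
  obtain ⟨h3, h4⟩ := proj_spec hc hC hne y
  have a := inner_sub_le_zero_of_isClosest hC h1 h2 h3
  have b := inner_sub_le_zero_of_isClosest hC h3 h4 h1
  set p := proj C x
  set q := proj C y
  have e : ‖p - q‖ ^ 2 ≤ ⟪x - y, p - q⟫ := by
    have e : ‖p - q‖ ^ 2 = ⟪x - y, p - q⟫ + ⟪x - p, q - p⟫ + ⟪y - q, p - q⟫ := by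
      rw [← real_inner_self_eq_norm_sq]
      have : q - p = -(p - q) := by abel
      rw [this, inner_neg_right, ← sub_eq_add_neg, ← inner_sub_left, ← inner_add_left]
      congr 1; abel
    linarith
  have h5 := real_inner_le_norm (x - y) (p - q)
  by_contra! hlt
  nlinarith [norm_nonneg (x - y), norm_nonneg (p - q)]

lemma continuous_proj {C : Set (E n)} (hc : IsClosed C) (hC : Convex ℝ C) (hne : C.Nonempty) :
    Continuous (proj C) := by
  have : LipschitzWith 1 (proj C) := LipschitzWith.of_dist_le_mul fun x y => by
    simpa [dist_eq_norm] using norm_proj_sub_proj_le hc hC hne x y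
  exact this.continuous

/-- Projecting onto a ball is a homothety, of positive ratio, with respect to the centre. This is
what makes SGD projected onto a ball a first-order iterative algorithm. -/
lemma exists_proj_closedBall_eq {x₀ : E n} {R : ℝ} (hR : 0 < R) (x : E n) :
    ∃ c : ℝ, 0 < c ∧ proj (Metric.closedBall x₀ R) x = x₀ + c • (x - x₀) := by
  by_cases h : ‖x - x₀‖ ≤ R
  · refine ⟨1, one_pos, ?_⟩
    rw [proj_eq Metric.isClosed_closedBall (convex_closedBall _ _) (y := x)]
    · simp
    · simpa [dist_eq_norm] using h
    · simp
  · push Not at h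
    have hx : 0 < ‖x - x₀‖ := hR.trans h
    refine ⟨R / ‖x - x₀‖, by positivity, ?_⟩
    apply proj_eq Metric.isClosed_closedBall (convex_closedBall _ _)
    · simp only [Metric.mem_closedBall, dist_eq_norm, add_sub_cancel_left, norm_smul, norm_div,
        norm_norm, Real.norm_of_nonneg hR.le]
      rw [div_mul_cancel₀ _ hx.ne']
    · intro z hz
      rw [Metric.mem_closedBall, dist_eq_norm] at hz
      have e : x - (x₀ + (R / ‖x - x₀‖) • (x - x₀)) = (1 - R / ‖x - x₀‖) • (x - x₀) := by
        rw [sub_smul, one_smul]; abel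
      have hle : R / ‖x - x₀‖ ≤ 1 := (div_le_one hx).2 h.le
      rw [e, norm_smul, Real.norm_of_nonneg (by linarith), sub_mul, one_mul,
        div_mul_cancel₀ _ hx.ne']
      have : ‖x - x₀‖ ≤ ‖x - z‖ + ‖z - x₀‖ := norm_sub_le_norm_sub_add_norm_sub x z x₀
      linarith

/-! ### Subgradients, strong convexity and smoothness -/

/-- Letting `l → 0` in a family of linear inequalities. -/
lemma add_le_of_forall_mem_Ioo {A B c : ℝ} (hc : 0 ≤ c)
    (h : ∀ l ∈ Ioo (0 : ℝ) 1, A + (1 - l) * c ≤ B) : A + c ≤ B := by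
  by_contra! hlt
  have h1 : 0 < A + c - B := by linarith
  have h2 : 0 < A + c - B + c + 1 := by linarith
  have := h ((A + c - B) / (A + c - B + c + 1))
    ⟨by positivity, by rw [div_lt_one h2]; linarith⟩
  have h3 : (A + c - B) / (A + c - B + c + 1) * c < A + c - B := by
    rw [div_mul_eq_mul_div, div_lt_iff₀ h2]; nlinarith
  nlinarith

lemma IsSubgradient.add_sq_le {f : E n → ℝ} {C : Set (E n)} {μ : ℝ} (hμ : 0 ≤ μ)
    (hf : StrongConvexOn C μ f) {x z v : E n} (hx : x ∈ C) (hz : z ∈ C)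
    (hv : IsSubgradient f x v) : f x + ⟪v, z - x⟫ + μ / 2 * ‖x - z‖ ^ 2 ≤ f z := by
  refine add_le_of_forall_mem_Ioo (by positivity) fun l hl => ?_
  have h1 := hf.2 hx hz (sub_nonneg.2 hl.2.le) hl.1.le (sub_add_cancel 1 l)
  have h2 := hv ((1 - l) • x + l • z)
  have e : (1 - l) • x + l • z - x = l • (z - x) := by
    rw [sub_smul, smul_sub, one_smul]; abel
  rw [e, inner_smul_right] at h2
  simp only [smul_eq_mul] at h1
  have : l * (f x + ⟪v, z - x⟫ + (1 - l) * (μ / 2 * ‖x - z‖ ^ 2)) ≤ l * f z := by nlinarith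
  exact le_of_mul_le_mul_left this hl.1

lemma _root_.IsMinOn.add_sq_le_of_strongConvexOn {f : E n → ℝ} {C : Set (E n)} {μ : ℝ} (hμ : 0 ≤ μ)
    (hf : StrongConvexOn C μ f) {x z : E n} (hx : x ∈ C) (hz : z ∈ C) (hmin : IsMinOn f C z) :
    f z + μ / 2 * ‖x - z‖ ^ 2 ≤ f x := by
  refine add_le_of_forall_mem_Ioo (by positivity) fun l hl => ?_
  have h1 := hf.2 hz hx (sub_nonneg.2 hl.2.le) hl.1.le (sub_add_cancel 1 l)
  have h2 : f z ≤ f ((1 - l) • z + l • x) :=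
    hmin (hf.1 hz hx (by linarith [hl.2]) hl.1.le (by ring))
  rw [norm_sub_rev z x] at h1
  simp only [smul_eq_mul] at h1
  have : l * (f z + (1 - l) * (μ / 2 * ‖x - z‖ ^ 2)) ≤ l * f x := by nlinarith
  exact le_of_mul_le_mul_left this hl.1

/-- A function has no subgradient other than its gradient where it is differentiable. -/
lemma IsSubgradient.eq_gradient {f : E n → ℝ} {x v : E n} (hv : IsSubgradient f x v)
    (hf : DifferentiableAt ℝ f x) : v = gradient f x := by
  have hmin : IsLocalMin (fun y => f y - ⟪v, y⟫) x := by
    refine Filter.Eventually.of_forall fun y => ?_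
    have := hv y
    rw [inner_sub_right] at this
    show f x - ⟪v, x⟫ ≤ f y - ⟪v, y⟫
    linarith
  have h0 := hmin.fderiv_eq_zero
  have hd : HasFDerivAt (fun y => f y - ⟪v, y⟫) (fderiv ℝ f x - innerSL ℝ v) x :=
    hf.hasFDerivAt.sub (innerSL ℝ v).hasFDerivAt
  rw [hd.fderiv] at h0
  apply ext_inner_right ℝ
  intro y
  have h1 := hf.hasGradientAt.hasFDerivAt.fderiv
  have h2 : fderiv ℝ f x y = ⟪v, y⟫ := by
    have := congrArg (fun F : E n →L[ℝ] ℝ => F y) h0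
    simpa [sub_eq_zero] using this
  rw [← h2, h1]
  simp

/-- A real function with a subgradient everywhere is convex. -/
lemma convexOn_univ_of_isSubgradient {f : E n → ℝ} (h : ∀ x, ∃ v, IsSubgradient f x v) :
    ConvexOn ℝ univ f := by
  refine ⟨convex_univ, fun x _ y _ a b ha hb hab => ?_⟩
  obtain ⟨v, hv⟩ := h (a • x + b • y)
  have h1 := hv x
  have h2 := hv y
  have e : a * ⟪v, x - (a • x + b • y)⟫ + b * ⟪v, y - (a • x + b • y)⟫ = 0 := by
    simp only [inner_sub_right, inner_add_right, inner_smul_right]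
    have : a = 1 - b := by linarith
    subst this; ring
  simp only [smul_eq_mul]
  have : f (a • x + b • y) = a * f (a • x + b • y) + b * f (a • x + b • y) := by
    rw [← add_mul, hab, one_mul]
  nlinarith

lemma lipschitzOnWith_of_isSubgradient {f : E n → ℝ} {U : Set (E n)} {G : ℝ≥0}
    (h : ∀ x ∈ U, ∃ v, IsSubgradient f x v ∧ ‖v‖ ≤ G) : LipschitzOnWith G f U := by
  have key : ∀ x ∈ U, ∀ y, f x - f y ≤ G * ‖x - y‖ := by
    intro x hx y
    obtain ⟨v, hv, hG⟩ := h x hx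
    have h1 := hv y
    have h2 := real_inner_le_norm v (x - y)
    have e : ⟪v, y - x⟫ = -⟪v, x - y⟫ := by rw [← inner_neg_right, neg_sub]
    nlinarith [norm_nonneg (x - y)]
  refine LipschitzOnWith.of_dist_le_mul fun x hx y hy => ?_
  rw [dist_eq_norm, dist_eq_norm, Real.norm_eq_abs, abs_le]
  have := key y hy x
  rw [norm_sub_rev] at this
  exact ⟨by linarith, key x hx y⟩

lemma IsSubgradient.norm_le {f : E n → ℝ} {U : Set (E n)} (hU : IsOpen U) {G : ℝ≥0}
    (hf : LipschitzOnWith G f U) {x v : E n} (hx : x ∈ U) (hv : IsSubgradient f x v) : ‖v‖ ≤ G := by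
  rcases eq_or_ne v 0 with rfl | hv0
  · simp
  have hv' : 0 < ‖v‖ := norm_pos_iff.2 hv0
  obtain ⟨r, hr, hball⟩ := Metric.isOpen_iff.1 hU x hx
  have hy : x + (r / 2 / ‖v‖) • v ∈ U := hball (by
    rw [Metric.mem_ball, dist_eq_norm, add_sub_cancel_left, norm_smul, norm_div, norm_norm,
      div_mul_cancel₀ _ hv'.ne', Real.norm_of_nonneg (by positivity)]
    linarith)
  have h1 := hv (x + (r / 2 / ‖v‖) • v)
  have h2 := hf.norm_sub_le hy hx
  rw [add_sub_cancel_left, inner_smul_right, real_inner_self_eq_norm_sq] at h1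
  rw [add_sub_cancel_left, norm_smul, norm_div, norm_norm, Real.norm_of_nonneg
    (by positivity : 0 ≤ r / 2)] at h2
  have h3 := le_abs_self (f (x + (r / 2 / ‖v‖) • v) - f x)
  rw [← Real.norm_eq_abs] at h3
  have h4 : r / 2 / ‖v‖ * ‖v‖ ^ 2 = r / 2 * ‖v‖ := by field_simp
  have h5 : r / 2 / ‖v‖ * ‖v‖ = r / 2 := by field_simp
  rw [h5] at h2
  rw [h4] at h1
  by_contra! hlt
  nlinarith

/-- The descent lemma. -/
lemma IsSmooth.le_add_sq {f : E n → ℝ} {L : ℝ≥0} (hf : IsSmooth L f) (x y : E n) :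
    f y ≤ f x + ⟪gradient f x, y - x⟫ + L / 2 * ‖y - x‖ ^ 2 := by
  set w := y - x with hw
  set ψ : ℝ → ℝ := fun s => f (x + s • w) - s * ⟪gradient f x, w⟫ - L / 2 * s ^ 2 * ‖w‖ ^ 2 with hψ
  have hd : ∀ s, HasDerivAt ψ
      (⟪gradient f (x + s • w), w⟫ - ⟪gradient f x, w⟫ - L * s * ‖w‖ ^ 2) s := by
    intro s
    have h1 : HasDerivAt (fun s : ℝ => x + s • w) w s := by
      simpa using ((hasDerivAt_id s).smul_const w).const_add x
    have h2 := ((hf.1 (x + s • w)).hasGradientAt.hasFDerivAt).comp_hasDerivAt s h1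
    have h3 := (h2.sub ((hasDerivAt_id s).mul_const ⟪gradient f x, w⟫)).sub
      ((((hasDerivAt_id s).pow 2).const_mul ((L : ℝ) / 2)).mul_const (‖w‖ ^ 2))
    refine h3.congr_deriv ?_
    rw [InnerProductSpace.toDual_apply_apply]
    push_cast
    simp only [id_eq, mul_one, one_mul, pow_one]
    ring
  have hanti : AntitoneOn ψ (Icc 0 1) := by
    refine antitoneOn_of_deriv_nonpos (convex_Icc _ _)
      (fun s _ => (hd s).continuousAt.continuousWithinAt)
      (fun s _ => (hd s).differentiableAt.differentiableWithinAt) fun s hs => ?_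
    rw [interior_Icc] at hs
    rw [(hd s).deriv, ← inner_sub_left]
    have h1 := real_inner_le_norm (gradient f (x + s • w) - gradient f x) w
    have h2 := hf.2.norm_sub_le (x + s • w) x
    rw [add_sub_cancel_left, norm_smul, Real.norm_of_nonneg hs.1.le] at h2
    nlinarith [norm_nonneg w]
  have := hanti (left_mem_Icc.2 zero_le_one) (right_mem_Icc.2 zero_le_one) zero_le_one
  simp only [hψ, one_smul, zero_smul, add_zero, one_mul, zero_mul, one_pow, mul_one, mul_zero,
    sub_zero, zero_pow two_ne_zero] at this
  rw [hw, add_sub_cancel] at this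
  linarith

/-- Cocoercivity of the gradient of a smooth convex function. -/
lemma IsSmooth.norm_sq_sub_le {f : E n → ℝ} {L : ℝ≥0} (hL : 0 < L) (hf : IsSmooth L f)
    {x y v w : E n} (hv : IsSubgradient f x v) (hw : IsSubgradient f y w) :
    ‖v - w‖ ^ 2 ≤ L * ⟪v - w, x - y⟫ := by
  have hL' : (0 : ℝ) < L := hL
  -- Compare the two functions at the minimizer of the quadratic upper bound, tilted by `v`.
  have key : ∀ {x y v w : E n}, IsSubgradient f x v → IsSubgradient f y w →
      f x + ⟪v, y - x⟫ + 1 / (2 * L) * ‖v - w‖ ^ 2 ≤ f y := by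
    intro x y v w hv hw
    have h1 := hv (y + (1 / (L : ℝ)) • (v - w))
    have h2 := hf.le_add_sq y (y + (1 / (L : ℝ)) • (v - w))
    rw [← hw.eq_gradient (hf.1 y), add_sub_cancel_left, inner_smul_right, norm_smul,
      Real.norm_of_nonneg (by positivity)] at h2
    have e : y + (1 / (L : ℝ)) • (v - w) - x = (y - x) + (1 / (L : ℝ)) • (v - w) := by abel
    rw [e, inner_add_right, inner_smul_right] at h1
    have e2 : ‖v - w‖ ^ 2 = ⟪v, v - w⟫ - ⟪w, v - w⟫ := by
      rw [← inner_sub_left, real_inner_self_eq_norm_sq]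
    have e3 : (L : ℝ) / 2 * (1 / L * ‖v - w‖) ^ 2 = 1 / (2 * L) * ‖v - w‖ ^ 2 := by field_simp
    have e4 : 1 / (L : ℝ) * ⟪v, v - w⟫ - 1 / (L : ℝ) * ⟪w, v - w⟫ =
        2 * (1 / (2 * L) * ‖v - w‖ ^ 2) := by
      rw [e2]; field_simp
    rw [e3] at h2
    linarith
  have h1 := key hv hw
  have h2 := key hw hv
  rw [norm_sub_rev w v] at h2
  have e : ⟪v - w, x - y⟫ = -⟪v, y - x⟫ - ⟪w, x - y⟫ := by
    rw [inner_sub_left, ← inner_neg_right, neg_sub]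
  have h3 : 1 / (L : ℝ) * ‖v - w‖ ^ 2 ≤ ⟪v - w, x - y⟫ := by
    have : 1 / (L : ℝ) * ‖v - w‖ ^ 2 = 2 * (1 / (2 * L) * ‖v - w‖ ^ 2) := by field_simp
    linarith
  calc ‖v - w‖ ^ 2 = L * (1 / (L : ℝ) * ‖v - w‖ ^ 2) := by field_simp
    _ ≤ _ := by gcongr

/-! ### The randomness of a run -/

/-- Resampling one coordinate preserves the law of an i.i.d. sequence. -/
lemma lintegral_infinitePi_update {S : Type*} [MeasurableSpace S] (ν : Measure S)
    [IsProbabilityMeasure ν] (t : ℕ) {H : (ℕ → S) → ℝ≥0∞} (hH : Measurable H) :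
    ∫⁻ s, H s ∂(Measure.infinitePi fun _ : ℕ => ν) =
      ∫⁻ s, ∫⁻ u, H (Function.update s t u) ∂ν ∂(Measure.infinitePi fun _ : ℕ => ν) := by
  set P := Measure.infinitePi fun _ : ℕ => ν with hP
  have hm : Measurable fun p : (ℕ → S) × S => Function.update p.1 t p.2 := by
    refine measurable_pi_lambda _ fun i => ?_
    by_cases h : i = t
    · subst h; simpa using measurable_snd
    · simpa [Function.update_of_ne h, Function.comp_def] using
        (measurable_pi_apply i).comp measurable_fst
  have hmap : (P.prod ν).map (fun p => Function.update p.1 t p.2) = P := by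
    refine Measure.eq_infinitePi _ fun I B hB => ?_
    rw [Measure.map_apply hm (MeasurableSet.pi I.countable_toSet fun i _ => hB i)]
    by_cases ht : t ∈ I
    · have : (fun p : (ℕ → S) × S => Function.update p.1 t p.2) ⁻¹' (I : Set ℕ).pi B =
          ((I.erase t : Finset ℕ) : Set ℕ).pi B ×ˢ B t := by
        ext p
        simp only [mem_preimage, mem_pi, Finset.mem_coe, mem_prod, Finset.mem_erase]
        constructor
        · refine fun h => ⟨fun i hi => by simpa [Function.update_of_ne hi.1] using h i hi.2, ?_⟩
          simpa using h t ht
        · rintro ⟨h1, h2⟩ i hi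
          by_cases hit : i = t
          · subst hit; simpa using h2
          · simpa [Function.update_of_ne hit] using h1 i ⟨hit, hi⟩
      rw [this, Measure.prod_prod, hP, Measure.infinitePi_pi _ fun i _ => hB i,
        Finset.prod_erase_mul _ _ ht]
    · have : (fun p : (ℕ → S) × S => Function.update p.1 t p.2) ⁻¹' (I : Set ℕ).pi B =
          (I : Set ℕ).pi B ×ˢ univ := by
        ext p
        simp only [mem_preimage, mem_pi, Finset.mem_coe, mem_prod, mem_univ, and_true]
        refine forall₂_congr fun i hi => ?_
        rw [Function.update_of_ne (ne_of_mem_of_not_mem hi ht)]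
      rw [this, Measure.prod_prod, hP, Measure.infinitePi_pi _ fun i _ => hB i]
      simp
  conv_lhs => rw [← hmap]
  rw [lintegral_map hH hm]
  exact lintegral_prod _ (hH.comp hm).aemeasurable

namespace Algorithm

variable (A : Algorithm n) (O : StochasticOracle n)

instance : IsProbabilityMeasure (A.runLaw O) := by
  unfold runLaw; infer_instance

lemma answers_succ (c : A.Coin) (s : ℕ → O.Seed) (t : ℕ) :
    A.answers O c s (t + 1) = Fin.snoc (α := fun _ => E n) (A.answers O c s t)
      (O.out t (A.point t (A.answers O c s t) c) (s t)) := rfl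

lemma answers_congr (c : A.Coin) {s s' : ℕ → O.Seed} {t : ℕ} (h : ∀ i < t, s i = s' i) :
    A.answers O c s t = A.answers O c s' t := by
  induction t with
  | zero => rfl
  | succ t ih => rw [answers_succ, answers_succ, ih fun i hi => h i (by omega), h t (by omega)]

lemma answers_update (c : A.Coin) (s : ℕ → O.Seed) (t : ℕ) (u : O.Seed) :
    A.answers O c (Function.update s t u) t = A.answers O c s t :=
  A.answers_congr O c fun i hi => by rw [Function.update_of_ne hi.ne]

lemma answers_apply (c : A.Coin) (s : ℕ → O.Seed) (t : ℕ) (i : Fin t) :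
    A.answers O c s t i = O.out i (A.point i (A.answers O c s i) c) (s i) := by
  induction t with
  | zero => exact i.elim0
  | succ t ih =>
    rw [answers_succ]
    refine Fin.lastCases ?_ (fun j => ?_) i
    · simp
    · rw [Fin.snoc_castSucc, ih]; rfl

lemma measurable_snoc {t : ℕ} :
    Measurable fun p : (Fin t → E n) × E n => Fin.snoc (α := fun _ => E n) p.1 p.2 := by
  refine measurable_pi_lambda _ fun i => ?_
  refine Fin.lastCases ?_ (fun j => ?_) i
  · simpa using measurable_snd
  · simpa [Function.comp_def] using (measurable_pi_apply j).comp measurable_fst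

variable {A} in
lemma measurable_answers (hA : A.IsMeasurable) (t : ℕ) :
    Measurable fun ω : A.Coin × (ℕ → O.Seed) => A.answers O ω.1 ω.2 t := by
  induction t with
  | zero => exact measurable_const
  | succ t ih =>
    simp only [answers_succ]
    refine measurable_snoc.comp (ih.prodMk ?_)
    refine (O.measurable_out t).comp (Measurable.prodMk ?_ ?_)
    · exact (hA t).comp (ih.prodMk measurable_fst)
    · exact (measurable_pi_apply t).comp measurable_snd

variable {A} in
lemma measurable_output (hA : A.IsMeasurable) (T : ℕ) : Measurable (A.output O T) :=
  (hA T).comp ((measurable_answers O hA T).prodMk measurable_fst)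

lemma lintegral_runLaw {F : A.Coin × (ℕ → O.Seed) → ℝ≥0∞} (hF : Measurable F) :
    ∫⁻ ω, F ω ∂A.runLaw O =
      ∫⁻ c, ∫⁻ s, F (c, s) ∂(Measure.infinitePi fun _ : ℕ => O.law) ∂A.coinLaw :=
  lintegral_prod _ hF.aemeasurable

variable {A} in
lemma deviation_eq (hA : A.IsMeasurable) (T : ℕ) : A.deviation O T =
    ∫⁻ ω, ∫⁻ ω', ‖A.output O T ω - A.output O T ω'‖ₑ ^ 2 ∂A.runLaw O ∂A.runLaw O := by
  have hm := measurable_output O hA T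
  have h : Measurable fun p : (A.Coin × (ℕ → O.Seed)) × (A.Coin × (ℕ → O.Seed)) =>
      ‖A.output O T p.1 - A.output O T p.2‖ₑ ^ 2 :=
    ((hm.comp measurable_fst).sub (hm.comp measurable_snd)).enorm.pow_const 2
  exact lintegral_prod _ h.aemeasurable

end Algorithm

/-! ### The iterates of averaged SGD -/

/-- The iterates of projected SGD driven by the oracle `O` with seeds `s`. -/
noncomputable def sgdRun (O : StochasticOracle n) (C : Set (E n)) (x₀ : E n) (η : ℕ → ℝ)
    (s : ℕ → O.Seed) : ℕ → E n
  | 0 => x₀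
  | t + 1 => proj C (sgdRun O C x₀ η s t - η t • O.out t (sgdRun O C x₀ η s t) (s t))

section Run

variable (O : StochasticOracle n) (C : Set (E n)) (x₀ : E n) (η : ℕ → ℝ)

lemma sgdIterate_eq_sgdRun (s : ℕ → O.Seed) {g : ℕ → E n} {t : ℕ}
    (h : ∀ i < t, g i = O.out i (sgdRun O C x₀ η s i) (s i)) :
    sgdIterate C x₀ η g t = sgdRun O C x₀ η s t := by
  induction t with
  | zero => rfl
  | succ t ih => rw [sgdIterate, sgdRun, ih fun i hi => h i (by omega), h t (by omega)]

lemma averagedSGD_answers (w : ℕ → ℝ) (T : ℕ) (c : (averagedSGD C x₀ η w T).Coin)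
    (s : ℕ → O.Seed) :
    ∀ t ≤ T, (averagedSGD C x₀ η w T).answers O c s t =
      fun i : Fin t => O.out i (sgdRun O C x₀ η s i) (s i) := by
  intro t
  induction t using Nat.strong_induction_on with
  | _ t ih =>
    intro ht
    funext i
    rw [Algorithm.answers_apply, ih i i.2 (by omega)]
    have hi : (i : ℕ) ≠ T := by omega
    simp only [averagedSGD, if_neg hi]
    rw [sgdIterate_eq_sgdRun O C x₀ η s fun j hj => by simp [hj]]

lemma averagedSGD_output (w : ℕ → ℝ) (T : ℕ)
    (ω : (averagedSGD C x₀ η w T).Coin × (ℕ → O.Seed)) :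
    (averagedSGD C x₀ η w T).output O T ω =
      (∑ t ∈ Finset.Icc 1 T, w t)⁻¹ • ∑ t ∈ Finset.Icc 1 T, w t • sgdRun O C x₀ η ω.2 t := by
  rw [Algorithm.output, averagedSGD_answers O C x₀ η w T ω.1 ω.2 T le_rfl]
  simp only [averagedSGD, if_true]
  congr 1
  refine Finset.sum_congr rfl fun t ht => ?_
  rw [Finset.mem_Icc] at ht
  rw [sgdIterate_eq_sgdRun O C x₀ η ω.2 fun j hj => by
    have : j < T := by omega
    simp [this]]

lemma sgdRun_update (s : ℕ → O.Seed) (u : O.Seed) {t k : ℕ} (hk : k ≤ t) :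
    sgdRun O C x₀ η (Function.update s t u) k = sgdRun O C x₀ η s k := by
  induction k with
  | zero => rfl
  | succ k ih => rw [sgdRun, sgdRun, ih (by omega), Function.update_of_ne (by omega)]

variable {C x₀}

lemma sgdRun_mem (hc : IsClosed C) (hC : Convex ℝ C) (hx₀ : x₀ ∈ C) (s : ℕ → O.Seed) (t : ℕ) :
    sgdRun O C x₀ η s t ∈ C := by
  cases t with
  | zero => exact hx₀
  | succ t => exact (proj_spec hc hC ⟨x₀, hx₀⟩ _).1

lemma measurable_sgdRun (hc : IsClosed C) (hC : Convex ℝ C) (hx₀ : x₀ ∈ C) (t : ℕ) :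
    Measurable fun s => sgdRun O C x₀ η s t := by
  induction t with
  | zero => exact measurable_const
  | succ t ih =>
    simp only [sgdRun]
    refine (continuous_proj hc hC ⟨x₀, hx₀⟩).measurable.comp (ih.sub
      (Measurable.fun_const_smul ?_ _))
    exact (O.measurable_out t).comp (ih.prodMk (measurable_pi_apply t))

lemma measurable_sgdIterate {α : Type*} [MeasurableSpace α] (hc : IsClosed C) (hC : Convex ℝ C)
    (hx₀ : x₀ ∈ C) {g : α → ℕ → E n} (hg : ∀ i, Measurable fun a => g a i) (t : ℕ) :
    Measurable fun a => sgdIterate C x₀ η (g a) t := by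
  induction t with
  | zero => exact measurable_const
  | succ t ih =>
    exact (continuous_proj hc hC ⟨x₀, hx₀⟩).measurable.comp (ih.sub ((hg t).fun_const_smul _))

lemma averagedSGD_isMeasurable (hc : IsClosed C) (hC : Convex ℝ C) (hx₀ : x₀ ∈ C) (w : ℕ → ℝ)
    (T : ℕ) : (averagedSGD C x₀ η w T).IsMeasurable := by
  intro t
  have h : ∀ k, Measurable fun p : (Fin t → E n) × Unit => sgdIterate C x₀ η
      (fun i => if hi : i < t then p.1 ⟨i, hi⟩ else 0) k := by
    refine measurable_sgdIterate η hc hC hx₀ fun i => ?_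
    by_cases hi : i < t
    · simpa [hi, Function.comp_def] using (measurable_pi_apply _).comp measurable_fst
    · simp [hi]
  by_cases ht : t = T
  · simp only [averagedSGD, if_pos ht]
    exact (Finset.measurable_sum _ fun k _ => (h k).fun_const_smul (w k)).fun_const_smul _
  · simp only [averagedSGD, if_neg ht]
    exact h t

/-! ### Averaged SGD as a first-order iterative algorithm -/

lemma exists_proj_eq_homothety (h : IsWholeSpace n C x₀ ∨ IsBallAround n C x₀) (x : E n) :
    ∃ c : ℝ, 0 < c ∧ proj C x = x₀ + c • (x - x₀) := by
  rcases h with h | ⟨R, hR, rfl⟩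
  · exact ⟨1, one_pos, by rw [h, proj_univ]; simp⟩
  · exact exists_proj_closedBall_eq hR x

variable {η}

lemma exists_sgdIterate_eq (h : IsWholeSpace n C x₀ ∨ IsBallAround n C x₀) (hη : ∀ t, 0 < η t)
    (g : ℕ → E n) (N t : ℕ) (ht : t ≤ N) :
    ∃ l : ℕ → ℝ, (∀ i, t ≤ i → l i = 0) ∧ (∀ i, i + 1 = t → 0 < l i) ∧
      sgdIterate C x₀ η g t = x₀ - ∑ i ∈ Finset.range N, l i • g i := by
  induction t with
  | zero => exact ⟨0, by simp, by simp, by simp [sgdIterate]⟩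
  | succ t ih =>
    obtain ⟨l, h0, -, hl⟩ := ih (by omega)
    obtain ⟨c, hc, hp⟩ := exists_proj_eq_homothety h (sgdIterate C x₀ η g t - η t • g t)
    refine ⟨fun i => c * (l i + if i = t then η t else 0), fun i hi => ?_, fun i hi => ?_, ?_⟩
    · simp [h0 i (by omega), show i ≠ t by omega]
    · obtain rfl : i = t := by omega
      simp [h0 i le_rfl, hc, hη]
    · rw [sgdIterate, hp, hl]
      have : ∑ i ∈ Finset.range N, (c * (l i + if i = t then η t else 0)) • g i =
          c • (∑ i ∈ Finset.range N, l i • g i + η t • g t) := by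
        simp only [mul_smul, ← Finset.smul_sum, add_smul, Finset.sum_add_distrib, ite_smul,
          zero_smul]
        rw [Finset.sum_ite_eq' (Finset.range N) t, if_pos (Finset.mem_range.2 (by omega))]
      rw [this]
      module

lemma averagedSGD_isFOILatest (h : IsWholeSpace n C x₀ ∨ IsBallAround n C x₀) (hη : ∀ t, 0 < η t)
    {w : ℕ → ℝ} (hw : ∀ t, 1 ≤ t → 0 < w t) {T : ℕ} (hT : 1 ≤ T) :
    (averagedSGD C x₀ η w T).IsFOILatest x₀ := by
  intro t a c
  set g : ℕ → E n := fun i => if hi : i < t then a ⟨i, hi⟩ else 0 with hg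
  have hga : ∀ i : Fin t, g i = a i := fun i => by simp [hg]
  by_cases ht : t = T
  · subst ht
    choose! l h0 hpos hl using exists_sgdIterate_eq h hη g t
    set W := ∑ k ∈ Finset.Icc 1 t, w k with hW
    have hWpos : 0 < W := Finset.sum_pos (fun k hk => hw k (Finset.mem_Icc.1 hk).1)
      ⟨t, Finset.mem_Icc.2 ⟨hT, le_rfl⟩⟩
    refine ⟨fun i => W⁻¹ * ∑ k ∈ Finset.Icc 1 t, w k * l k i, fun i hi => ?_, ?_⟩
    · have : ∑ k ∈ Finset.Icc 1 t, w k * l k i = w t * l t i := by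
        refine Finset.sum_eq_single_of_mem t (Finset.mem_Icc.2 ⟨hT, le_rfl⟩) fun k hk hkt => ?_
        have := Finset.mem_Icc.1 hk
        rw [h0 k this.2 i (by omega), mul_zero]
      simp only [this]
      exact (mul_pos (inv_pos.2 hWpos) (mul_pos (hw t hT) (hpos t le_rfl i hi))).ne'
    · simp only [averagedSGD, if_true]
      have e : ∑ k ∈ Finset.Icc 1 t, w k • sgdIterate C x₀ η g k =
          W • x₀ - ∑ i : Fin t, (∑ k ∈ Finset.Icc 1 t, w k * l k i) • a i := by
        have h1 : ∀ k ∈ Finset.Icc 1 t, w k • sgdIterate C x₀ η g k =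
            w k • x₀ - ∑ i : Fin t, (w k * l k i) • a i := by
          intro k hk
          rw [hl k (Finset.mem_Icc.1 hk).2, smul_sub, Finset.smul_sum,
            Finset.sum_range fun i => w k • l k i • g i]
          simp only [smul_smul, hga]
        rw [Finset.sum_congr rfl h1, Finset.sum_sub_distrib, ← Finset.sum_smul, Finset.sum_comm]
        simp only [Finset.sum_smul, hW]
      rw [e, smul_sub, smul_smul, inv_mul_cancel₀ hWpos.ne', one_smul, Finset.smul_sum]
      simp only [smul_smul, hW]
  · obtain ⟨l, -, hpos, hl⟩ := exists_sgdIterate_eq h hη g t t le_rfl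
    refine ⟨fun i => l i, fun i hi => (hpos i hi).ne', ?_⟩
    simp only [averagedSGD, if_neg ht]
    rw [hl, Finset.sum_range fun i => l i • g i]
    simp only [hga]

lemma Algorithm.IsFOILatest.isFOI {A : Algorithm n} {x₀ : E n} (h : A.IsFOILatest x₀) :
    A.IsFOI x₀ := fun t a c => by
  obtain ⟨l, -, hl⟩ := h t a c
  exact ⟨l, hl⟩

end Run

/-! ### One stochastic step -/

/-- The deterministic estimates that drive the analysis of SGD with step `η`: `v`, `w` are
subgradients, `ξ` is the noise of an oracle answer, and `z` is the minimizer. In `descent`, the gap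
is taken after the step, which matches an average of the iterates `x₁, …, x_T`, and the noise is
paired with a vector that is known before the step, so that this term has mean zero. The constant
`κ₃` measures how far a gradient step fails to be a contraction: it vanishes for smooth objectives,
which is why the deviation scales with `δ²` there. -/
structure StepBounds (f : E n → ℝ) (C : Set (E n)) (z : E n) (μ κ₁ κ₂ κ₃ η : ℝ) : Prop where
  descent : ∀ x ∈ C, ∀ v, IsSubgradient f x v → ∀ ξ : E n,
    2 * η * (f (proj C (x - η • (v + ξ))) - f z) + ‖proj C (x - η • (v + ξ)) - z‖ ^ 2 ≤
      (1 - η * μ) * ‖x - z‖ ^ 2 - 2 * η * ⟪ξ, x - z⟫ + η ^ 2 * (κ₁ + κ₂ * ‖ξ‖ ^ 2)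
  contraction : ∀ x ∈ C, ∀ y ∈ C, ∀ v w, IsSubgradient f x v → IsSubgradient f y w →
    ‖x - y - η • (v - w)‖ ^ 2 ≤ (1 - η * μ) * ‖x - y‖ ^ 2 + η ^ 2 * κ₃

lemma enorm_sq_eq_ofReal (x : E n) : ‖x‖ₑ ^ 2 = ENNReal.ofReal (‖x‖ ^ 2) := by
  rw [ENNReal.ofReal_pow (norm_nonneg _), ofReal_norm]

lemma inner_sub_proj_le {C : Set (E n)} (hc : IsClosed C) (hC : Convex ℝ C) {y z : E n}
    (hz : z ∈ C) : ⟪y - proj C y, z - proj C y⟫ ≤ 0 := by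
  obtain ⟨h1, h2⟩ := proj_spec hc hC ⟨z, hz⟩ y
  exact inner_sub_le_zero_of_isClosest hC h1 h2 hz

/-- The three-point inequality for a projected gradient step. -/
lemma two_mul_inner_proj_le {C : Set (E n)} (hc : IsClosed C) (hC : Convex ℝ C) {x z : E n}
    (hz : z ∈ C) (d : E n) : 2 * ⟪d, proj C (x - d) - z⟫ ≤
      ‖x - z‖ ^ 2 - ‖proj C (x - d) - z‖ ^ 2 - ‖proj C (x - d) - x‖ ^ 2 := by
  have h := inner_sub_proj_le hc hC (y := x - d) hz
  set p := proj C (x - d)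
  have e1 : x - d - p = -((p - x) + d) := by abel
  have e2 : z - p = -(p - z) := by abel
  rw [e1, e2, inner_neg_neg, inner_add_left] at h
  have e3 : ‖x - z‖ ^ 2 = ‖p - z‖ ^ 2 - 2 * ⟪p - x, p - z⟫ + ‖p - x‖ ^ 2 := by
    have : x - z = (p - z) - (p - x) := by abel
    rw [this, norm_sub_sq_real, real_inner_comm]
  linarith

/-- Smooth objectives, with a step of at most `1 / (2 L)`. Contraction comes from cocoercivity. -/
lemma stepBounds_of_isSmooth {f : E n → ℝ} {C : Set (E n)} {z : E n} {L : ℝ≥0} {μ η : ℝ}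
    (hc : IsClosed C) (hC : Convex ℝ C) (hL : 0 < L) (hf : IsSmooth L f) (hμ : 0 ≤ μ)
    (hs : StrongConvexOn C μ f) (hz : z ∈ C) (hη : 0 < η) (hηL : η * L ≤ 1 / 2) :
    StepBounds f C z μ 0 2 0 η where
  descent x hx v hv ξ := by
    have h1 := two_mul_inner_proj_le hc hC (x := x) hz (η • (v + ξ))
    set p := proj C (x - η • (v + ξ))
    have h2 := hf.le_add_sq x p
    rw [← hv.eq_gradient (hf.1 x)] at h2
    have h3 := hv.add_sq_le hμ hs hx hz
    rw [inner_smul_left, inner_add_left] at h1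
    simp only [conj_trivial] at h1
    have e1 : ⟪v, p - z⟫ = ⟪v, p - x⟫ - ⟪v, z - x⟫ := by
      rw [← inner_sub_right]; congr 1; abel
    have e2 : ⟪ξ, p - z⟫ = ⟪ξ, x - z⟫ + ⟪ξ, p - x⟫ := by
      rw [← inner_add_right]; congr 1; abel
    have h4 : -⟪ξ, p - x⟫ ≤ ‖ξ‖ * ‖p - x‖ := by
      have := abs_real_inner_le_norm ξ (p - x)
      linarith [neg_abs_le ⟪ξ, p - x⟫]
    have h5 : 2 * η * (f p - f z) ≤
        2 * η * (⟪v, p - z⟫ + L / 2 * ‖p - x‖ ^ 2 - μ / 2 * ‖x - z‖ ^ 2) := by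
      refine mul_le_mul_of_nonneg_left ?_ (by positivity)
      linarith
    have h6 : 2 * η * (L / 2 * ‖p - x‖ ^ 2) ≤ 1 / 2 * ‖p - x‖ ^ 2 := by
      nlinarith [sq_nonneg ‖p - x‖]
    have h7 : 2 * η * -⟪ξ, p - x⟫ ≤ 2 * η * (‖ξ‖ * ‖p - x‖) :=
      mul_le_mul_of_nonneg_left h4 (by positivity)
    rw [e2] at h1
    nlinarith [sq_nonneg (‖p - x‖ - 2 * η * ‖ξ‖)]
  contraction x hx y hy v w hv hw := by
    have h1 := hf.norm_sq_sub_le hL hv hw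
    have h2 := hv.add_sq_le hμ hs hx hy
    have h3 := hw.add_sq_le hμ hs hy hx
    rw [norm_sub_rev y x] at h3
    have e : ⟪v - w, x - y⟫ = -⟪v, y - x⟫ - ⟪w, x - y⟫ := by
      rw [inner_sub_left, ← inner_neg_right, neg_sub]
    have h4 : μ * ‖x - y‖ ^ 2 ≤ ⟪v - w, x - y⟫ := by linarith
    rw [norm_sub_sq_real, inner_smul_right, norm_smul, Real.norm_of_nonneg hη.le,
      real_inner_comm]
    have h0 : 0 ≤ ⟪v - w, x - y⟫ := le_trans (by positivity) h4
    have h5 : η ^ 2 * ‖v - w‖ ^ 2 ≤ η * (1 / 2 * ⟪v - w, x - y⟫) := by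
      calc η ^ 2 * ‖v - w‖ ^ 2 ≤ η ^ 2 * (L * ⟪v - w, x - y⟫) := by gcongr
        _ = η * ((η * L) * ⟪v - w, x - y⟫) := by ring
        _ ≤ _ := by gcongr
    have h6 : η * (μ * ‖x - y‖ ^ 2) ≤ η * ⟪v - w, x - y⟫ := by gcongr
    nlinarith [mul_nonneg hη.le h0]

/-- Lipschitz objectives, with any step. Subgradients can jump, and contraction holds only up to an
error of the order of the squared step. -/
lemma stepBounds_of_isLipschitzNear {f : E n → ℝ} {C : Set (E n)} {z : E n} {G : ℝ≥0} {μ η : ℝ}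
    (hc : IsClosed C) (hC : Convex ℝ C) (hf : IsLipschitzNear G f C) (hμ : 0 ≤ μ)
    (hs : StrongConvexOn C μ f) (hz : z ∈ C) (hη : 0 < η) :
    StepBounds f C z μ (5 * G ^ 2) 4 (4 * G ^ 2) η := by
  obtain ⟨U, hU, hCU, hL⟩ := hf
  refine ⟨fun x hx v hv ξ => ?_, fun x hx y hy v w hv hw => ?_⟩
  · have hvG := hv.norm_le hU hL (hCU hx)
    have hp := (proj_spec hc hC ⟨z, hz⟩ (x - η • (v + ξ))).1
    have hxx : proj C x = x := proj_eq hc hC hx fun w _ => by simp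
    have h1 := norm_proj_sub_proj_le hc hC ⟨z, hz⟩ (x - η • (v + ξ)) x
    have hzz : proj C z = z := proj_eq hc hC hz fun w _ => by simp
    have h2 := norm_proj_sub_proj_le hc hC ⟨z, hz⟩ (x - η • (v + ξ)) z
    rw [hxx, sub_sub_cancel_left, norm_neg, norm_smul, Real.norm_of_nonneg hη.le] at h1
    rw [hzz] at h2
    set p := proj C (x - η • (v + ξ))
    have h3 := hL.norm_sub_le (hCU hp) (hCU hx)
    have h3' := (le_abs_self _).trans h3
    have h4 := hv.add_sq_le hμ hs hx hz
    have h5 : ‖p - z‖ ^ 2 ≤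
        ‖x - z‖ ^ 2 - 2 * η * (⟪v, x - z⟫ + ⟪ξ, x - z⟫) + η ^ 2 * ‖v + ξ‖ ^ 2 := by
      calc ‖p - z‖ ^ 2 ≤ ‖x - η • (v + ξ) - z‖ ^ 2 := by gcongr
        _ = ‖(x - z) - η • (v + ξ)‖ ^ 2 := by congr 2; abel
        _ = _ := by
          rw [norm_sub_sq_real, inner_smul_right, norm_smul, Real.norm_of_nonneg hη.le,
            real_inner_comm, inner_add_left]
          ring
    have e : ⟪v, z - x⟫ = -⟪v, x - z⟫ := by rw [← inner_neg_right, neg_sub]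
    rw [e] at h4
    have h6 : ‖v + ξ‖ ^ 2 ≤ 2 * G ^ 2 + 2 * ‖ξ‖ ^ 2 := by
      have := norm_add_le v ξ
      have hv2 : ‖v‖ ^ 2 ≤ G ^ 2 := by gcongr
      nlinarith [norm_nonneg (v + ξ), norm_nonneg v, norm_nonneg ξ, sq_nonneg (‖v‖ - ‖ξ‖)]
    have h7 : 2 * η * (f p - f x) ≤ η ^ 2 * (G ^ 2 + ‖v + ξ‖ ^ 2) := by
      have : f p - f x ≤ G * (η * ‖v + ξ‖) :=
        h3'.trans (mul_le_mul_of_nonneg_left h1 G.2)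
      calc 2 * η * (f p - f x) ≤ 2 * η * (G * (η * ‖v + ξ‖)) := by gcongr
        _ = η ^ 2 * (2 * G * ‖v + ξ‖) := by ring
        _ ≤ _ := by
          gcongr
          nlinarith [sq_nonneg ((G : ℝ) - ‖v + ξ‖)]
    have h8 : 2 * η * (f x - f z) ≤ 2 * η * (⟪v, x - z⟫ - μ / 2 * ‖x - z‖ ^ 2) :=
      mul_le_mul_of_nonneg_left (by linarith) (by positivity)
    have h9 : η ^ 2 * ‖v + ξ‖ ^ 2 ≤ η ^ 2 * (2 * G ^ 2 + 2 * ‖ξ‖ ^ 2) := by gcongr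
    nlinarith
  · have h2 := hv.add_sq_le hμ hs hx hy
    have h3 := hw.add_sq_le hμ hs hy hx
    rw [norm_sub_rev y x] at h3
    have e : ⟪v - w, x - y⟫ = -⟪v, y - x⟫ - ⟪w, x - y⟫ := by
      rw [inner_sub_left, ← inner_neg_right, neg_sub]
    have h4 : μ * ‖x - y‖ ^ 2 ≤ ⟪v - w, x - y⟫ := by linarith
    rw [norm_sub_sq_real, inner_smul_right, norm_smul, Real.norm_of_nonneg hη.le,
      real_inner_comm]
    have h5 : ‖v - w‖ ≤ 2 * G := by
      have := norm_sub_le v w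
      linarith [hv.norm_le hU hL (hCU hx), hw.norm_le hU hL (hCU hy)]
    have h6 : (η * ‖v - w‖) ^ 2 ≤ (η * (2 * G)) ^ 2 := by gcongr
    have h7 : η * (μ * ‖x - y‖ ^ 2) ≤ η * ⟪v - w, x - y⟫ := by gcongr
    have h8 : 0 ≤ η * (μ * ‖x - y‖ ^ 2) := by positivity
    nlinarith

section Noise

variable {O : StochasticOracle n} {f : E n → ℝ} {C : Set (E n)} {δ : ℝ}

/-- The mean of the answer to the `t`-th query, made at `x`. -/
noncomputable def StochasticOracle.mean (O : StochasticOracle n) (t : ℕ) (x : E n) : E n :=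
  ∫ u, O.out t x u ∂O.law

lemma StochasticOracle.measurable_out_const (O : StochasticOracle n) (t : ℕ) (x : E n) :
    Measurable (O.out t x) :=
  (O.measurable_out t).comp measurable_prodMk_left

/-- An affine function of the centred noise has its value at `0` as mean, and the quadratic term
costs at most `k δ²`. Nonnegativity allows a passage from Bochner to Lebesgue integrals. -/
lemma StochasticOracle.IsInexact.lintegral_noise_le (hO : O.IsInexact f C δ) {t : ℕ} {x : E n}
    (hx : x ∈ C) {k b : ℝ} {d : E n} (hk : 0 ≤ k)
    (hpos : ∀ u, 0 ≤ b + ⟪O.out t x u - O.mean t x, d⟫ + k * ‖O.out t x u - O.mean t x‖ ^ 2) :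
    ∫⁻ u, ENNReal.ofReal
      (b + ⟪O.out t x u - O.mean t x, d⟫ + k * ‖O.out t x u - O.mean t x‖ ^ 2) ∂O.law ≤
      ENNReal.ofReal (b + k * δ ^ 2) := by
  obtain ⟨hint, -, hvar⟩ := hO t x hx
  set ξ : O.Seed → E n := fun u => O.out t x u - O.mean t x with hξ
  have hξm : Measurable ξ := (O.measurable_out_const t x).sub_const _
  have hξi : Integrable ξ O.law := hint.sub (integrable_const _)
  have hξ0 : ∫ u, ξ u ∂O.law = 0 := by
    rw [hξ, integral_sub hint (integrable_const _)]
    simp [StochasticOracle.mean]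
  have hvar' : ∫⁻ u, ENNReal.ofReal (‖ξ u‖ ^ 2) ∂O.law ≤ ENNReal.ofReal (δ ^ 2) := by
    simp only [← enorm_sq_eq_ofReal]
    exact hvar
  have hsq : Integrable (fun u => ‖ξ u‖ ^ 2) O.law := by
    refine ⟨(hξm.norm.pow_const 2).aestronglyMeasurable, ?_⟩
    rw [hasFiniteIntegral_iff_ofReal (Filter.Eventually.of_forall fun u => sq_nonneg _)]
    exact hvar'.trans_lt ENNReal.ofReal_lt_top
  have hsq' : ∫ u, ‖ξ u‖ ^ 2 ∂O.law ≤ δ ^ 2 := by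
    rw [← ofReal_integral_eq_lintegral_ofReal hsq
      (Filter.Eventually.of_forall fun u => sq_nonneg _)] at hvar'
    exact (ENNReal.ofReal_le_ofReal_iff (sq_nonneg _)).1 hvar'
  have hi1 : Integrable (fun u => b + ⟪ξ u, d⟫) O.law :=
    (integrable_const b).add (hξi.inner_const d)
  have hi2 : Integrable (fun u => b + ⟪ξ u, d⟫ + k * ‖ξ u‖ ^ 2) O.law := hi1.add (hsq.const_mul k)
  change ∫⁻ u, ENNReal.ofReal (b + ⟪ξ u, d⟫ + k * ‖ξ u‖ ^ 2) ∂O.law ≤ _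
  rw [← ofReal_integral_eq_lintegral_ofReal hi2 (Filter.Eventually.of_forall hpos)]
  apply ENNReal.ofReal_le_ofReal
  have hin : ∫ u, ⟪ξ u, d⟫ ∂O.law = 0 := by
    have := integral_inner (𝕜 := ℝ) hξi d
    simp only [real_inner_comm d] at this ⊢
    rw [this, hξ0]; simp
  rw [integral_add hi1 (hsq.const_mul k), integral_add (integrable_const b) (hξi.inner_const d),
    hin, integral_const_mul]
  simp only [integral_const, probReal_univ, smul_eq_mul, one_mul, add_zero]
  gcongr

end Noise

/-! ### Recursions for averaged SGD -/

section Recursion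

variable {O : StochasticOracle n} {f : E n → ℝ} {C : Set (E n)} {x₀ z : E n} {δ μ κ₁ κ₂ κ₃ : ℝ}
  {η : ℕ → ℝ}

lemma IsConvexProblem.continuous (h : IsConvexProblem f C x₀) : Continuous f :=
  continuousOn_univ.1 (h.convexOn.continuousOn isOpen_univ)

lemma lintegral_descent_le (hP : IsConvexProblem f C x₀) (hO : O.IsInexact f C δ)
    (hz : z ∈ C) (hmin : IsMinOn f C z) (hκ₂ : 0 ≤ κ₂) {t : ℕ} (hη : 0 < η t)
    (hS : StepBounds f C z μ κ₁ κ₂ κ₃ (η t)) {x : E n} (hx : x ∈ C) :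
    ∫⁻ u, ENNReal.ofReal (2 * η t * (f (proj C (x - η t • O.out t x u)) - f z) +
        ‖proj C (x - η t • O.out t x u) - z‖ ^ 2) ∂O.law ≤
      ENNReal.ofReal ((1 - η t * μ) * ‖x - z‖ ^ 2 + η t ^ 2 * (κ₁ + κ₂ * δ ^ 2)) := by
  have h : ∀ u, 2 * η t * (f (proj C (x - η t • O.out t x u)) - f z) +
        ‖proj C (x - η t • O.out t x u) - z‖ ^ 2 ≤
      ((1 - η t * μ) * ‖x - z‖ ^ 2 + η t ^ 2 * κ₁) +
        ⟪O.out t x u - O.mean t x, (-(2 * η t)) • (x - z)⟫ +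
        (η t ^ 2 * κ₂) * ‖O.out t x u - O.mean t x‖ ^ 2 := by
    intro u
    have := hS.descent x hx (O.mean t x) (hO t x hx).2.1 (O.out t x u - O.mean t x)
    rw [add_sub_cancel] at this
    rw [inner_smul_right]
    linarith
  have hpos : ∀ u, 0 ≤ 2 * η t * (f (proj C (x - η t • O.out t x u)) - f z) +
        ‖proj C (x - η t • O.out t x u) - z‖ ^ 2 := by
    intro u
    have : f z ≤ f (proj C (x - η t • O.out t x u)) :=
      hmin (proj_spec hP.isClosed hP.convex ⟨z, hz⟩ _).1
    have := sub_nonneg.2 this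
    positivity
  refine (lintegral_mono fun u => ENNReal.ofReal_le_ofReal (h u)).trans ?_
  refine (hO.lintegral_noise_le hx (by positivity) fun u => (hpos u).trans (h u)).trans ?_
  exact ENNReal.ofReal_le_ofReal (by linarith)

/-- One step of two independent runs. The projection does not increase the distance, and the two
noises are centred and independent, so they only add their variances. -/
lemma lintegral_contraction_le (hP : IsConvexProblem f C x₀) (hO : O.IsInexact f C δ) {t : ℕ}
    (hS : StepBounds f C z μ κ₁ κ₂ κ₃ (η t)) {x y : E n} (hx : x ∈ C) (hy : y ∈ C) :
    ∫⁻ u, ∫⁻ u', ENNReal.ofReal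
        (‖proj C (x - η t • O.out t x u) - proj C (y - η t • O.out t y u')‖ ^ 2) ∂O.law ∂O.law ≤
      ENNReal.ofReal ((1 - η t * μ) * ‖x - y‖ ^ 2 + η t ^ 2 * (κ₃ + 4 * δ ^ 2)) := by
  set v := O.mean t x
  set w := O.mean t y
  set a := x - y - η t • (v - w) with ha
  have hA : ‖a‖ ^ 2 ≤ (1 - η t * μ) * ‖x - y‖ ^ 2 + η t ^ 2 * κ₃ :=
    hS.contraction x hx y hy v w (hO t x hx).2.1 (hO t y hy).2.1
  have hinner : ∀ u, ∫⁻ u', ENNReal.ofReal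
        (‖proj C (x - η t • O.out t x u) - proj C (y - η t • O.out t y u')‖ ^ 2) ∂O.law ≤
      ENNReal.ofReal ((‖a‖ ^ 2 + 2 * η t ^ 2 * δ ^ 2) + ⟪O.out t x u - v, (-(2 * η t)) • a⟫ +
        2 * η t ^ 2 * ‖O.out t x u - v‖ ^ 2) := by
    intro u
    set ξ := O.out t x u - v with hξ
    have h : ∀ u', ‖proj C (x - η t • O.out t x u) - proj C (y - η t • O.out t y u')‖ ^ 2 ≤
        (‖a‖ ^ 2 + ⟪ξ, (-(2 * η t)) • a⟫ + 2 * η t ^ 2 * ‖ξ‖ ^ 2) +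
          ⟪O.out t y u' - w, (2 * η t) • a⟫ + 2 * η t ^ 2 * ‖O.out t y u' - w‖ ^ 2 := by
      intro u'
      set ξ' := O.out t y u' - w with hξ'
      have e : x - η t • O.out t x u - (y - η t • O.out t y u') = a - η t • (ξ - ξ') := by
        rw [ha, hξ, hξ']; module
      have h1 := norm_proj_sub_proj_le hP.isClosed hP.convex ⟨x, hx⟩ (x - η t • O.out t x u)
        (y - η t • O.out t y u')
      rw [e] at h1
      have h2 : ‖ξ - ξ'‖ ^ 2 ≤ 2 * ‖ξ‖ ^ 2 + 2 * ‖ξ'‖ ^ 2 := by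
        have := norm_sub_le ξ ξ'
        nlinarith [norm_nonneg (ξ - ξ'), norm_nonneg ξ, norm_nonneg ξ', sq_nonneg (‖ξ‖ - ‖ξ'‖)]
      calc _ ≤ ‖a - η t • (ξ - ξ')‖ ^ 2 := by gcongr
        _ = ‖a‖ ^ 2 - 2 * η t * (⟪ξ, a⟫ - ⟪ξ', a⟫) + η t ^ 2 * ‖ξ - ξ'‖ ^ 2 := by
          rw [norm_sub_sq_real, inner_smul_right, norm_smul, mul_pow, Real.norm_eq_abs, sq_abs,
            real_inner_comm, inner_sub_left]
          ring
        _ ≤ ‖a‖ ^ 2 - 2 * η t * (⟪ξ, a⟫ - ⟪ξ', a⟫) + η t ^ 2 * (2 * ‖ξ‖ ^ 2 + 2 * ‖ξ'‖ ^ 2) := by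
          gcongr
        _ = _ := by rw [inner_smul_right, inner_smul_right]; ring
    refine (lintegral_mono fun u' => ENNReal.ofReal_le_ofReal (h u')).trans ?_
    refine (hO.lintegral_noise_le hy (by positivity) fun u' => (sq_nonneg _).trans (h u')).trans ?_
    exact ENNReal.ofReal_le_ofReal (by linarith)
  refine (lintegral_mono hinner).trans ?_
  refine (hO.lintegral_noise_le hx (by positivity) fun u => ?_).trans ?_
  · have h1 : 0 ≤ ‖a - η t • (O.out t x u - v)‖ ^ 2 := sq_nonneg _
    rw [norm_sub_sq_real, inner_smul_right, norm_smul, mul_pow, Real.norm_eq_abs, sq_abs,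
      real_inner_comm] at h1
    rw [inner_smul_right]
    have h2 : 0 ≤ η t ^ 2 * ‖O.out t x u - O.mean t x‖ ^ 2 := by positivity
    have h3 : 0 ≤ η t ^ 2 * δ ^ 2 := by positivity
    linarith
  · exact ENNReal.ofReal_le_ofReal (by linarith)

variable (O x₀ η f C z) in
/-- The expected suboptimality of the `t`-th iterate. -/
noncomputable def expGap (t : ℕ) : ℝ≥0∞ :=
  ∫⁻ s, ENNReal.ofReal (f (sgdRun O C x₀ η s t) - f z) ∂(Measure.infinitePi fun _ : ℕ => O.law)

variable (O x₀ η C z) in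
/-- The expected squared distance of the `t`-th iterate to `z`. -/
noncomputable def expDist (t : ℕ) : ℝ≥0∞ :=
  ∫⁻ s, ENNReal.ofReal (‖sgdRun O C x₀ η s t - z‖ ^ 2) ∂(Measure.infinitePi fun _ : ℕ => O.law)

variable (O x₀ η C) in
/-- The expected squared distance between the `t`-th iterates of two independent runs. -/
noncomputable def expDev (t : ℕ) : ℝ≥0∞ :=
  ∫⁻ s, ∫⁻ s', ENNReal.ofReal (‖sgdRun O C x₀ η s t - sgdRun O C x₀ η s' t‖ ^ 2)
    ∂(Measure.infinitePi fun _ : ℕ => O.law) ∂(Measure.infinitePi fun _ : ℕ => O.law)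

lemma sgdRun_succ_update (s : ℕ → O.Seed) (t : ℕ) (u : O.Seed) :
    sgdRun O C x₀ η (Function.update s t u) (t + 1) =
      proj C (sgdRun O C x₀ η s t - η t • O.out t (sgdRun O C x₀ η s t) u) := by
  rw [sgdRun, sgdRun_update O C x₀ η s u le_rfl, Function.update_self]

lemma expGap_succ_le (hP : IsConvexProblem f C x₀) (hO : O.IsInexact f C δ)
    (hz : z ∈ C) (hmin : IsMinOn f C z) (hκ₂ : 0 ≤ κ₂) (hκ₁ : 0 ≤ κ₁) {t : ℕ} (hη : 0 < η t)
    (hημ : η t * μ ≤ 1) (hS : StepBounds f C z μ κ₁ κ₂ κ₃ (η t)) :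
    ENNReal.ofReal (2 * η t) * expGap O f C x₀ z η (t + 1) + expDist O C x₀ z η (t + 1) ≤
      ENNReal.ofReal (1 - η t * μ) * expDist O C x₀ z η t +
        ENNReal.ofReal (η t ^ 2 * (κ₁ + κ₂ * δ ^ 2)) := by
  have hm := fun t => measurable_sgdRun O η hP.isClosed hP.convex hP.mem t
  have hfm := hP.continuous.measurable
  have hpos : ∀ s t, 0 ≤ f (sgdRun O C x₀ η s t) - f z := fun s t =>
    sub_nonneg.2 (hmin (sgdRun_mem O η hP.isClosed hP.convex hP.mem s t))
  calc ENNReal.ofReal (2 * η t) * expGap O f C x₀ z η (t + 1) + expDist O C x₀ z η (t + 1)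
      = ∫⁻ s, ENNReal.ofReal (2 * η t * (f (sgdRun O C x₀ η s (t + 1)) - f z) +
          ‖sgdRun O C x₀ η s (t + 1) - z‖ ^ 2) ∂(Measure.infinitePi fun _ : ℕ => O.law) := by
        rw [expGap, expDist, ← lintegral_const_mul' _ _ ENNReal.ofReal_ne_top,
          ← lintegral_add_right _ (((hm (t + 1)).sub_const z).norm.pow_const 2).ennreal_ofReal]
        refine lintegral_congr fun s => ?_
        rw [← ENNReal.ofReal_mul (by positivity),
          ← ENNReal.ofReal_add (mul_nonneg (by positivity) (hpos s _)) (sq_nonneg _)]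
    _ = ∫⁻ s, ∫⁻ u, ENNReal.ofReal (2 * η t * (f (proj C (sgdRun O C x₀ η s t -
          η t • O.out t (sgdRun O C x₀ η s t) u)) - f z) + ‖proj C (sgdRun O C x₀ η s t -
          η t • O.out t (sgdRun O C x₀ η s t) u) - z‖ ^ 2) ∂O.law
          ∂(Measure.infinitePi fun _ : ℕ => O.law) := by
        rw [lintegral_infinitePi_update O.law t]
        · simp only [sgdRun_succ_update]
        · exact ((((hfm.comp (hm (t + 1))).sub_const _).const_mul _).add
            (((hm (t + 1)).sub_const z).norm.pow_const 2)).ennreal_ofReal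
    _ ≤ ∫⁻ s, ENNReal.ofReal ((1 - η t * μ) * ‖sgdRun O C x₀ η s t - z‖ ^ 2 +
          η t ^ 2 * (κ₁ + κ₂ * δ ^ 2)) ∂(Measure.infinitePi fun _ : ℕ => O.law) :=
        lintegral_mono fun s => lintegral_descent_le hP hO hz hmin hκ₂ hη hS
          (sgdRun_mem O η hP.isClosed hP.convex hP.mem s t)
    _ = _ := by
        rw [expDist, ← lintegral_const_mul' _ _ ENNReal.ofReal_ne_top]
        have : ∀ s, ENNReal.ofReal ((1 - η t * μ) * ‖sgdRun O C x₀ η s t - z‖ ^ 2 +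
            η t ^ 2 * (κ₁ + κ₂ * δ ^ 2)) = ENNReal.ofReal (1 - η t * μ) *
            ENNReal.ofReal (‖sgdRun O C x₀ η s t - z‖ ^ 2) +
            ENNReal.ofReal (η t ^ 2 * (κ₁ + κ₂ * δ ^ 2)) := fun s => by
          have h1 : 0 ≤ 1 - η t * μ := by linarith
          rw [ENNReal.ofReal_add (by positivity) (by positivity), ENNReal.ofReal_mul h1]
        simp only [this]
        rw [lintegral_add_right _ measurable_const]
        simp

lemma expDev_succ_le (hP : IsConvexProblem f C x₀) (hO : O.IsInexact f C δ) (hκ₃ : 0 ≤ κ₃) {t : ℕ}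
    (hημ : η t * μ ≤ 1) (hS : StepBounds f C z μ κ₁ κ₂ κ₃ (η t)) :
    expDev O C x₀ η (t + 1) ≤ ENNReal.ofReal (1 - η t * μ) * expDev O C x₀ η t +
        ENNReal.ofReal (η t ^ 2 * (κ₃ + 4 * δ ^ 2)) := by
  set P := Measure.infinitePi fun _ : ℕ => O.law with hPdef
  have hm := fun t => measurable_sgdRun O η hP.isClosed hP.convex hP.mem t
  set X := sgdRun O C x₀ η with hX
  set N : E n → O.Seed → E n := fun x u => proj C (x - η t • O.out t x u) with hN
  have hNm : Measurable fun p : E n × O.Seed => N p.1 p.2 :=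
    (continuous_proj hP.isClosed hP.convex ⟨x₀, hP.mem⟩).measurable.comp
      (measurable_fst.sub ((O.measurable_out t).fun_const_smul _))
  have hstep : ∀ s u, X (Function.update s t u) (t + 1) = N (X s t) u := fun s u =>
    sgdRun_succ_update s t u
  have hjoint : Measurable fun p : (ℕ → O.Seed) × (ℕ → O.Seed) =>
      ENNReal.ofReal (‖X p.1 (t + 1) - X p.2 (t + 1)‖ ^ 2) :=
    ((((hm (t + 1)).comp measurable_fst).sub ((hm (t + 1)).comp measurable_snd)).norm.pow_const
      2).ennreal_ofReal
  calc expDev O C x₀ η (t + 1)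
      = ∫⁻ s, ∫⁻ u, ∫⁻ s', ENNReal.ofReal (‖N (X s t) u - X s' (t + 1)‖ ^ 2) ∂P ∂O.law ∂P := by
        rw [expDev, ← hPdef, ← hX, lintegral_infinitePi_update O.law t]
        · simp only [hstep]; rfl
        · exact hjoint.lintegral_prod_right'
    _ = ∫⁻ s, ∫⁻ s', ∫⁻ u, ENNReal.ofReal (‖N (X s t) u - X s' (t + 1)‖ ^ 2) ∂O.law ∂P ∂P := by
        refine lintegral_congr fun s => lintegral_lintegral_swap ?_
        exact (((hNm.comp (measurable_const.prodMk measurable_fst)).sub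
          ((hm (t + 1)).comp measurable_snd)).norm.pow_const 2).ennreal_ofReal.aemeasurable
    _ = ∫⁻ s, ∫⁻ s', ∫⁻ u', ∫⁻ u, ENNReal.ofReal (‖N (X s t) u - N (X s' t) u'‖ ^ 2)
          ∂O.law ∂O.law ∂P ∂P := by
        refine lintegral_congr fun s => ?_
        rw [lintegral_infinitePi_update O.law t]
        · simp only [hstep]; rfl
        · refine Measurable.lintegral_prod_right' (f := fun p : (ℕ → O.Seed) × O.Seed =>
            ENNReal.ofReal (‖N (X s t) p.2 - X p.1 (t + 1)‖ ^ 2)) ?_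
          exact (((hNm.comp (measurable_const.prodMk measurable_snd)).sub
            ((hm (t + 1)).comp measurable_fst)).norm.pow_const 2).ennreal_ofReal
    _ ≤ ∫⁻ s, ∫⁻ s', ENNReal.ofReal ((1 - η t * μ) * ‖X s t - X s' t‖ ^ 2 +
          η t ^ 2 * (κ₃ + 4 * δ ^ 2)) ∂P ∂P := by
        refine lintegral_mono fun s => lintegral_mono fun s' => ?_
        have := lintegral_contraction_le hP hO hS
          (sgdRun_mem O η hP.isClosed hP.convex hP.mem s' t)
          (sgdRun_mem O η hP.isClosed hP.convex hP.mem s t)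
        simpa only [norm_sub_rev] using this
    _ = _ := by
        rw [expDev, ← hPdef, ← hX]
        have : ∀ s s', ENNReal.ofReal ((1 - η t * μ) * ‖X s t - X s' t‖ ^ 2 +
            η t ^ 2 * (κ₃ + 4 * δ ^ 2)) = ENNReal.ofReal (1 - η t * μ) *
            ENNReal.ofReal (‖X s t - X s' t‖ ^ 2) +
            ENNReal.ofReal (η t ^ 2 * (κ₃ + 4 * δ ^ 2)) := fun s s' => by
          have h1 : 0 ≤ 1 - η t * μ := by linarith
          rw [ENNReal.ofReal_add (by positivity) (by positivity), ENNReal.ofReal_mul h1]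
        simp only [this]
        simp only [lintegral_add_right _ measurable_const,
          lintegral_const_mul' _ _ ENNReal.ofReal_ne_top]
        simp

end Recursion

/-! ### Averaged SGD: accuracy and deviation -/

section Average

variable {O : StochasticOracle n} {f : E n → ℝ} {C : Set (E n)} {x₀ z : E n} {δ μ κ₁ κ₂ κ₃ ε : ℝ}
  {η w : ℕ → ℝ} {T : ℕ}

/-- The recursions for the expected gap `e`, squared distance `v` to the minimizer, and deviation
`d` of the iterates, in terms of real numbers. -/
lemma exists_real_recursion (hP : IsConvexProblem f C x₀) (hO : O.IsInexact f C δ)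
    (hz : z ∈ C) (hmin : IsMinOn f C z) (hκ₁ : 0 ≤ κ₁) (hκ₂ : 0 ≤ κ₂) (hκ₃ : 0 ≤ κ₃)
    (hη : ∀ t, 0 < η t) (hημ : ∀ t, η t * μ ≤ 1)
    (hS : ∀ t, StepBounds f C z μ κ₁ κ₂ κ₃ (η t)) :
    ∃ e v d : ℕ → ℝ, (∀ t, 0 ≤ e t) ∧ (∀ t, 0 ≤ v t) ∧ (∀ t, 0 ≤ d t) ∧ v 0 = ‖x₀ - z‖ ^ 2 ∧
      d 0 = 0 ∧ (∀ t, 2 * η t * e (t + 1) + v (t + 1) ≤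
        (1 - η t * μ) * v t + η t ^ 2 * (κ₁ + κ₂ * δ ^ 2)) ∧
      (∀ t, d (t + 1) ≤ (1 - η t * μ) * d t + η t ^ 2 * (κ₃ + 4 * δ ^ 2)) ∧
      (∀ t, 1 ≤ t → expGap O f C x₀ z η t = ENNReal.ofReal (e t)) ∧
      (∀ t, expDev O C x₀ η t = ENNReal.ofReal (d t)) := by
  have hrec := fun t => expGap_succ_le hP hO hz hmin hκ₂ hκ₁ (hη t) (hημ t) (hS t)
  have hrecd := fun t => expDev_succ_le hP hO hκ₃ (hημ t) (hS t)
  have hv0 : expDist O C x₀ z η 0 = ENNReal.ofReal (‖x₀ - z‖ ^ 2) := by simp [expDist, sgdRun]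
  have hd0 : expDev O C x₀ η 0 = 0 := by simp [expDev, sgdRun]
  have hv : ∀ t, expDist O C x₀ z η t ≠ ∞ := by
    intro t
    induction t with
    | zero => rw [hv0]; exact ENNReal.ofReal_ne_top
    | succ t ih =>
      refine ((le_add_self.trans (hrec t)).trans_lt ?_).ne
      exact ENNReal.add_lt_top.2 ⟨ENNReal.mul_lt_top ENNReal.ofReal_lt_top ih.lt_top,
        ENNReal.ofReal_lt_top⟩
  have hd : ∀ t, expDev O C x₀ η t ≠ ∞ := by
    intro t
    induction t with
    | zero => rw [hd0]; exact ENNReal.zero_ne_top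
    | succ t ih =>
      refine ((hrecd t).trans_lt ?_).ne
      exact ENNReal.add_lt_top.2 ⟨ENNReal.mul_lt_top ENNReal.ofReal_lt_top ih.lt_top,
        ENNReal.ofReal_lt_top⟩
  have he : ∀ t, expGap O f C x₀ z η (t + 1) ≠ ∞ := by
    intro t htop
    have h1 := hrec t
    rw [htop, ENNReal.mul_top (by simpa using hη t), top_add, top_le_iff] at h1
    exact (ENNReal.add_lt_top.2 ⟨ENNReal.mul_lt_top ENNReal.ofReal_lt_top (hv t).lt_top,
        ENNReal.ofReal_lt_top⟩).ne h1
  refine ⟨fun t => (expGap O f C x₀ z η t).toReal, fun t => (expDist O C x₀ z η t).toReal,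
    fun t => (expDev O C x₀ η t).toReal, fun t => ENNReal.toReal_nonneg,
    fun t => ENNReal.toReal_nonneg, fun t => ENNReal.toReal_nonneg, ?_, ?_, fun t => ?_, fun t =>
      ?_,
    fun t ht => ?_, fun t => (ENNReal.ofReal_toReal (hd t)).symm⟩
  · simp [hv0]
  · simp [hd0]
  · have h1 := hrec t
    have h2 : 0 ≤ 1 - η t * μ := by linarith [hημ t]
    have h3 := (hη t).le
    rw [← ENNReal.ofReal_toReal (he t), ← ENNReal.ofReal_toReal (hv t),
      ← ENNReal.ofReal_toReal (hv (t + 1)), ← ENNReal.ofReal_mul (by positivity),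
      ← ENNReal.ofReal_mul h2, ← ENNReal.ofReal_add (by positivity) (by positivity),
      ← ENNReal.ofReal_add (by positivity) (by positivity)] at h1
    exact (ENNReal.ofReal_le_ofReal_iff (by positivity)).1 h1
  · have h1 := hrecd t
    have h2 : 0 ≤ 1 - η t * μ := by linarith [hημ t]
    rw [← ENNReal.ofReal_toReal (hd t), ← ENNReal.ofReal_toReal (hd (t + 1)),
      ← ENNReal.ofReal_mul h2, ← ENNReal.ofReal_add (by positivity) (by positivity)] at h1
    exact (ENNReal.ofReal_le_ofReal_iff (by positivity)).1 h1
  · cases t with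
    | zero => omega
    | succ t => exact (ENNReal.ofReal_toReal (he t)).symm

lemma IsMinOn.sInf_image_eq {g : E n → ℝ} (hz : z ∈ C) (hmin : IsMinOn g C z) :
    sInf (g '' C) = g z :=
  IsLeast.csInf_eq ⟨⟨z, hz, rfl⟩, by rintro _ ⟨y, hy, rfl⟩; exact hmin hy⟩

lemma lintegral_averagedSGD_eq {F : E n → ℝ≥0∞} (hP : IsConvexProblem f C x₀) (hF : Measurable F) :
    ∫⁻ ω, F ((averagedSGD C x₀ η w T).output O T ω) ∂(averagedSGD C x₀ η w T).runLaw O =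
      ∫⁻ s, F ((∑ t ∈ Finset.Icc 1 T, w t)⁻¹ • ∑ t ∈ Finset.Icc 1 T, w t • sgdRun O C x₀ η s t)
        ∂(Measure.infinitePi fun _ : ℕ => O.law) := by
  have h : Measurable fun ω => F ((averagedSGD C x₀ η w T).output O T ω) :=
    hF.comp (Algorithm.measurable_output O
      (averagedSGD_isMeasurable η hP.isClosed hP.convex hP.mem w T) T)
  rw [Algorithm.lintegral_runLaw _ _ h]
  simp only [averagedSGD_output]
  rw [lintegral_const, measure_univ, mul_one]

lemma averagedSGD_output_mem (hP : IsConvexProblem f C x₀) (hw : ∀ t, 1 ≤ t → 0 < w t) (hT : 1 ≤ T)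
    (ω : (averagedSGD C x₀ η w T).Coin × (ℕ → O.Seed)) :
    (averagedSGD C x₀ η w T).output O T ω ∈ C := by
  rw [averagedSGD_output]
  refine hP.convex.centerMass_mem (t := Finset.Icc 1 T)
    (fun t ht => (hw t (Finset.mem_Icc.1 ht).1).le) ?_
    fun t _ => sgdRun_mem O η hP.isClosed hP.convex hP.mem ω.2 t
  exact Finset.sum_pos (fun t ht => hw t (Finset.mem_Icc.1 ht).1)
    ⟨T, Finset.mem_Icc.2 ⟨hT, le_rfl⟩⟩

/-- By convexity, the gap of the output is at most the weighted average of the gaps of the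
iterates. -/
lemma averagedSGD_isAccurate (hP : IsConvexProblem f C x₀) (hz : z ∈ C) (hmin : IsMinOn f C z)
    (hw : ∀ t, 1 ≤ t → 0 < w t) (hT : 1 ≤ T) {e : ℕ → ℝ} (he : ∀ t, 0 ≤ e t)
    (hgap : ∀ t, 1 ≤ t → expGap O f C x₀ z η t = ENNReal.ofReal (e t))
    (hε : ∑ t ∈ Finset.Icc 1 T, w t * e t ≤ (∑ t ∈ Finset.Icc 1 T, w t) * ε) :
    (averagedSGD C x₀ η w T).IsAccurate O f C T ε := by
  refine ⟨Filter.Eventually.of_forall fun ω => averagedSGD_output_mem hP hw hT ω, ?_⟩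
  set W := ∑ t ∈ Finset.Icc 1 T, w t with hW
  have hWpos : 0 < W := Finset.sum_pos (fun t ht => hw t (Finset.mem_Icc.1 ht).1)
    ⟨T, Finset.mem_Icc.2 ⟨hT, le_rfl⟩⟩
  have hm := fun t => measurable_sgdRun O η hP.isClosed hP.convex hP.mem t
  have hfm := hP.continuous.measurable
  have ha : ∀ t ∈ Finset.Icc 1 T, 0 ≤ W⁻¹ * w t := fun t ht =>
    mul_nonneg (inv_nonneg.2 hWpos.le) (hw t (Finset.mem_Icc.1 ht).1).le
  have hsum : ∑ t ∈ Finset.Icc 1 T, W⁻¹ * w t = 1 := by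
    rw [← Finset.mul_sum, ← hW, inv_mul_cancel₀ hWpos.ne']
  rw [IsMinOn.sInf_image_eq hz hmin,
    lintegral_averagedSGD_eq (F := fun x => ENNReal.ofReal (f x - f z)) hP
      (hfm.sub_const _).ennreal_ofReal, ← hW]
  calc _ ≤ ∫⁻ s, ∑ t ∈ Finset.Icc 1 T, ENNReal.ofReal (W⁻¹ * w t) *
        ENNReal.ofReal (f (sgdRun O C x₀ η s t) - f z)
          ∂(Measure.infinitePi fun _ : ℕ => O.law) := by
        refine lintegral_mono fun s => ?_
        have hpos : ∀ t, 0 ≤ f (sgdRun O C x₀ η s t) - f z := fun t =>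
          sub_nonneg.2 (hmin (sgdRun_mem O η hP.isClosed hP.convex hP.mem s t))
        have h1 := hP.convexOn.map_sum_le (t := Finset.Icc 1 T) (w := fun t => W⁻¹ * w t)
          (p := fun t => sgdRun O C x₀ η s t) ha hsum (fun _ _ => mem_univ _)
        have h2 : ∑ t ∈ Finset.Icc 1 T, (W⁻¹ * w t) * (f (sgdRun O C x₀ η s t) - f z) =
            ∑ t ∈ Finset.Icc 1 T, (W⁻¹ * w t) • f (sgdRun O C x₀ η s t) - f z := by
          simp only [mul_sub, Finset.sum_sub_distrib, smul_eq_mul]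
          rw [← Finset.sum_mul, hsum, one_mul]
        have h3 : f (W⁻¹ • ∑ t ∈ Finset.Icc 1 T, w t • sgdRun O C x₀ η s t) - f z ≤
            ∑ t ∈ Finset.Icc 1 T, (W⁻¹ * w t) * (f (sgdRun O C x₀ η s t) - f z) := by
          rw [h2, Finset.smul_sum]
          simp only [smul_smul]
          linarith
        refine (ENNReal.ofReal_le_ofReal h3).trans (le_of_eq ?_)
        rw [ENNReal.ofReal_sum_of_nonneg fun t ht => mul_nonneg (ha t ht) (hpos t)]
        exact Finset.sum_congr rfl fun t ht => ENNReal.ofReal_mul (ha t ht)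
    _ = ∑ t ∈ Finset.Icc 1 T, ENNReal.ofReal (W⁻¹ * w t * e t) := by
        have h1 : ∀ t, Measurable fun s => ENNReal.ofReal (f (sgdRun O C x₀ η s t) - f z) :=
          fun t => ((hfm.comp (hm t)).sub_const _).ennreal_ofReal
        rw [lintegral_finsetSum _ fun t _ => (h1 t).const_mul _]
        refine Finset.sum_congr rfl fun t ht => ?_
        rw [lintegral_const_mul' _ _ ENNReal.ofReal_ne_top, ← expGap,
          hgap t (Finset.mem_Icc.1 ht).1, ENNReal.ofReal_mul (ha t ht)]
    _ = ENNReal.ofReal (W⁻¹ * ∑ t ∈ Finset.Icc 1 T, w t * e t) := by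
        rw [← ENNReal.ofReal_sum_of_nonneg fun t ht => mul_nonneg (ha t ht) (he t), Finset.mul_sum]
        simp only [mul_assoc]
    _ ≤ _ := by
        refine ENNReal.ofReal_le_ofReal ?_
        rw [inv_mul_le_iff₀ hWpos]
        exact hε

/-- By convexity, the deviation of the output is at most the weighted average of the deviations of
the iterates. -/
lemma averagedSGD_deviation_le (hP : IsConvexProblem f C x₀)
    (hw : ∀ t, 1 ≤ t → 0 < w t) (hT : 1 ≤ T) {d : ℕ → ℝ} (hd : ∀ t, 0 ≤ d t)
    (hdev : ∀ t, expDev O C x₀ η t = ENNReal.ofReal (d t)) {b : ℝ}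
    (hb : ∑ t ∈ Finset.Icc 1 T, w t * d t ≤ (∑ t ∈ Finset.Icc 1 T, w t) * b) :
    (averagedSGD C x₀ η w T).deviation O T ≤ ENNReal.ofReal b := by
  set W := ∑ t ∈ Finset.Icc 1 T, w t with hW
  have hWpos : 0 < W := Finset.sum_pos (fun t ht => hw t (Finset.mem_Icc.1 ht).1)
    ⟨T, Finset.mem_Icc.2 ⟨hT, le_rfl⟩⟩
  have hm := fun t => measurable_sgdRun O η hP.isClosed hP.convex hP.mem t
  have ha : ∀ t ∈ Finset.Icc 1 T, 0 ≤ W⁻¹ * w t := fun t ht =>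
    mul_nonneg (inv_nonneg.2 hWpos.le) (hw t (Finset.mem_Icc.1 ht).1).le
  have hsum : ∑ t ∈ Finset.Icc 1 T, W⁻¹ * w t = 1 := by
    rw [← Finset.mul_sum, ← hW, inv_mul_cancel₀ hWpos.ne']
  set P := Measure.infinitePi fun _ : ℕ => O.law with hPdef
  set X := sgdRun O C x₀ η with hX
  have hjoint : ∀ t, Measurable fun p : (ℕ → O.Seed) × (ℕ → O.Seed) =>
      ENNReal.ofReal (‖X p.1 t - X p.2 t‖ ^ 2) := fun t =>
    ((((hm t).comp measurable_fst).sub ((hm t).comp measurable_snd)).norm.pow_const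
      2).ennreal_ofReal
  set Y : (ℕ → O.Seed) → E n := fun s => W⁻¹ • ∑ t ∈ Finset.Icc 1 T, w t • X s t with hY
  have hYm : Measurable Y :=
    (Finset.measurable_sum _ fun t _ => (hm t).fun_const_smul (w t)).fun_const_smul _
  have hdev0 : (averagedSGD C x₀ η w T).deviation O T = ∫⁻ s, ∫⁻ s', ‖Y s - Y s'‖ₑ ^ 2 ∂P ∂P := by
    rw [Algorithm.deviation_eq O
      (averagedSGD_isMeasurable η hP.isClosed hP.convex hP.mem w T)]
    have h1 : ∀ p : (averagedSGD C x₀ η w T).Coin × (ℕ → O.Seed),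
        ∫⁻ p', ‖(averagedSGD C x₀ η w T).output O T p - (averagedSGD C x₀ η w T).output O T p'‖ₑ ^ 2
          ∂(averagedSGD C x₀ η w T).runLaw O =
        ∫⁻ s', ‖(averagedSGD C x₀ η w T).output O T p - Y s'‖ₑ ^ 2 ∂P := fun p =>
      lintegral_averagedSGD_eq (F := fun x =>
        ‖(averagedSGD C x₀ η w T).output O T p - x‖ₑ ^ 2) hP
        ((measurable_const.sub measurable_id).enorm.pow_const 2)
    simp only [h1]
    refine lintegral_averagedSGD_eq (F := fun x => ∫⁻ s', ‖x - Y s'‖ₑ ^ 2 ∂P) hP ?_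
    refine Measurable.lintegral_prod_right' (f := fun p : E n × (ℕ → O.Seed) => ‖p.1 - Y p.2‖ₑ ^ 2)
      ?_
    exact (measurable_fst.sub (hYm.comp measurable_snd)).enorm.pow_const 2
  rw [hdev0]
  calc _ ≤ ∫⁻ s, ∫⁻ s', ∑ t ∈ Finset.Icc 1 T, ENNReal.ofReal (W⁻¹ * w t) *
        ENNReal.ofReal (‖X s t - X s' t‖ ^ 2) ∂P ∂P := by
        refine lintegral_mono fun s => lintegral_mono fun s' => ?_
        have hconv : ConvexOn ℝ univ fun x : E n => ‖x‖ ^ 2 :=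
          convexOn_univ_norm.pow (fun _ _ => norm_nonneg _) 2
        have h1 := hconv.map_sum_le (t := Finset.Icc 1 T) (w := fun t => W⁻¹ * w t)
          (p := fun t => X s t - X s' t) ha hsum (fun _ _ => mem_univ _)
        have h2 : Y s - Y s' = ∑ t ∈ Finset.Icc 1 T, (W⁻¹ * w t) • (X s t - X s' t) := by
          simp only [hY, smul_sub, Finset.smul_sum, smul_smul, Finset.sum_sub_distrib]
        rw [enorm_sq_eq_ofReal, h2]
        refine (ENNReal.ofReal_le_ofReal h1).trans (le_of_eq ?_)
        simp only [smul_eq_mul]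
        rw [ENNReal.ofReal_sum_of_nonneg fun t ht => mul_nonneg (ha t ht) (sq_nonneg _)]
        exact Finset.sum_congr rfl fun t ht => ENNReal.ofReal_mul (ha t ht)
    _ = ∑ t ∈ Finset.Icc 1 T, ENNReal.ofReal (W⁻¹ * w t * d t) := by
        have h1 : ∀ s, ∫⁻ s', ∑ t ∈ Finset.Icc 1 T, ENNReal.ofReal (W⁻¹ * w t) *
            ENNReal.ofReal (‖X s t - X s' t‖ ^ 2) ∂P = ∑ t ∈ Finset.Icc 1 T,
            ENNReal.ofReal (W⁻¹ * w t) * ∫⁻ s', ENNReal.ofReal (‖X s t - X s' t‖ ^ 2) ∂P := fun s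
              => by
          have h2 : ∀ t, Measurable fun s' => ENNReal.ofReal (‖X s t - X s' t‖ ^ 2) :=
            fun t => ((measurable_const.sub (hm t)).norm.pow_const 2).ennreal_ofReal
          rw [lintegral_finsetSum _ fun t _ => (h2 t).const_mul _]
          exact Finset.sum_congr rfl fun t _ => lintegral_const_mul' _ _ ENNReal.ofReal_ne_top
        have h3 : ∀ t, Measurable fun s => ∫⁻ s', ENNReal.ofReal (‖X s t - X s' t‖ ^ 2) ∂P :=
          fun t => (hjoint t).lintegral_prod_right'
        rw [lintegral_congr h1, lintegral_finsetSum _ fun t _ => (h3 t).const_mul _]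
        refine Finset.sum_congr rfl fun t ht => ?_
        rw [lintegral_const_mul' _ _ ENNReal.ofReal_ne_top, ENNReal.ofReal_mul (ha t ht), ← hdev t,
          expDev]
    _ = ENNReal.ofReal (W⁻¹ * ∑ t ∈ Finset.Icc 1 T, w t * d t) := by
        rw [← ENNReal.ofReal_sum_of_nonneg fun t ht => mul_nonneg (ha t ht) (hd t), Finset.mul_sum]
        simp only [mul_assoc]
    _ ≤ _ := by
        refine ENNReal.ofReal_le_ofReal ?_
        rw [inv_mul_le_iff₀ hWpos]
        exact hb

/-- Accuracy controls the deviation when the objective is strongly convex, because both outputs are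
close to the minimizer. -/
lemma deviation_le_of_isAccurate {A : Algorithm n} (hA : A.IsMeasurable) (hμ : 0 < μ)
    (hf : StrongConvexOn C μ f) (hz : z ∈ C) (hmin : IsMinOn f C z)
    (hacc : A.IsAccurate O f C T ε) : A.deviation O T ≤ ENNReal.ofReal (8 / μ * ε) := by
  have hmo := Algorithm.measurable_output O hA T
  obtain ⟨hmem, hgap⟩ := hacc
  rw [IsMinOn.sInf_image_eq hz hmin] at hgap
  set M := ∫⁻ ω, ‖A.output O T ω - z‖ₑ ^ 2 ∂A.runLaw O with hM
  have hMle : M ≤ ENNReal.ofReal (2 / μ * ε) := by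
    calc M ≤ ∫⁻ ω, ENNReal.ofReal (2 / μ) * ENNReal.ofReal (f (A.output O T ω) - f z)
          ∂A.runLaw O := by
          refine lintegral_mono_ae ?_
          filter_upwards [hmem] with ω hω
          rw [enorm_sq_eq_ofReal, ← ENNReal.ofReal_mul (by positivity)]
          refine ENNReal.ofReal_le_ofReal ?_
          have := hmin.add_sq_le_of_strongConvexOn hμ.le hf hω hz
          rw [div_mul_eq_mul_div, le_div_iff₀ hμ]
          linarith
      _ ≤ _ := by
          rw [lintegral_const_mul' _ _ ENNReal.ofReal_ne_top, ENNReal.ofReal_mul (by positivity)]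
          gcongr
  have hpt : ∀ x y : E n, ‖x - y‖ₑ ^ 2 ≤ 2 * ‖x - z‖ₑ ^ 2 + 2 * ‖y - z‖ₑ ^ 2 := by
    intro x y
    have e : 2 * ‖x - z‖ₑ ^ 2 + 2 * ‖y - z‖ₑ ^ 2 =
        ENNReal.ofReal (2 * ‖x - z‖ ^ 2 + 2 * ‖y - z‖ ^ 2) := by
      rw [ENNReal.ofReal_add (by positivity) (by positivity), ENNReal.ofReal_mul (by norm_num),
        ENNReal.ofReal_mul (by norm_num), enorm_sq_eq_ofReal, enorm_sq_eq_ofReal,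
        ENNReal.ofReal_ofNat]
    rw [e, enorm_sq_eq_ofReal]
    refine ENNReal.ofReal_le_ofReal ?_
    have := norm_sub_le (x - z) (y - z)
    rw [sub_sub_sub_cancel_right] at this
    nlinarith [norm_nonneg (x - y), norm_nonneg (x - z), norm_nonneg (y - z),
      sq_nonneg (‖x - z‖ - ‖y - z‖)]
  have hsqm : Measurable fun ω => ‖A.output O T ω - z‖ₑ ^ 2 := (hmo.sub_const z).enorm.pow_const 2
  rw [Algorithm.deviation_eq O hA]
  calc _ ≤ ∫⁻ ω, ∫⁻ ω', (2 * ‖A.output O T ω - z‖ₑ ^ 2 + 2 * ‖A.output O T ω' - z‖ₑ ^ 2)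
        ∂A.runLaw O ∂A.runLaw O := lintegral_mono fun ω => lintegral_mono fun ω' => hpt _ _
    _ = 2 * M + 2 * M := by
        simp only [lintegral_add_left measurable_const, lintegral_const, measure_univ, mul_one]
        rw [lintegral_add_right _ measurable_const]
        simp only [lintegral_const_mul 2 hsqm, lintegral_const, measure_univ, mul_one, ← hM]
    _ ≤ ENNReal.ofReal (4 * (2 / μ * ε)) := by
        rw [← two_mul, ← mul_assoc, ENNReal.ofReal_mul (by norm_num)]
        gcongr
        norm_num
    _ = _ := by congr 1; ring

end Average

/-! ### Solving the recursions -/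

lemma sum_le_of_const_recursion {e v : ℕ → ℝ} {η K : ℝ} (hv : ∀ t, 0 ≤ v t)
    (h : ∀ t, 2 * η * e (t + 1) + v (t + 1) ≤ v t + η ^ 2 * K) (T : ℕ) :
    2 * η * ∑ t ∈ Finset.Icc 1 T, e t ≤ v 0 + T * (η ^ 2 * K) := by
  have : 2 * η * ∑ t ∈ Finset.Icc 1 T, e t + v T ≤ v 0 + T * (η ^ 2 * K) := by
    induction T with
    | zero => simp
    | succ T ih =>
      rw [Finset.sum_Icc_succ_top (by omega), mul_add]
      push_cast
      linarith [h T]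
  linarith [hv T]

lemma le_of_const_recursion {d : ℕ → ℝ} {b : ℝ} (h0 : d 0 = 0) (h : ∀ t, d (t + 1) ≤ d t + b)
    (t : ℕ) : d t ≤ t * b := by
  induction t with
  | zero => simp [h0]
  | succ t ih => push_cast; linarith [h t]

lemma sum_Icc_natCast (T : ℕ) : ∑ t ∈ Finset.Icc 1 T, (t : ℝ) = T * (T + 1) / 2 := by
  induction T with
  | zero => simp
  | succ T ih => rw [Finset.sum_Icc_succ_top (by omega), ih]; push_cast; ring

/-- The weights `t` make `t (t + a - 1) v t` a potential, up to an error `(a - 2) v t`. -/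
lemma sum_le_of_decaying_recursion {e v : ℕ → ℝ} {μ K a W : ℝ} (hμ : 0 < μ) (ha : 2 ≤ a)
    (hK : 0 ≤ K) (he : ∀ t, 0 ≤ e t) (hv : ∀ t, 0 ≤ v t) (hv0 : v 0 ≤ W)
    (hKW : 2 * K / (μ ^ 2 * a) ≤ W)
    (h : ∀ t : ℕ, 2 * (2 / (μ * (t + a))) * e (t + 1) + v (t + 1) ≤
      (1 - 2 / (μ * (t + a)) * μ) * v t + (2 / (μ * (t + a))) ^ 2 * K) (T : ℕ) :
    ∑ t ∈ Finset.Icc 1 T, t * e t ≤ T * (μ / 4 * ((a - 2) * W + 4 * K / μ ^ 2)) := by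
  have h' : ∀ t : ℕ, 4 / μ * e (t + 1) + (t + a) * v (t + 1) ≤
      (t + a - 2) * v t + 4 * K / μ ^ 2 / (t + a) := by
    intro t
    have hs : (0 : ℝ) < t + a := by positivity
    have := mul_le_mul_of_nonneg_left (h t) hs.le
    have e1 : (t + a) * (2 * (2 / (μ * (t + a))) * e (t + 1) + v (t + 1)) =
        4 / μ * e (t + 1) + (t + a) * v (t + 1) := by field_simp; ring
    have e2 : (t + a) * ((1 - 2 / (μ * (t + a)) * μ) * v t + (2 / (μ * (t + a))) ^ 2 * K) =
        (t + a - 2) * v t + 4 * K / μ ^ 2 / (t + a) := by field_simp; ring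
    rwa [e1, e2] at this
  have hKW' : 4 * K / μ ^ 2 / a ≤ 2 * W := by
    have : 4 * K / μ ^ 2 / a = 2 * (2 * K / (μ ^ 2 * a)) := by field_simp; ring
    linarith
  have hvW : ∀ t, v t ≤ W := by
    intro t
    induction t with
    | zero => exact hv0
    | succ t ih =>
      have hs : (0 : ℝ) < t + a := by positivity
      have h1 : 4 * K / μ ^ 2 / (t + a) ≤ 4 * K / μ ^ 2 / a := by
        gcongr
        linarith [(Nat.cast_nonneg t : (0 : ℝ) ≤ t)]
      have h2 : 0 ≤ 4 / μ * e (t + 1) := mul_nonneg (by positivity) (he _)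
      have h3 : (t + a - 2) * v t ≤ (t + a - 2) * W := by
        have : (0 : ℝ) ≤ t + a - 2 := by linarith [(Nat.cast_nonneg t : (0 : ℝ) ≤ t)]
        gcongr
      have := h' t
      exact le_of_mul_le_mul_left (a := (t : ℝ) + a) (by linarith) hs
  have hsum : 4 / μ * ∑ t ∈ Finset.Icc 1 T, t * e t + T * (T + a - 1) * v T ≤
      T * ((a - 2) * W + 4 * K / μ ^ 2) := by
    induction T with
    | zero => simp
    | succ T ih =>
      rw [Finset.sum_Icc_succ_top (by omega), mul_add]
      have h1 := mul_le_mul_of_nonneg_left (h' T) (by positivity : (0 : ℝ) ≤ T + 1)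
      have h2 : ((T : ℝ) + 1) * (4 * K / μ ^ 2 / (T + a)) ≤ 4 * K / μ ^ 2 := by
        rw [mul_div_assoc', div_le_iff₀ (by positivity), mul_comm]
        gcongr
        linarith
      have h3 : (a - 2) * v T ≤ (a - 2) * W := by
        have : 0 ≤ a - 2 := by linarith
        gcongr
        exact hvW T
      push_cast
      linarith
  have h4 : 0 ≤ T * (T + a - 1) * v T := by
    have : (0 : ℝ) ≤ T + a - 1 := by linarith [(Nat.cast_nonneg T : (0 : ℝ) ≤ T)]
    have := hv T
    positivity
  have h5 : ∑ t ∈ Finset.Icc 1 T, t * e t = μ / 4 * (4 / μ * ∑ t ∈ Finset.Icc 1 T, t * e t) := by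
    field_simp
  rw [h5, mul_left_comm (T : ℝ)]
  exact mul_le_mul_of_nonneg_left (by linarith) (by positivity)

lemma le_of_decaying_recursion {d : ℕ → ℝ} {μ K a : ℝ} (hμ : 0 < μ) (ha : 2 ≤ a) (hK : 0 ≤ K)
    (h0 : d 0 = 0) (h : ∀ t : ℕ, d (t + 1) ≤
      (1 - 2 / (μ * (t + a)) * μ) * d t + (2 / (μ * (t + a))) ^ 2 * K) (t : ℕ) :
    d t ≤ 4 * K / μ ^ 2 / (t + a) := by
  induction t with
  | zero => rw [h0]; positivity
  | succ t ih =>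
    have hs : (0 : ℝ) < t + a := by positivity
    set s : ℝ := t + a with hsdef
    set k := 4 * K / μ ^ 2 with hk
    have hk0 : 0 ≤ k := by positivity
    have h2s : 2 ≤ s := by rw [hsdef]; linarith [(Nat.cast_nonneg t : (0 : ℝ) ≤ t)]
    have h1 : 0 ≤ 1 - 2 / (μ * s) * μ := by
      have : 2 / (μ * s) * μ = 2 / s := by field_simp
      rw [this, sub_nonneg, div_le_one hs]
      exact h2s
    have e1 : ((t + 1 : ℕ) : ℝ) + a = s + 1 := by rw [hsdef]; push_cast; ring
    rw [e1]
    calc d (t + 1) ≤ (1 - 2 / (μ * s) * μ) * (k / s) + (2 / (μ * s)) ^ 2 * K := by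
          refine (h t).trans ?_
          gcongr
      _ = k * (s - 1) / s ^ 2 := by rw [hk]; field_simp; ring
      _ ≤ k / (s + 1) := by
          rw [div_le_div_iff₀ (by positivity) (by positivity)]
          nlinarith

/-! ### The upper bounds -/

section Upper

variable {O : StochasticOracle n} {f : E n → ℝ} {C : Set (E n)} {x₀ z : E n}
  {δ μ κ₁ κ₂ κ₃ ε D : ℝ} {T : ℕ}

/-- With the constant step `D² / (ε T)`, the initial distance contributes `ε / 2` to the accuracy of
the average, and so does the noise once `T` is of the order of `1 / ε²`. The deviation is that of
`T` independent errors of the size of the step. -/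
lemma averagedSGD_const_step (hP : IsConvexProblem f C x₀) (hO : O.IsInexact f C δ)
    (hz : z ∈ C) (hmin : IsMinOn f C z) (hzD : ‖x₀ - z‖ ≤ D) (hD : 0 < D)
    (hκ₁ : 0 ≤ κ₁) (hκ₂ : 0 ≤ κ₂) (hκ₃ : 0 ≤ κ₃) (hε : 0 < ε) (hT : 1 ≤ T)
    (hS : StepBounds f C z 0 κ₁ κ₂ κ₃ (D ^ 2 / (ε * T)))
    (hK : D ^ 2 * (κ₁ + κ₂ * δ ^ 2) ≤ ε ^ 2 * T) :
    (averagedSGD C x₀ (fun _ => D ^ 2 / (ε * T)) (fun _ => 1) T).IsAccurate O f C T ε ∧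
      (averagedSGD C x₀ (fun _ => D ^ 2 / (ε * T)) (fun _ => 1) T).deviation O T ≤
        ENNReal.ofReal (D ^ 4 * (κ₃ + 4 * δ ^ 2) / (T * ε ^ 2)) := by
  have hT' : (0 : ℝ) < T := by exact_mod_cast hT
  set η : ℝ := D ^ 2 / (ε * T) with hη
  have hηpos : 0 < η := by positivity
  obtain ⟨e, v, d, he, hv, hd, hv0, hd0, hrec, hrecd, hgap, hdev⟩ :=
    exists_real_recursion (η := fun _ => η) hP hO hz hmin hκ₁ hκ₂ hκ₃ (fun _ => hηpos)
      (fun _ => by simp) (fun _ => hS)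
  simp only [mul_zero, sub_zero, one_mul] at hrec hrecd
  constructor
  · refine averagedSGD_isAccurate hP hz hmin (fun _ _ => one_pos) hT he hgap ?_
    simp only [one_mul, Finset.sum_const, Nat.card_Icc, nsmul_eq_mul, mul_one, Nat.add_sub_cancel]
    have h1 := sum_le_of_const_recursion hv hrec T
    have h2 : v 0 ≤ D ^ 2 := by rw [hv0]; gcongr
    have h3 : T * (η ^ 2 * (κ₁ + κ₂ * δ ^ 2)) ≤ D ^ 2 := by
      calc T * (η ^ 2 * (κ₁ + κ₂ * δ ^ 2)) = D ^ 2 / (ε ^ 2 * T) * (D ^ 2 * (κ₁ + κ₂ * δ ^ 2)) := by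
            rw [hη]; field_simp
        _ ≤ D ^ 2 / (ε ^ 2 * T) * (ε ^ 2 * T) := by gcongr
        _ = D ^ 2 := by field_simp
    have h4 : 2 * η * (T * ε) = 2 * D ^ 2 := by rw [hη]; field_simp
    exact le_of_mul_le_mul_left (by linarith) (by positivity : 0 < 2 * η)
  · refine averagedSGD_deviation_le hP (fun _ _ => one_pos) hT hd hdev ?_
    simp only [one_mul, Finset.sum_const, Nat.card_Icc, nsmul_eq_mul, mul_one, Nat.add_sub_cancel]
    have h1 : ∀ t ∈ Finset.Icc 1 T, d t ≤ D ^ 4 * (κ₃ + 4 * δ ^ 2) / (T * ε ^ 2) := by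
      intro t ht
      have htT : (t : ℝ) ≤ T := by exact_mod_cast (Finset.mem_Icc.1 ht).2
      calc d t ≤ t * (η ^ 2 * (κ₃ + 4 * δ ^ 2)) := le_of_const_recursion hd0 hrecd t
        _ ≤ T * (η ^ 2 * (κ₃ + 4 * δ ^ 2)) := by gcongr
        _ = _ := by rw [hη]; field_simp
    simpa [nsmul_eq_mul] using Finset.sum_le_card_nsmul _ _ _ h1

/-- With steps `2 / (μ (t + a))`, the deviation is bounded twice: through the contraction of two
independent runs, which gives the order `1 / T`, and through the accuracy, which forces both outputs
to be close to the minimizer. -/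
lemma averagedSGD_decaying_step {a : ℝ} (hP : IsConvexProblem f C x₀) (hO : O.IsInexact f C δ)
    (hz : z ∈ C) (hmin : IsMinOn f C z) (hzD : ‖x₀ - z‖ ≤ D)
    (hκ₁ : 0 ≤ κ₁) (hκ₂ : 0 ≤ κ₂) (hκ₃ : 0 ≤ κ₃) (hμ : 0 < μ) (ha : 2 ≤ a) (hT : 1 ≤ T)
    (hf : StrongConvexOn C μ f)
    (hS : ∀ t : ℕ, StepBounds f C z μ κ₁ κ₂ κ₃ (2 / (μ * (t + a))))
    (hK : μ / 2 * ((a - 2) * (D ^ 2 + 2 * (κ₁ + κ₂ * δ ^ 2) / (μ ^ 2 * a)) +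
      4 * (κ₁ + κ₂ * δ ^ 2) / μ ^ 2) ≤ T * ε) :
    (averagedSGD C x₀ (fun t => 2 / (μ * (t + a))) (fun t => t) T).IsAccurate O f C T ε ∧
      (averagedSGD C x₀ (fun t => 2 / (μ * (t + a))) (fun t => t) T).deviation O T ≤
        ENNReal.ofReal (min (8 * (κ₃ + 4 * δ ^ 2) / μ ^ 2 / T) (8 / μ * ε)) := by
  have hT' : (0 : ℝ) < T := by exact_mod_cast hT
  have hw : ∀ t : ℕ, 1 ≤ t → (0 : ℝ) < t := fun t ht => by exact_mod_cast ht
  have hta : ∀ t : ℕ, (2 : ℝ) ≤ t + a := fun t => by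
    linarith [(Nat.cast_nonneg t : (0 : ℝ) ≤ t)]
  obtain ⟨e, v, d, he, hv, hd, hv0, hd0, hrec, hrecd, hgap, hdev⟩ :=
    exists_real_recursion (η := fun t => 2 / (μ * (t + a))) hP hO hz hmin hκ₁ hκ₂ hκ₃
      (fun t => by have := hta t; positivity)
      (fun t => by
        have := hta t
        have e : 2 / (μ * (t + a)) * μ = 2 / (t + a) := by field_simp
        simp only [e]
        rwa [div_le_one (by linarith)]) hS
  set K := κ₁ + κ₂ * δ ^ 2 with hKdef
  have hK0 : 0 ≤ K := by positivity
  have hacc :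
      (averagedSGD C x₀ (fun t => 2 / (μ * (t + a))) (fun t => t) T).IsAccurate O f C T ε := by
    refine averagedSGD_isAccurate hP hz hmin hw hT he hgap ?_
    have hW : 2 * K / (μ ^ 2 * a) ≤ D ^ 2 + 2 * K / (μ ^ 2 * a) := by nlinarith [sq_nonneg D]
    have hvD : v 0 ≤ D ^ 2 + 2 * K / (μ ^ 2 * a) := by
      have h1 : v 0 ≤ D ^ 2 := by rw [hv0]; gcongr
      have h2 : 0 ≤ 2 * K / (μ ^ 2 * a) := by positivity
      linarith
    refine (sum_le_of_decaying_recursion hμ ha hK0 he hv hvD hW hrec T).trans ?_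
    rw [sum_Icc_natCast]
    have hε : 0 ≤ ε := by
      have h1 : 0 ≤ μ / 2 * ((a - 2) * (D ^ 2 + 2 * K / (μ ^ 2 * a)) + 4 * K / μ ^ 2) := by
        have : 0 ≤ a - 2 := by linarith
        positivity
      exact nonneg_of_mul_nonneg_right (h1.trans hK) hT'
    have h2 : μ / 4 * ((a - 2) * (D ^ 2 + 2 * K / (μ ^ 2 * a)) + 4 * K / μ ^ 2) ≤ T * ε / 2 := by
      linarith
    calc _ ≤ T * (T * ε / 2) := by gcongr
      _ ≤ _ := by nlinarith
  refine ⟨hacc, ?_⟩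
  have h1 : (averagedSGD C x₀ (fun t => 2 / (μ * (t + a))) (fun t => t) T).deviation O T ≤
      ENNReal.ofReal (8 * (κ₃ + 4 * δ ^ 2) / μ ^ 2 / T) := by
    refine averagedSGD_deviation_le hP hw hT hd hdev ?_
    have h2 : ∀ t ∈ Finset.Icc 1 T, t * d t ≤ 4 * (κ₃ + 4 * δ ^ 2) / μ ^ 2 := by
      intro t _
      have h3 := le_of_decaying_recursion hμ ha (by positivity : 0 ≤ κ₃ + 4 * δ ^ 2) hd0 hrecd t
      have h4 : (0 : ℝ) < t + a := by linarith [hta t]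
      rw [le_div_iff₀ h4] at h3
      have h5 : 0 ≤ a * d t := mul_nonneg (by linarith) (hd t)
      linarith
    have h3 := Finset.sum_le_card_nsmul _ _ _ h2
    rw [sum_Icc_natCast]
    simp only [Nat.card_Icc, Nat.add_sub_cancel, nsmul_eq_mul] at h3
    refine h3.trans ?_
    have e : (T : ℝ) * (T + 1) / 2 * (8 * (κ₃ + 4 * δ ^ 2) / μ ^ 2 / T) =
        (T + 1) * (4 * (κ₃ + 4 * δ ^ 2) / μ ^ 2) := by field_simp; ring
    rw [e]
    gcongr
    linarith
  have h2 := deviation_le_of_isAccurate (averagedSGD_isMeasurable _ hP.isClosed hP.convex hP.mem _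
    T)
    hμ hf hz hmin hacc
  rcases le_total (8 * (κ₃ + 4 * δ ^ 2) / μ ^ 2 / T) (8 / μ * ε) with h | h
  · rwa [min_eq_left h]
  · rwa [min_eq_right h]

end Upper

lemma strongConvexOn_zero_of_isConvexProblem {f : E n → ℝ} {C : Set (E n)} {x₀ : E n}
    (hP : IsConvexProblem f C x₀) : StrongConvexOn C 0 f :=
  strongConvexOn_zero.2 (hP.convexOn.subset (subset_univ _) hP.convex)

lemma one_le_of_le_natCast {C₀ : ℝ} (hC₀ : 0 < C₀) {T : ℕ} (h : C₀ ≤ T) : 1 ≤ T := by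
  have : (0 : ℝ) < T := hC₀.trans_le h
  exact_mod_cast this

theorem deviationUpperBound_smoothClass (L : ℝ≥0) (D : ℝ) (hL : 0 < L) (hD : 0 < D) :
    DeviationUpperBound (smoothClass L D) (fun _ x₀ A => A.IsFOI x₀)
        (fun ε => 1 / ε ^ 2) (fun a ε T _ => a / (ε * T)) (fun _ => 1)
        (fun ε δ T => δ ^ 2 / (T * ε ^ 2)) := by
  intro Δ hΔ
  have hL' : (0 : ℝ) < L := hL
  refine ⟨D ^ 2, 4 * D ^ 4, (2 * L * D ^ 2) ^ 2 + 2 * D ^ 2 * Δ ^ 2, by positivity, by positivity,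
    by positivity, ?_⟩
  intro ε δ T hε hδ hδΔ hT n f C x₀ O hf hO
  obtain ⟨hP, hsm, z, hz, hmin, hzD⟩ := hf
  have hT1 : 1 ≤ T := one_le_of_le_natCast (by positivity) hT
  have hT' : (1 : ℝ) ≤ T := by exact_mod_cast hT1
  rw [mul_one_div, div_le_iff₀ (by positivity)] at hT
  have hη : 0 < D ^ 2 / (ε * T) := by positivity
  have hεT : 2 * L * D ^ 2 ≤ ε * T := by
    refine le_of_sq_le_sq ?_ (by positivity)
    have h1 : 0 ≤ 2 * D ^ 2 * Δ ^ 2 := by positivity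
    have h2 : T * ε ^ 2 ≤ (ε * T) ^ 2 := by nlinarith [sq_nonneg ε]
    linarith
  have hηL : D ^ 2 / (ε * T) * L ≤ 1 / 2 := by
    rw [div_mul_eq_mul_div, div_le_iff₀ (by positivity)]
    linarith
  have hS := stepBounds_of_isSmooth hP.isClosed hP.convex hL hsm le_rfl
    (strongConvexOn_zero_of_isConvexProblem hP) hz hη hηL
  have hδ2 : δ ^ 2 ≤ Δ ^ 2 := by gcongr
  obtain ⟨h1, h2⟩ := averagedSGD_const_step hP hO hz hmin hzD hD le_rfl zero_le_two le_rfl hε hT1 hS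
    (by
      have : D ^ 2 * δ ^ 2 ≤ D ^ 2 * Δ ^ 2 := by gcongr
      have : 0 ≤ (2 * L * D ^ 2) ^ 2 := by positivity
      linarith)
  refine ⟨averagedSGD_isMeasurable _ hP.isClosed hP.convex hP.mem _ T, fun h =>
    (averagedSGD_isFOILatest h (fun _ => hη) (fun _ _ => one_pos) hT1).isFOI, h1, h2.trans ?_⟩
  refine ENNReal.ofReal_le_ofReal (le_of_eq ?_)
  ring

theorem deviationUpperBound_lipschitzClass (G : ℝ≥0) (D : ℝ) (hG : 0 < G) (hD : 0 < D) :
    DeviationUpperBound (lipschitzClass G D) (fun _ x₀ A => A.IsFOILatest x₀)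
        (fun ε => 1 / ε ^ 2) (fun a ε T _ => a / (ε * T)) (fun _ => 1)
        (fun ε _ T => 1 / (T * ε ^ 2)) := by
  intro Δ hΔ
  have hG' : (0 : ℝ) < G := hG
  refine ⟨D ^ 2, D ^ 4 * (4 * G ^ 2 + 4 * Δ ^ 2), D ^ 2 * (5 * G ^ 2 + 4 * Δ ^ 2), by positivity,
    by positivity, by positivity, ?_⟩
  intro ε δ T hε hδ hδΔ hT n f C x₀ O hf hO
  obtain ⟨hP, hlip, z, hz, hmin, hzD⟩ := hf
  have hT1 : 1 ≤ T := one_le_of_le_natCast (by positivity) hT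
  have hT' : (1 : ℝ) ≤ T := by exact_mod_cast hT1
  rw [mul_one_div, div_le_iff₀ (by positivity)] at hT
  have hη : 0 < D ^ 2 / (ε * T) := by positivity
  have hS := stepBounds_of_isLipschitzNear hP.isClosed hP.convex hlip le_rfl
    (strongConvexOn_zero_of_isConvexProblem hP) hz hη
  have hδ2 : δ ^ 2 ≤ Δ ^ 2 := by gcongr
  obtain ⟨h1, h2⟩ := averagedSGD_const_step hP hO hz hmin hzD hD (by positivity) (by norm_num)
    (by positivity) hε hT1 hS
    (by
      have : D ^ 2 * (5 * G ^ 2 + 4 * δ ^ 2) ≤ D ^ 2 * (5 * G ^ 2 + 4 * Δ ^ 2) := by gcongr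
      linarith)
  refine ⟨averagedSGD_isMeasurable _ hP.isClosed hP.convex hP.mem _ T, fun h =>
    averagedSGD_isFOILatest h (fun _ => hη) (fun _ _ => one_pos) hT1, h1, h2.trans ?_⟩
  refine ENNReal.ofReal_le_ofReal ?_
  rw [mul_one_div]
  gcongr

theorem deviationUpperBound_smoothStrongClass (L : ℝ≥0) (μ D : ℝ) (hμ : 0 < μ) (hμL : μ ≤ L) :
    DeviationUpperBound (smoothStrongClass L μ D) (fun _ x₀ A => A.IsFOI x₀)
        (fun ε => 1 / ε) (fun a _ _ t => 2 / (μ * (t + a))) (fun t => t)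
        (fun ε δ T => min (δ ^ 2 / T) ε) := by
  intro Δ hΔ
  have hL' : (0 : ℝ) < L := hμ.trans_le hμL
  have hL : 0 < L := hL'
  -- This makes the first and longest step equal to `1 / (2 L)`.
  set a : ℝ := 4 * L / μ with ha
  have ha2 : 2 ≤ a := by rw [ha, le_div_iff₀ hμ]; linarith
  have ha2' : 0 ≤ a - 2 := by linarith
  refine ⟨a, 32 / μ ^ 2 + 8 / μ, μ / 2 * ((a - 2) * (D ^ 2 + 2 * (0 + 2 * Δ ^ 2) / (μ ^ 2 * a)) +
      4 * (0 + 2 * Δ ^ 2) / μ ^ 2), by positivity, by positivity, by positivity, ?_⟩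
  intro ε δ T hε hδ hδΔ hT n f C x₀ O hf hO
  obtain ⟨hP, hsm, hst, z, hz, hmin, hzD⟩ := hf
  have hT1 : 1 ≤ T := one_le_of_le_natCast (by positivity) hT
  have hT' : (1 : ℝ) ≤ T := by exact_mod_cast hT1
  rw [mul_one_div, div_le_iff₀ (by positivity)] at hT
  have hη : ∀ t : ℕ, 0 < 2 / (μ * (t + a)) := fun t => by positivity
  have hS := fun t : ℕ => stepBounds_of_isSmooth hP.isClosed hP.convex hL hsm hμ.le hst hz (hη t)
    (by
      rw [div_mul_eq_mul_div, div_le_iff₀ (by positivity), mul_add, ha]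
      have : μ * (4 * L / μ) = 4 * L := by field_simp
      have : 0 ≤ μ * (t : ℝ) := by positivity
      linarith)
  have hδ2 : δ ^ 2 ≤ Δ ^ 2 := by gcongr
  obtain ⟨h1, h2⟩ := averagedSGD_decaying_step hP hO hz hmin hzD le_rfl zero_le_two le_rfl hμ ha2
    hT1 hst hS (ε := ε) (hT.trans' (by gcongr))
  refine ⟨averagedSGD_isMeasurable _ hP.isClosed hP.convex hP.mem _ T, fun h =>
    (averagedSGD_isFOILatest h hη (fun t ht => by exact_mod_cast ht) hT1).isFOI, h1, h2.trans ?_⟩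
  refine ENNReal.ofReal_le_ofReal ?_
  rw [mul_min_of_nonneg _ _ (by positivity)]
  refine min_le_min ?_ ?_
  · have e : 8 * (0 + 4 * δ ^ 2) / μ ^ 2 / T = 32 / μ ^ 2 * (δ ^ 2 / T) := by field_simp; ring
    rw [e]
    gcongr
    have : 0 < 8 / μ := by positivity
    linarith
  · gcongr
    have : 0 < 32 / μ ^ 2 := by positivity
    linarith

/-- A domain on which a function is both Lipschitz and strongly convex is bounded: strong convexity
puts the value at the midpoint far below the mean of the values at the endpoints. -/
lemma norm_sub_le_of_isLipschitzNear {f : E n → ℝ} {C : Set (E n)} {G : ℝ≥0} {μ : ℝ} (hμ : 0 < μ)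
    (hf : IsLipschitzNear G f C) (hs : StrongConvexOn C μ f) {x y : E n} (hx : x ∈ C) (hy : y ∈ C) :
    ‖x - y‖ ≤ 4 * G / μ := by
  obtain ⟨U, -, hCU, hL⟩ := hf
  have hm := hs.1 hx hy (by norm_num : (0 : ℝ) ≤ 1 / 2) (by norm_num : (0 : ℝ) ≤ 1 / 2)
    (by norm_num)
  have h1 := hs.2 hx hy (by norm_num : (0 : ℝ) ≤ 1 / 2) (by norm_num : (0 : ℝ) ≤ 1 / 2)
    (by norm_num)
  have h2 := (le_abs_self _).trans (hL.norm_sub_le (hCU hx) (hCU hm))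
  have h3 := (le_abs_self _).trans (hL.norm_sub_le (hCU hy) (hCU hm))
  have e1 : x - ((1 / 2 : ℝ) • x + (1 / 2 : ℝ) • y) = (1 / 2 : ℝ) • (x - y) := by module
  have e2 : y - ((1 / 2 : ℝ) • x + (1 / 2 : ℝ) • y) = (-(1 / 2) : ℝ) • (x - y) := by module
  rw [e1, norm_smul] at h2
  rw [e2, norm_smul] at h3
  norm_num at h1 h2 h3
  rw [le_div_iff₀ hμ]
  by_contra! hlt
  have h0 : 0 < ‖x - y‖ := by
    by_contra! h
    have h0 : ‖x - y‖ = 0 := le_antisymm h (norm_nonneg _)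
    rw [h0, zero_mul] at hlt
    have := G.2
    simp only [NNReal.val_eq_coe] at this
    linarith
  nlinarith

theorem deviationUpperBound_lipschitzStrongClass (G : ℝ≥0) (μ : ℝ) (hG : 0 < G) (hμ : 0 < μ) :
    DeviationUpperBound (lipschitzStrongClass G μ) (fun _ x₀ A => A.IsFOILatest x₀)
        (fun ε => 1 / ε) (fun a _ _ t => 2 / (μ * (t + a))) (fun t => t)
        (fun ε _ T => min (1 / T) ε) := by
  intro Δ hΔ
  have hG' : (0 : ℝ) < G := hG
  -- The value `a = 2` makes the first step `1 / μ`, so that the initial point is forgotten. The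
  -- factor `2 - 2` records that it does not contribute to the number of iterations.
  refine ⟨2, 8 * (4 * G ^ 2 + 4 * Δ ^ 2) / μ ^ 2 + 8 / μ,
    μ / 2 * ((2 - 2) * ((4 * G / μ) ^ 2 + 2 * (5 * G ^ 2 + 4 * Δ ^ 2) / (μ ^ 2 * 2)) +
      4 * (5 * G ^ 2 + 4 * Δ ^ 2) / μ ^ 2), by positivity, by positivity, ?_, ?_⟩
  · rw [sub_self, zero_mul, zero_add]; positivity
  intro ε δ T hε hδ hδΔ hT n f C x₀ O hf hO
  obtain ⟨hP, hlip, hst⟩ := hf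
  have hbdd : Bornology.IsBounded C := by
    refine (Metric.isBounded_closedBall (x := x₀) (r := 4 * G / μ)).subset fun x hx => ?_
    rw [Metric.mem_closedBall, dist_eq_norm]
    exact norm_sub_le_of_isLipschitzNear hμ hlip hst hx hP.mem
  obtain ⟨z, hz, hmin⟩ := (Metric.isCompact_of_isClosed_isBounded hP.isClosed hbdd).exists_isMinOn
    ⟨x₀, hP.mem⟩ hP.continuous.continuousOn
  have hzD := norm_sub_le_of_isLipschitzNear hμ hlip hst hP.mem hz
  have hT1 : 1 ≤ T := one_le_of_le_natCast (by rw [sub_self, zero_mul, zero_add]; positivity) hT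
  have hT' : (1 : ℝ) ≤ T := by exact_mod_cast hT1
  rw [mul_one_div, div_le_iff₀ (by positivity)] at hT
  have hη : ∀ t : ℕ, 0 < 2 / (μ * ((t : ℝ) + 2)) := fun t => by positivity
  have hS := fun t : ℕ => stepBounds_of_isLipschitzNear hP.isClosed hP.convex hlip hμ.le hst hz
    (hη t)
  have hδ2 : δ ^ 2 ≤ Δ ^ 2 := by gcongr
  obtain ⟨h1, h2⟩ := averagedSGD_decaying_step hP hO hz hmin hzD (by positivity) (by norm_num)
    (by positivity) hμ le_rfl hT1 hst hS (ε := ε)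
    (hT.trans' (by rw [sub_self, zero_mul, zero_mul]; gcongr))
  refine ⟨averagedSGD_isMeasurable _ hP.isClosed hP.convex hP.mem _ T, fun h =>
    averagedSGD_isFOILatest h hη (fun t ht => by exact_mod_cast ht) hT1, h1, h2.trans ?_⟩
  refine ENNReal.ofReal_le_ofReal ?_
  rw [mul_min_of_nonneg _ _ (by positivity)]
  refine min_le_min ?_ ?_
  · rw [mul_one_div]
    gcongr
    have h3 : 8 * (4 * G ^ 2 + 4 * δ ^ 2) / μ ^ 2 ≤ 8 * (4 * G ^ 2 + 4 * Δ ^ 2) / μ ^ 2 := by gcongr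
    have : 0 < 8 / μ := by positivity
    linarith
  · gcongr
    have : 0 < 8 * ((4 * G ^ 2 + 4 * Δ ^ 2) / μ ^ 2) := by positivity
    have : 8 * (4 * G ^ 2 + 4 * Δ ^ 2) / μ ^ 2 = 8 * ((4 * G ^ 2 + 4 * Δ ^ 2) / μ ^ 2) := by ring
    linarith

/-! ### Hard instances: coordinates, seeds and noise -/

/-- The coordinates of the hard instances with `T` iterations: a base direction `inl false`, along
which an accurate algorithm has to move, an auxiliary direction `inl true`, and two families of
coordinates indexed by an iteration and a bit: `inr (false, t, b)`, called values, and
`inr (true, t, b)`, called traces. -/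
abbrev Coord (T : ℕ) : Type := Bool ⊕ (Bool × Fin T × Bool)

/-- An enumeration of the coordinates. -/
noncomputable def coordEquiv (T : ℕ) : Coord T ≃ Fin (2 + 4 * T) :=
  Fintype.equivFinOfCardEq (by simp; ring)

variable {T : ℕ}

/-- The unit vector in the direction of a coordinate. -/
noncomputable def unitVec (c : Coord T) : E (2 + 4 * T) := EuclideanSpace.single (coordEquiv T c) 1

/-- The `c`-th coordinate of a vector. -/
noncomputable def coord (c : Coord T) (x : E (2 + 4 * T)) : ℝ := x (coordEquiv T c)

lemma coord_unitVec (c c' : Coord T) : coord c (unitVec c') = if c = c' then 1 else 0 := by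
  simp [coord, unitVec, PiLp.single_apply]

@[simp] lemma coord_add (c : Coord T) (x y : E (2 + 4 * T)) : coord c (x + y) = coord c x + coord c
    y :=
  rfl

@[simp] lemma coord_sub (c : Coord T) (x y : E (2 + 4 * T)) : coord c (x - y) = coord c x - coord c
    y :=
  rfl

@[simp] lemma coord_smul (c : Coord T) (a : ℝ) (x : E (2 + 4 * T)) : coord c (a • x) = a * coord c
    x :=
  rfl

@[simp] lemma coord_zero (c : Coord T) : coord c 0 = 0 := rfl

lemma coord_sum {ι : Type*} (S : Finset ι) (c : Coord T) (x : ι → E (2 + 4 * T)) :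
    coord c (∑ i ∈ S, x i) = ∑ i ∈ S, coord c (x i) := by
  induction S using Finset.cons_induction with
  | empty => simp
  | cons a S ha ih => rw [Finset.sum_cons, Finset.sum_cons, coord_add, ih]

lemma inner_unitVec (c : Coord T) (x : E (2 + 4 * T)) : ⟪unitVec c, x⟫ = coord c x := by
  simp [unitVec, coord, EuclideanSpace.inner_single_left]

@[simp] lemma norm_unitVec (c : Coord T) : ‖unitVec c‖ = 1 := by simp [unitVec]

lemma measurable_coord (c : Coord T) : Measurable (coord c) := by
  unfold coord; fun_prop

lemma sum_coord_sq_le (x : E (2 + 4 * T)) (S : Finset (Coord T)) :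
    ∑ c ∈ S, coord c x ^ 2 ≤ ‖x‖ ^ 2 := by
  rw [EuclideanSpace.real_norm_sq_eq, ← (coordEquiv T).sum_comp]
  exact Finset.sum_le_sum_of_subset_of_nonneg (Finset.subset_univ _) fun _ _ _ => sq_nonneg _

/-- The sign `±1` encoded by a bit. -/
def sign (b : Bool) : ℝ := if b then 1 else -1

lemma sign_mul_self (b : Bool) : sign b * sign b = 1 := by cases b <;> simp [sign]

lemma abs_sign (b : Bool) : |sign b| = 1 := by cases b <;> simp [sign]

/-- The uniform law on the seeds of the hard instances. The first bit of a seed selects the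
coordinate of the noise, the second one its sign. -/
noncomputable def bitsLaw : Measure (Bool × Bool) := (4 : ℝ≥0∞)⁻¹ • Measure.count

instance : IsProbabilityMeasure bitsLaw := ⟨by
  rw [bitsLaw, Measure.smul_apply, ← Finset.coe_univ, Measure.count_apply_finset]
  simp
  exact ENNReal.inv_mul_cancel (by simp) (by simp)⟩

lemma integral_bitsLaw {n : ℕ} (F : Bool × Bool → E n) :
    ∫ s, F s ∂bitsLaw = (4 : ℝ)⁻¹ • ∑ s, F s := by
  rw [bitsLaw, integral_smul_measure, integral_count]
  simp

/-- The answers `m x + ρ x • N t s` with mean `m x` and centred noise `N t s`. -/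
noncomputable def noisyOracle {n : ℕ} (m : E n → E n) (ρ : E n → ℝ) (N : ℕ → Bool × Bool → E n)
    (hm : Measurable m) (hρ : Measurable ρ) : StochasticOracle n where
  Seed := Bool × Bool
  law := bitsLaw
  out := fun t x s => m x + ρ x • N t s
  measurable_out := fun t => (hm.comp measurable_fst).add
    ((hρ.comp measurable_fst).smul ((measurable_of_finite (N t)).comp measurable_snd))

lemma noisyOracle_isInexact {n : ℕ} {m : E n → E n} {ρ : E n → ℝ} {N : ℕ → Bool × Bool → E n}
    (hm : Measurable m) (hρ : Measurable ρ) {f : E n → ℝ} {δ : ℝ}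
    (hsub : ∀ x, IsSubgradient f x (m x)) (hρδ : ∀ x, |ρ x| ≤ δ) (hN : ∀ t s, ‖N t s‖ ≤ 1)
    (hN0 : ∀ t, ∑ s, N t s = 0) (S : Set (E n)) : (noisyOracle m ρ N hm hρ).IsInexact f S δ := by
  intro t x _
  have hmean : ∫ s, (m x + ρ x • N t s) ∂bitsLaw = m x := by
    rw [integral_bitsLaw, Finset.sum_add_distrib, ← Finset.smul_sum, hN0, smul_zero, add_zero,
      Finset.sum_const, Finset.card_univ, ← Nat.cast_smul_eq_nsmul ℝ, smul_smul]
    simp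
  show Integrable (fun s => m x + ρ x • N t s) bitsLaw ∧
    IsSubgradient f x (∫ s, (m x + ρ x • N t s) ∂bitsLaw) ∧
    ∫⁻ s, ‖(m x + ρ x • N t s) - ∫ s', (m x + ρ x • N t s') ∂bitsLaw‖ₑ ^ 2 ∂bitsLaw ≤ _
  rw [hmean]
  refine ⟨Integrable.of_finite, hsub x, ?_⟩
  calc _ ≤ ∫⁻ _, ENNReal.ofReal (δ ^ 2) ∂bitsLaw := by
        refine lintegral_mono fun s => ?_
        rw [enorm_sq_eq_ofReal, add_sub_cancel_left]
        refine ENNReal.ofReal_le_ofReal ?_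
        rw [norm_smul, Real.norm_eq_abs]
        have h1 : |ρ x| * ‖N t s‖ ≤ δ * 1 :=
          mul_le_mul (hρδ x) (hN t s) (norm_nonneg _) ((abs_nonneg _).trans (hρδ x))
        rw [mul_one] at h1
        gcongr
    _ = _ := by simp

/-- The noise of the hard instances: a random sign times the unit vector of one of the two
coordinates with index `t` of the kind `κ`. There is no noise after the first `T` calls. -/
noncomputable def bitNoise (T : ℕ) (κ : Bool) (t : ℕ) (s : Bool × Bool) : E (2 + 4 * T) :=
  if h : t < T then sign s.2 • unitVec (.inr (κ, ⟨t, h⟩, s.1)) else 0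

lemma bitNoise_of_lt (κ : Bool) {t : ℕ} (h : t < T) (s : Bool × Bool) :
    bitNoise T κ t s = sign s.2 • unitVec (.inr (κ, ⟨t, h⟩, s.1)) := dif_pos h

lemma norm_bitNoise_le (κ : Bool) (t : ℕ) (s : Bool × Bool) : ‖bitNoise T κ t s‖ ≤ 1 := by
  unfold bitNoise
  split_ifs
  · rw [norm_smul, norm_unitVec, Real.norm_eq_abs, abs_sign, one_mul]
  · simp

lemma sum_bitNoise (κ : Bool) (t : ℕ) : ∑ s, bitNoise T κ t s = 0 := by
  unfold bitNoise
  split_ifs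
  · simp [Fintype.sum_prod_type, sign]
  · simp

/-! ### The deviation caused by the identity of the noisy coordinates -/

/-- A lower bound for `u²` that is linear in the gap `m - p u`, and can thus be integrated. -/
lemma sq_bound_of_gap {m p u : ℝ} (hm : 0 < m) (hp : 0 < p) :
    ENNReal.ofReal (3 / 4 * (m / p) ^ 2) ≤ ENNReal.ofReal (u ^ 2) +
      ENNReal.ofReal (m / p ^ 2) * ENNReal.ofReal (m - p * u) := by
  rw [← ENNReal.ofReal_mul (by positivity)]
  refine le_trans ?_ ENNReal.ofReal_add_le
  refine ENNReal.ofReal_le_ofReal ?_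
  have e : u ^ 2 + m / p ^ 2 * (m - p * u) = (u - m / p / 2) ^ 2 + 3 / 4 * (m / p) ^ 2 := by
    field_simp; ring
  rw [e]
  nlinarith [sq_nonneg (u - m / p / 2)]

/-- Suppose that the value coordinates of a random vector, one pair for each iteration, vanish
unless selected by fair bits, and that the selected ones control the base coordinate. Two
independent copies select different coordinates for half of the iterations, so they deviate by a
fraction of the norm of the selected part, while a small expected gap forces the base coordinate to
be large. -/
lemma lintegral_norm_sub_sq_ge_of_selected {Ω : Type*} [MeasurableSpace Ω] {P : Measure Ω}
    [IsProbabilityMeasure P] (hT : 1 ≤ T) {X : Ω → E (2 + 4 * T)} (hX : Measurable X)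
    {ξ : Fin T → Ω → Bool} (hξ : ∀ t, Measurable (ξ t)) (hhalf : ∀ t b, P {ω | ξ t ω = b} = 2⁻¹)
    {q M p : ℝ} (hM : 0 < M) (hp : 0 < p)
    (hgap : ∫⁻ ω, ENNReal.ofReal (M - p * coord (.inl false) (X ω)) ∂P ≤ ENNReal.ofReal (M / 2))
    (hzero : ∀ ω t, coord (.inr (false, t, !ξ t ω)) (X ω) = 0)
    (hsel : ∀ ω, q ^ 2 * coord (.inl false) (X ω) ^ 2 ≤
      T * ∑ t : Fin T, coord (.inr (false, t, ξ t ω)) (X ω) ^ 2) :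
    ENNReal.ofReal (q ^ 2 * M ^ 2 / (8 * T * p ^ 2)) ≤ ∫⁻ ω, ∫⁻ ω', ‖X ω - X ω'‖ₑ ^ 2 ∂P ∂P := by
  have hT' : (0 : ℝ) < T := by exact_mod_cast hT
  have hbase : ENNReal.ofReal (M ^ 2 / (4 * p ^ 2)) ≤
      ∫⁻ ω, ENNReal.ofReal (coord (.inl false) (X ω) ^ 2) ∂P := by
    have hmeas : Measurable fun ω => ENNReal.ofReal (coord (.inl false) (X ω) ^ 2) :=
      (((measurable_coord _).comp hX).pow_const 2).ennreal_ofReal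
    have h2 : ENNReal.ofReal (3 / 4 * (M / p) ^ 2) ≤
        ∫⁻ ω, ENNReal.ofReal (coord (.inl false) (X ω) ^ 2) ∂P +
          ENNReal.ofReal (M / p ^ 2 * (M / 2)) := by
      calc ENNReal.ofReal (3 / 4 * (M / p) ^ 2)
          = ∫⁻ _, ENNReal.ofReal (3 / 4 * (M / p) ^ 2) ∂P := by
            rw [lintegral_const, measure_univ, mul_one]
        _ ≤ ∫⁻ ω, (ENNReal.ofReal (coord (.inl false) (X ω) ^ 2) +
              ENNReal.ofReal (M / p ^ 2) *
                ENNReal.ofReal (M - p * coord (.inl false) (X ω))) ∂P :=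
            lintegral_mono fun ω => sq_bound_of_gap hM hp
        _ ≤ _ := by
            rw [lintegral_add_left hmeas,
              lintegral_const_mul' _ _ ENNReal.ofReal_ne_top, ENNReal.ofReal_mul (by positivity)]
            gcongr
    have h3 : 3 / 4 * (M / p) ^ 2 = M ^ 2 / (4 * p ^ 2) + M / p ^ 2 * (M / 2) := by
      field_simp; ring
    rw [h3, ENNReal.ofReal_add (by positivity) (by positivity)] at h2
    exact (ENNReal.add_le_add_iff_right ENNReal.ofReal_ne_top).1 h2
  have hms : ∀ t b, MeasurableSet {ω | ξ t ω = b} := fun t b => hξ t (measurableSet_singleton b)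
  calc ENNReal.ofReal (q ^ 2 * M ^ 2 / (8 * T * p ^ 2))
      = ENNReal.ofReal (q ^ 2 / (2 * T)) * ENNReal.ofReal (M ^ 2 / (4 * p ^ 2)) := by
        rw [← ENNReal.ofReal_mul (by positivity)]
        congr 1
        field_simp
        ring
    _ ≤ ∫⁻ ω, ENNReal.ofReal (q ^ 2 / (2 * T)) *
          ENNReal.ofReal (coord (.inl false) (X ω) ^ 2) ∂P := by
        rw [lintegral_const_mul' _ _ ENNReal.ofReal_ne_top]
        gcongr
    _ ≤ ∫⁻ ω, ∑ t : Fin T, ENNReal.ofReal (coord (.inr (false, t, ξ t ω)) (X ω) ^ 2) * 2⁻¹ ∂P := by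
        refine lintegral_mono fun ω => ?_
        have h2 : (2 : ℝ≥0∞)⁻¹ = ENNReal.ofReal 2⁻¹ := by
          rw [ENNReal.ofReal_inv_of_pos (by norm_num)]; simp
        rw [← Finset.sum_mul, ← ENNReal.ofReal_sum_of_nonneg fun _ _ => sq_nonneg _, h2,
          ← ENNReal.ofReal_mul (by positivity), ← ENNReal.ofReal_mul (by positivity)]
        refine ENNReal.ofReal_le_ofReal ?_
        rw [div_mul_eq_mul_div, div_le_iff₀ (by positivity)]
        have := hsel ω
        linarith
    _ = ∫⁻ ω, ∫⁻ ω', ∑ t : Fin T, {ω' | ξ t ω' = !ξ t ω}.indicator (fun _ =>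
          ENNReal.ofReal (coord (.inr (false, t, ξ t ω)) (X ω) ^ 2)) ω' ∂P ∂P := by
        refine lintegral_congr fun ω => ?_
        rw [lintegral_finsetSum _ fun t _ => measurable_const.indicator (hms t _)]
        refine Finset.sum_congr rfl fun t _ => ?_
        rw [lintegral_indicator_const (hms t _), hhalf]
    _ ≤ _ := by
        refine lintegral_mono fun ω => lintegral_mono fun ω' => ?_
        have h1 : ∀ t : Fin T, {ω' | ξ t ω' = !ξ t ω}.indicator (fun _ =>
            ENNReal.ofReal (coord (.inr (false, t, ξ t ω)) (X ω) ^ 2)) ω' ≤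
            ENNReal.ofReal (coord (.inr (false, t, ξ t ω)) (X ω - X ω') ^ 2) := by
          intro t
          by_cases h : ξ t ω' = !ξ t ω
          · rw [indicator_of_mem (by exact h)]
            have h2 := hzero ω' t
            rw [h, Bool.not_not] at h2
            rw [coord_sub, h2, sub_zero]
          · rw [indicator_of_notMem (by exact h)]
            positivity
        refine (Finset.sum_le_sum fun t _ => h1 t).trans ?_
        rw [← ENNReal.ofReal_sum_of_nonneg fun _ _ => sq_nonneg _, enorm_sq_eq_ofReal]
        refine ENNReal.ofReal_le_ofReal ?_
        have hinj : Function.Injective fun t : Fin T => (.inr (false, t, ξ t ω) : Coord T) := by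
          intro t t' h
          simp only [Sum.inr.injEq, Prod.mk.injEq, true_and] at h
          exact h.1
        have h3 := sum_coord_sq_le (X ω - X ω') (Finset.univ.map ⟨_, hinj⟩)
        rwa [Finset.sum_map] at h3

/-- `lintegral_norm_sub_sq_ge_of_selected` for the output of an accurate algorithm. Here `p` is the
slope at which the objective decreases in the base direction, `M` is the possible decrease, and `q`
is the size of the value coordinates relative to the base coordinate. -/
lemma deviation_ge_of_selected {m : E (2 + 4 * T) → E (2 + 4 * T)} {ρ : E (2 + 4 * T) → ℝ}
    {N : ℕ → Bool × Bool → E (2 + 4 * T)} {hm : Measurable m} {hρ : Measurable ρ}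
    (hT : 1 ≤ T) {A : Algorithm (2 + 4 * T)} (hA : A.IsMeasurable) {f : E (2 + 4 * T) → ℝ}
    {C : Set (E (2 + 4 * T))} {ε q M p : ℝ} (hM : 0 < M) (hp : 0 < p)
    (hacc : A.IsAccurate (noisyOracle m ρ N hm hρ) f C T ε) (hε : ε ≤ M / 2)
    (hgap : ∀ ω, M - p * coord (.inl false) (A.output (noisyOracle m ρ N hm hρ) T ω) ≤
      f (A.output (noisyOracle m ρ N hm hρ) T ω) - sInf (f '' C))
    (hzero : ∀ (c : A.Coin) (s : ℕ → Bool × Bool) (t : Fin T),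
      coord (.inr (false, t, !(s t).1)) (A.output (noisyOracle m ρ N hm hρ) T (c, s)) = 0)
    (hsel : ∀ (c : A.Coin) (s : ℕ → Bool × Bool),
      q ^ 2 * coord (.inl false) (A.output (noisyOracle m ρ N hm hρ) T (c, s)) ^ 2 ≤
      T * ∑ t : Fin T,
        coord (.inr (false, t, (s t).1)) (A.output (noisyOracle m ρ N hm hρ) T (c, s)) ^ 2) :
    ENNReal.ofReal (q ^ 2 * M ^ 2 / (8 * T * p ^ 2)) ≤ A.deviation (noisyOracle m ρ N hm hρ) T := by
  rw [Algorithm.deviation_eq _ hA]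
  have hfst : Measurable fun u : Bool × Bool => u.1 := measurable_fst
  refine lintegral_norm_sub_sq_ge_of_selected (Ω := A.Coin × (ℕ → Bool × Bool))
    (P := A.coinLaw.prod (Measure.infinitePi fun _ : ℕ => bitsLaw))
    (ξ := fun (t : Fin T) ω => (ω.2 t).1) hT
    (Algorithm.measurable_output _ hA T)
    (fun t => hfst.comp ((measurable_pi_apply (t : ℕ)).comp measurable_snd)) ?_ hM hp
    ((lintegral_mono fun ω => ENNReal.ofReal_le_ofReal (hgap ω)).trans
      (hacc.2.trans (ENNReal.ofReal_le_ofReal hε)))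
    (fun ω t => hzero ω.1 ω.2 t) (fun ω => hsel ω.1 ω.2)
  intro t b
  have h1 : MeasurePreserving (fun ω : A.Coin × (ℕ → Bool × Bool) => ω.2 t)
      (A.coinLaw.prod (Measure.infinitePi fun _ : ℕ => bitsLaw)) bitsLaw :=
    (measurePreserving_eval_infinitePi (fun _ : ℕ => bitsLaw) (t : ℕ)).comp measurePreserving_snd
  have h2 := h1.measure_preimage (s := {u | u.1 = b})
    (hfst (measurableSet_singleton b)).nullMeasurableSet
  refine h2.trans ?_
  have h3 : ({u : Bool × Bool | u.1 = b}) = ((({b} : Finset Bool) ×ˢ Finset.univ : Finset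
    (Bool × Bool)) :
      Set (Bool × Bool)) := by
    ext u
    simp only [mem_ofPred_eq, Finset.mem_coe, Finset.mem_product, Finset.mem_singleton,
      Finset.mem_univ, and_true]
  rw [bitsLaw, Measure.smul_apply, h3, Measure.count_apply_finset]
  simp only [Finset.card_product, Finset.card_singleton, Finset.card_univ, Fintype.card_bool,
    one_mul,
    smul_eq_mul]
  rw [show (4 : ℝ≥0∞) = 2 * 2 by norm_num, ENNReal.mul_inv (by simp) (by simp), mul_assoc]
  push_cast
  rw [ENNReal.inv_mul_cancel (by simp) (by simp), mul_one]

/-! ### Smooth objectives of one variable -/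

/-- The derivative of `v ↦ √(r² + v²)`. -/
noncomputable def hyperbolaSlope (r v : ℝ) : ℝ := v / √(r ^ 2 + v ^ 2)

section Hyperbola

variable {r : ℝ}

lemma sqrt_sq_add_sq_pos (hr : 0 < r) (v : ℝ) : 0 < √(r ^ 2 + v ^ 2) :=
  Real.sqrt_pos.2 (by positivity)

lemma abs_hyperbolaSlope_le (hr : 0 < r) (v : ℝ) : |hyperbolaSlope r v| ≤ 1 := by
  rw [hyperbolaSlope, abs_div, abs_of_pos (sqrt_sq_add_sq_pos hr v),
    div_le_one (sqrt_sq_add_sq_pos hr v), ← Real.sqrt_sq_eq_abs]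
  exact Real.sqrt_le_sqrt (by nlinarith)

lemma hasDerivAt_hyperbola (hr : 0 < r) (v : ℝ) :
    HasDerivAt (fun v => √(r ^ 2 + v ^ 2)) (hyperbolaSlope r v) v := by
  have h := (((hasDerivAt_id v).pow 2).const_add (r ^ 2)).sqrt (by simp; positivity)
  refine h.congr_deriv ?_
  simp [hyperbolaSlope]
  field_simp

lemma le_sqrt_sq_add_sq (r v : ℝ) : r ≤ √(r ^ 2 + v ^ 2) :=
  Real.le_sqrt_of_sq_le (by nlinarith [sq_nonneg v])

lemma abs_le_sqrt_sq_add_sq (v : ℝ) : |v| ≤ √(r ^ 2 + v ^ 2) :=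
  Real.abs_le_sqrt (by nlinarith [sq_nonneg r])

lemma abs_hyperbolaSlope_sub_le (hr : 0 < r) (v w : ℝ) :
    |hyperbolaSlope r v - hyperbolaSlope r w| ≤ |v - w| / r := by
  have hd : ∀ v, HasDerivAt (hyperbolaSlope r) (r ^ 2 / √(r ^ 2 + v ^ 2) ^ 3) v := by
    intro v
    have hs := sqrt_sq_add_sq_pos hr v
    refine ((hasDerivAt_id v).div (hasDerivAt_hyperbola hr v) hs.ne').congr_deriv ?_
    have h2 : √(r ^ 2 + v ^ 2) ^ 2 = r ^ 2 + v ^ 2 := Real.sq_sqrt (by positivity)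
    rw [hyperbolaSlope, id]
    field_simp
    rw [h2]; ring
  have hlip : LipschitzWith (NNReal.mk (1 / r) (by positivity)) (hyperbolaSlope r) := by
    refine lipschitzWith_of_nnnorm_deriv_le (fun v => (hd v).differentiableAt) fun v => ?_
    rw [← NNReal.coe_le_coe, coe_nnnorm, (hd v).deriv, NNReal.coe_mk]
    have h1 := le_sqrt_sq_add_sq r v
    have hs := sqrt_sq_add_sq_pos hr v
    rw [Real.norm_of_nonneg (by positivity), div_le_div_iff₀ (by positivity) hr]
    calc r ^ 2 * r = r ^ 3 := by ring
      _ ≤ 1 * √(r ^ 2 + v ^ 2) ^ 3 := by rw [one_mul]; gcongr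
  have := hlip.dist_le_mul v w
  rw [Real.dist_eq, Real.dist_eq, NNReal.coe_mk] at this
  rwa [div_eq_inv_mul, ← one_div]

lemma hyperbola_subgradient (hr : 0 < r) (v w : ℝ) :
    √(r ^ 2 + v ^ 2) + hyperbolaSlope r v * (w - v) ≤ √(r ^ 2 + w ^ 2) := by
  have hs := sqrt_sq_add_sq_pos hr v
  have h1 : √(r ^ 2 + v ^ 2) + hyperbolaSlope r v * (w - v) =
      (r ^ 2 + v * w) / √(r ^ 2 + v ^ 2) := by
    have h2 : √(r ^ 2 + v ^ 2) ^ 2 = r ^ 2 + v ^ 2 := Real.sq_sqrt (by positivity)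
    rw [hyperbolaSlope]
    field_simp
    rw [h2]; ring
  rw [h1, div_le_iff₀ hs, ← Real.sqrt_mul (by positivity)]
  refine Real.le_sqrt_of_sq_le ?_
  nlinarith [sq_nonneg (r * (v - w))]

end Hyperbola

section HyperbolaProblem

variable (i : Fin n) (p r a : ℝ)

/-- The objective `p √(r² + (xᵢ - a)²)`, a smooth version of `p |xᵢ - a|`. -/
noncomputable def hyperbolaObjective (x : E n) : ℝ := p * √(r ^ 2 + (x i - a) ^ 2)

/-- The gradient of `hyperbolaObjective`. -/
noncomputable def hyperbolaGradient (x : E n) : E n :=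
  (p * hyperbolaSlope r (x i - a)) • EuclideanSpace.single i 1

variable {p r a}

lemma hyperbolaGradient_isSubgradient (hp : 0 < p) (hr : 0 < r) (x : E n) :
    IsSubgradient (hyperbolaObjective i p r a) x (hyperbolaGradient i p r a x) := by
  intro y
  have h := hyperbola_subgradient hr (x i - a) (y i - a)
  rw [sub_sub_sub_cancel_right] at h
  have e : ⟪hyperbolaGradient i p r a x, y - x⟫ = p * hyperbolaSlope r (x i - a) * (y i - x i) := by
    rw [hyperbolaGradient, inner_smul_left, EuclideanSpace.inner_single_left]
    simp
  rw [e, hyperbolaObjective, hyperbolaObjective]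
  nlinarith

lemma hyperbolaObjective_differentiable (hr : 0 < r) :
    Differentiable ℝ (hyperbolaObjective i p r a) := by
  intro x
  have h1 : DifferentiableAt ℝ (fun x : E n => x i - a) x := by fun_prop
  have h2 := (hasDerivAt_hyperbola hr (x i - a)).differentiableAt.comp x h1
  exact h2.const_mul p

lemma hyperbolaObjective_isSmooth {L : ℝ≥0} (hp : 0 < p) (hr : 0 < r) (hL : p / r ≤ L) :
    IsSmooth L (hyperbolaObjective i p r a) := by
  refine ⟨hyperbolaObjective_differentiable i hr, LipschitzWith.of_dist_le_mul fun x y => ?_⟩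
  rw [← (hyperbolaGradient_isSubgradient i hp hr x).eq_gradient
      (hyperbolaObjective_differentiable i hr x),
    ← (hyperbolaGradient_isSubgradient i hp hr y).eq_gradient
      (hyperbolaObjective_differentiable i hr y), dist_eq_norm, dist_eq_norm, hyperbolaGradient,
    hyperbolaGradient, ← sub_smul, norm_smul, PiLp.norm_single, norm_one, mul_one,
    ← mul_sub, norm_mul, Real.norm_of_nonneg hp.le, Real.norm_eq_abs]
  have h1 := abs_hyperbolaSlope_sub_le hr (x i - a) (y i - a)
  rw [sub_sub_sub_cancel_right] at h1
  have h2 : |x i - y i| ≤ ‖x - y‖ := by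
    have := PiLp.norm_apply_le (x - y) i
    simpa using this
  calc p * |hyperbolaSlope r (x i - a) - hyperbolaSlope r (y i - a)|
      ≤ p * (‖x - y‖ / r) := by gcongr; exact h1.trans (by gcongr)
    _ = p / r * ‖x - y‖ := by ring
    _ ≤ L * ‖x - y‖ := by gcongr

lemma hyperbolaObjective_single :
    hyperbolaObjective i p r a (EuclideanSpace.single i a) = p * |r| := by
  simp [hyperbolaObjective, Real.sqrt_sq_eq_abs]

lemma hyperbolaObjective_isMinOn (hp : 0 < p) (hr : 0 < r) :
    IsMinOn (hyperbolaObjective i p r a) univ (EuclideanSpace.single i a) := by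
  intro x _
  show hyperbolaObjective i p r a (EuclideanSpace.single i a) ≤ _
  rw [hyperbolaObjective_single, abs_of_pos hr, hyperbolaObjective]
  have := le_sqrt_sq_add_sq r (x i - a)
  gcongr

lemma hyperbolaObjective_mem_smoothClass {L : ℝ≥0} {D : ℝ} (hp : 0 < p) (hr : 0 < r)
    (hL : p / r ≤ L) (ha : |a| ≤ D) : smoothClass L D n (hyperbolaObjective i p r a) univ 0 := by
  refine ⟨⟨isClosed_univ, convex_univ, mem_univ _, convexOn_univ_of_isSubgradient fun x =>
    ⟨_, hyperbolaGradient_isSubgradient i hp hr x⟩⟩, hyperbolaObjective_isSmooth i hp hr hL,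
    EuclideanSpace.single i a, mem_univ _, hyperbolaObjective_isMinOn i hp hr, ?_⟩
  rw [zero_sub, norm_neg, PiLp.norm_single]
  exact ha

lemma hyperbolaObjective_gap (hp : 0 < p) (hr : 0 < r) (x : E n) :
    hyperbolaObjective i p r a x - sInf (hyperbolaObjective i p r a '' univ) =
      p * (√(r ^ 2 + (x i - a) ^ 2) - r) := by
  rw [IsMinOn.sInf_image_eq (mem_univ _) (hyperbolaObjective_isMinOn i hp hr),
    hyperbolaObjective_single, abs_of_pos hr, hyperbolaObjective]
  ring

lemma measurable_hyperbolaSlope_coord : Measurable fun x : E n => hyperbolaSlope r (x i - a) := by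
  unfold hyperbolaSlope
  have : Continuous fun x : E n => x i - a := by fun_prop
  fun_prop

lemma measurable_hyperbolaGradient : Measurable (hyperbolaGradient i p r a) := by
  unfold hyperbolaGradient
  exact ((measurable_hyperbolaSlope_coord i).const_mul p).smul_const _

end HyperbolaProblem

/-! ### Lower bounds for smooth objectives -/

/-- For given seeds, the span of the vectors `e₀ + q e_t`, where `e₀` is the base direction and
`e_t` is the signed unit vector selected by the `t`-th seed. -/
noncomputable def selectedSubmodule (T : ℕ) (q : ℝ) (s : ℕ → Bool × Bool) :
    Submodule ℝ (E (2 + 4 * T)) where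
  carrier := {x | (∀ t : Fin T, coord (.inr (false, t, !(s t).1)) x = 0) ∧
    q * coord (.inl false) x = ∑ t : Fin T, sign (s t).2 * coord (.inr (false, t, (s t).1)) x}
  add_mem' := by
    rintro x y ⟨hx1, hx2⟩ ⟨hy1, hy2⟩
    refine ⟨fun t => by rw [coord_add, hx1, hy1, add_zero], ?_⟩
    simp only [coord_add, mul_add, Finset.sum_add_distrib, hx2, hy2]
  zero_mem' := by simp
  smul_mem' := by
    rintro a x ⟨hx1, hx2⟩
    refine ⟨fun t => by rw [coord_smul, hx1, mul_zero], ?_⟩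
    simp only [coord_smul, mul_left_comm _ a, hx2, ← Finset.mul_sum]

lemma sq_mul_sq_le_of_mem_selectedSubmodule {q : ℝ} {s : ℕ → Bool × Bool} {x : E (2 + 4 * T)}
    (hx : x ∈ selectedSubmodule T q s) : q ^ 2 * coord (.inl false) x ^ 2 ≤
      T * ∑ t : Fin T, coord (.inr (false, t, (s t).1)) x ^ 2 := by
  rw [← mul_pow, hx.2]
  have h := sq_sum_le_card_mul_sum_sq (s := (Finset.univ : Finset (Fin T)))
    (f := fun t => sign (s t).2 * coord (.inr (false, t, (s t).1)) x)
  simp only [Finset.card_univ, Fintype.card_fin, mul_pow, pow_two (sign _), sign_mul_self,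
    one_mul] at h
  exact h

lemma unitVec_add_bitNoise_mem {q : ℝ} (s : ℕ → Bool × Bool) {t : ℕ} (ht : t < T) :
    unitVec (.inl false) + q • bitNoise T false t (s t) ∈ selectedSubmodule T q s := by
  rw [bitNoise_of_lt false ht]
  refine ⟨fun i => ?_, ?_⟩
  · simp only [coord_add, coord_smul, coord_unitVec]
    by_cases h : i = ⟨t, ht⟩
    · subst h; simp
    · simp [h]
  · simp only [coord_add, coord_smul, coord_unitVec]
    rw [Finset.sum_eq_single_of_mem (⟨t, ht⟩ : Fin T) (Finset.mem_univ _)]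
    · simp only [reduceCtorEq, if_true, if_false]
      have := sign_mul_self (s t).2
      linear_combination (-q) * this
    · intro i _ hi
      simp [hi]

/-- A subspace that is invariant under the answers of the oracle contains the output. -/
lemma Algorithm.output_mem_of_isFOI {n : ℕ} {A : Algorithm n} (hA : A.IsFOI 0)
    (O : StochasticOracle n) (c : A.Coin) (s : ℕ → O.Seed) (V : Submodule ℝ (E n)) {T : ℕ}
    (hV : ∀ t < T, ∀ x ∈ V, O.out t x (s t) ∈ V) : A.output O T (c, s) ∈ V := by
  have hpoint : ∀ (t : ℕ) (h : Fin t → E n), (∀ i, h i ∈ V) → A.point t h c ∈ V := by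
    intro t h hh
    obtain ⟨l, hl⟩ := hA t h c
    rw [hl]
    exact V.sub_mem V.zero_mem (V.sum_mem fun i _ => V.smul_mem _ (hh i))
  have hans : ∀ t ≤ T, ∀ i, A.answers O c s t i ∈ V := by
    intro t
    induction t using Nat.strong_induction_on with
    | _ t ih =>
      intro ht i
      rw [Algorithm.answers_apply]
      exact hV i (by omega) _ (hpoint _ _ (ih i i.2 (by omega)))
  exact hpoint T _ (hans T le_rfl)

lemma two_add_four_mul_le (hT : 1 ≤ T) : 2 + 4 * T ≤ 6 * T := by omega

theorem deviationLowerBound_smoothClass (L : ℝ≥0) (D : ℝ) (hL : 0 < L) (hD : 0 < D) :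
    DeviationLowerBound (smoothClass L D) IsWholeSpace
        (fun _ x₀ A => A.IsFOI x₀) (fun ε δ T => δ ^ 2 / (T * ε ^ 2)) := by
  have hL' : (0 : ℝ) < L := hL
  refine ⟨D ^ 4 / 512, L * D ^ 2 / 8, 6, by positivity, by positivity, ?_⟩
  intro ε δ T hε hεL hδ hT
  -- The slope `p` is so small that moving by a fixed fraction of `D` changes the
  -- objective by no more than a multiple of `ε`. The noise is `δ / p` times the gradient.
  set p : ℝ := 4 * ε / D with hp
  set r : ℝ := D / 2 with hr
  have hppos : 0 < p := by positivity
  have hrpos : 0 < r := by positivity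
  set i : Fin (2 + 4 * T) := coordEquiv T (.inl false) with hi
  have hρ : Measurable fun x : E (2 + 4 * T) => δ * hyperbolaSlope r (x i - D) :=
    (measurable_hyperbolaSlope_coord i).const_mul δ
  have hm : Measurable (hyperbolaGradient i p r D) := measurable_hyperbolaGradient i
  have hpr : p / r ≤ L := by
    rw [hp, hr, div_div_eq_mul_div, div_le_iff₀ hD, div_mul_eq_mul_div, div_le_iff₀ hD]
    linarith
  refine ⟨2 + 4 * T, two_add_four_mul_le hT, hyperbolaObjective i p r D, univ,
    noisyOracle _ _ (bitNoise T false) hm hρ,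
    hyperbolaObjective_mem_smoothClass i hppos hrpos hpr (abs_of_pos hD).le, rfl,
    noisyOracle_isInexact hm hρ (hyperbolaGradient_isSubgradient i hppos hrpos) (fun x => ?_)
      (norm_bitNoise_le false) (sum_bitNoise false) univ, fun A hA hfoi hacc => ?_⟩
  · rw [abs_mul, abs_of_pos hδ]
    exact mul_le_of_le_one_right hδ.le (abs_hyperbolaSlope_le hrpos _)
  have hmem : ∀ (c : A.Coin) (s : ℕ → Bool × Bool),
      A.output (noisyOracle _ _ (bitNoise T false) hm hρ) T (c, s) ∈
        selectedSubmodule T (δ / p) s := by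
    intro c s
    refine A.output_mem_of_isFOI hfoi (noisyOracle _ _ (bitNoise T false) hm hρ) c s _
      fun t ht x _ => ?_
    -- The noise is scaled like the gradient, so that every answer points in the same direction.
    have e : hyperbolaGradient i p r D x +
          (δ * hyperbolaSlope r (x i - D)) • bitNoise T false t (s t)
        = (p * hyperbolaSlope r (x i - D)) •
          (unitVec (.inl false) + (δ / p) • bitNoise T false t (s t)) := by
      rw [hyperbolaGradient, smul_add, smul_smul]
      congr 2
      field_simp
    show hyperbolaGradient i p r D x + (δ * hyperbolaSlope r (x i - D)) • bitNoise T false t (s t)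
      ∈ _
    rw [e]
    exact Submodule.smul_mem _ _ (unitVec_add_bitNoise_mem s ht)
  have h := deviation_ge_of_selected (q := δ / p) (M := p * r) hT hA (by positivity) hppos hacc
    (by rw [hp, hr]; apply le_of_eq; field_simp; norm_num)
    (fun ω => by
      rw [hyperbolaObjective_gap i hppos hrpos]
      set x := A.output (noisyOracle _ _ (bitNoise T false) hm hρ) T ω
      have h1 := (neg_le_abs _).trans (abs_le_sqrt_sq_add_sq (r := r) (x i - D))
      have h2 : coord (.inl false) x = x i := rfl
      have h3 : p * r = p * D - p * r := by rw [hr]; ring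
      have h4 := mul_le_mul_of_nonneg_left h1 hppos.le
      rw [h2]
      linarith)
    (fun c s => (hmem c s).1) (fun c s => sq_mul_sq_le_of_mem_selectedSubmodule (hmem c s))
  refine (ENNReal.ofReal_le_ofReal (le_of_eq ?_)).trans h
  rw [hp, hr]
  field_simp
  norm_num

/-- The quadratic `μ/2 ‖x - z‖²`. -/
noncomputable def quadraticObjective {n : ℕ} (μ : ℝ) (z x : E n) : ℝ := μ / 2 * ‖x - z‖ ^ 2

section Quadratic

variable {μ : ℝ} (z : E n)

lemma quadraticObjective_add (x y : E n) : quadraticObjective μ z y =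
    quadraticObjective μ z x + ⟪μ • (x - z), y - x⟫ + μ / 2 * ‖y - x‖ ^ 2 := by
  unfold quadraticObjective
  have : y - z = (x - z) + (y - x) := by abel
  rw [this, norm_add_sq_real, inner_smul_left]
  simp only [conj_trivial]
  ring

lemma quadraticObjective_isSubgradient (hμ : 0 < μ) (x : E n) :
    IsSubgradient (quadraticObjective μ z) x (μ • (x - z)) := fun y => by
  rw [quadraticObjective_add z x y]
  have : 0 ≤ μ / 2 * ‖y - x‖ ^ 2 := by positivity
  linarith

lemma quadraticObjective_strongConvexOn : StrongConvexOn univ μ (quadraticObjective μ z) := by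
  rw [strongConvexOn_iff_convex]
  refine convexOn_univ_of_isSubgradient fun x => ⟨-(μ • z), fun y => le_of_eq ?_⟩
  simp only [quadraticObjective, norm_sub_sq_real, inner_neg_left, inner_smul_left, inner_sub_right,
    conj_trivial, real_inner_comm z]
  ring

lemma quadraticObjective_mem_smoothStrongClass {L : ℝ≥0} {D : ℝ} (hμ : 0 < μ) (hμL : μ ≤ L)
    (hz : ‖z‖ ≤ D) : smoothStrongClass L μ D n (quadraticObjective μ z) univ 0 := by
  have hdiff : Differentiable ℝ (quadraticObjective μ z) := by
    unfold quadraticObjective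
    exact ((differentiable_id.sub_const z).norm_sq ℝ).const_mul _
  refine ⟨⟨isClosed_univ, convex_univ, mem_univ _, convexOn_univ_of_isSubgradient fun x =>
    ⟨_, quadraticObjective_isSubgradient z hμ x⟩⟩, ⟨hdiff, LipschitzWith.of_dist_le_mul fun x y =>
      ?_⟩,
    quadraticObjective_strongConvexOn z, z, mem_univ _, fun x _ => ?_, by simpa using hz⟩
  · rw [← (quadraticObjective_isSubgradient z hμ x).eq_gradient (hdiff x),
      ← (quadraticObjective_isSubgradient z hμ y).eq_gradient (hdiff y), dist_eq_norm, dist_eq_norm,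
      ← smul_sub, sub_sub_sub_cancel_right, norm_smul, Real.norm_of_nonneg hμ.le]
    gcongr
  · show quadraticObjective μ z z ≤ quadraticObjective μ z x
    have h : quadraticObjective μ z z = 0 := by simp [quadraticObjective]
    rw [h, quadraticObjective]
    positivity

end Quadratic

theorem deviationLowerBound_smoothStrongClass (L : ℝ≥0) (μ D : ℝ) (hμ : 0 < μ) (hμL : μ ≤ L)
    (hD : 0 < D) :
    DeviationLowerBound (smoothStrongClass L μ D) IsWholeSpace
        (fun _ x₀ A => A.IsFOI x₀) (fun ε δ T => min (δ ^ 2 / T) ε) := by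
  refine ⟨9 / (128 * μ ^ 2), 3 * μ * D ^ 2 / 16, 6, by positivity, by positivity, ?_⟩
  intro ε δ T hε hεD hδ hT
  have hT' : (0 : ℝ) < T := by exact_mod_cast hT
  set z : E (2 + 4 * T) := D • unitVec (.inl false) with hz
  have hm : Measurable fun x : E (2 + 4 * T) => μ • (x - z) := by fun_prop
  have hρ : Measurable fun _ : E (2 + 4 * T) => -δ := measurable_const
  have hzD : ‖z‖ ≤ D := by rw [hz, norm_smul, norm_unitVec, mul_one, Real.norm_of_nonneg hD.le]
  refine ⟨2 + 4 * T, two_add_four_mul_le hT, quadraticObjective μ z, univ,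
    noisyOracle _ _ (bitNoise T false) hm hρ, quadraticObjective_mem_smoothStrongClass z hμ hμL hzD,
    rfl, noisyOracle_isInexact hm hρ (quadraticObjective_isSubgradient z hμ)
      (fun x => by rw [abs_neg, abs_of_pos hδ])
      (norm_bitNoise_le false) (sum_bitNoise false) univ, fun A hA hfoi hacc => ?_⟩
  have hmem : ∀ (c : A.Coin) (s : ℕ → Bool × Bool),
      A.output (noisyOracle _ _ (bitNoise T false) hm hρ) T (c, s) ∈
        selectedSubmodule T (δ / (μ * D)) s := by
    intro c s
    refine A.output_mem_of_isFOI hfoi (noisyOracle _ _ (bitNoise T false) hm hρ) c s _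
      fun t ht x hx => ?_
    have e : μ • (x - z) + (-δ) • bitNoise T false t (s t)
        = μ • x - (μ * D) • (unitVec (.inl false) + (δ / (μ * D)) • bitNoise T false t (s t)) := by
      have h1 : μ * D * (δ / (μ * D)) = δ := by field_simp
      rw [smul_add, smul_smul, h1, hz, smul_sub, smul_smul, neg_smul]
      abel
    show μ • (x - z) + (-δ) • bitNoise T false t (s t) ∈ _
    rw [e]
    exact Submodule.sub_mem _ (Submodule.smul_mem _ _ hx)
      (Submodule.smul_mem _ _ (unitVec_add_bitNoise_mem s ht))
  -- The quadratic lies above its tangent of slope `-μ D / 2`.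
  have h := deviation_ge_of_selected (q := δ / (μ * D)) (M := 3 * μ * D ^ 2 / 8) (p := μ * D / 2)
    hT hA (by positivity) (by positivity) hacc (by linarith)
    (fun ω => by
      set x := A.output (noisyOracle _ _ (bitNoise T false) hm hρ) T ω
      have hmin : IsMinOn (quadraticObjective μ z) univ z := fun y _ => by
        show quadraticObjective μ z z ≤ quadraticObjective μ z y
        have h : quadraticObjective μ z z = 0 := by simp [quadraticObjective]
        rw [h, quadraticObjective]
        positivity
      rw [IsMinOn.sInf_image_eq (mem_univ _) hmin]
      have h1 := sum_coord_sq_le (x - z) {.inl false}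
      rw [Finset.sum_singleton, coord_sub, hz, coord_smul, coord_unitVec, if_pos rfl, mul_one, ←
        hz] at h1
      have h2 : quadraticObjective μ z z = 0 := by simp [quadraticObjective]
      rw [h2, sub_zero, quadraticObjective]
      have h3 : μ / 2 * (coord (.inl false) x - D) ^ 2 ≤ μ / 2 * ‖x - z‖ ^ 2 := by gcongr
      have h4 : 0 ≤ μ / 2 * (coord (.inl false) x - D / 2) ^ 2 := by positivity
      refine le_trans (le_of_sub_nonneg ?_) h3
      linarith)
    (fun c s => (hmem c s).1) (fun c s => sq_mul_sq_le_of_mem_selectedSubmodule (hmem c s))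
  refine (ENNReal.ofReal_le_ofReal ?_).trans h
  calc 9 / (128 * μ ^ 2) * min (δ ^ 2 / T) ε ≤ 9 / (128 * μ ^ 2) * (δ ^ 2 / T) := by
        gcongr
        exact min_le_left _ _
    _ = _ := by field_simp; norm_num

/-! ### Measurable selection of an active piece of a maximum -/

section Selection

variable {X ι : Type*} [Nonempty ι]

open Classical in
/-- An index at which the maximum of the numbers `h i x` is attained, equal to `i₀` if it is
attained there. -/
noncomputable def activeIndex (h : ι → X → ℝ) (i₀ : ι) (x : X) : ι :=
  if ∀ j, h j x ≤ h i₀ x then i₀ else Classical.epsilon fun i => ∀ j, h j x ≤ h i x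

lemma activeIndex_of_forall_le {h : ι → X → ℝ} {i₀ : ι} {x : X} (hx : ∀ j, h j x ≤ h i₀ x) :
    activeIndex h i₀ x = i₀ := if_pos hx

lemma le_activeIndex [Finite ι] (h : ι → X → ℝ) (i₀ j : ι) (x : X) : h j x ≤ h (activeIndex h i₀ x)
    x := by
  by_cases hx : ∀ j, h j x ≤ h i₀ x
  · rw [activeIndex_of_forall_le hx]
    exact hx j
  · rw [activeIndex, if_neg hx]
    have hex : ∃ i, ∀ j, h j x ≤ h i x := Finite.exists_max fun i => h i x
    exact Classical.epsilon_spec hex j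

/-- The active index depends only on the set of the maximizing indices, which takes finitely many
values. -/
lemma measurable_comp_activeIndex [Finite ι] [MeasurableSpace X] {Y : Type*} [MeasurableSpace Y]
    {h : ι → X → ℝ} (hh : ∀ i, Measurable (h i)) (i₀ : ι) (F : ι → Y) :
    Measurable fun x => F (activeIndex h i₀ x) := by
  classical
  have h1 : Measurable fun x => (fun i => ∀ j, h j x ≤ h i x : ι → Prop) :=
    measurable_pi_lambda _ fun i => measurableSet_setOfPred.1 <| by
      have : {x | ∀ j, h j x ≤ h i x} = ⋂ j, {x | h j x ≤ h i x} := by ext; simp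
      rw [this]
      exact MeasurableSet.iInter fun j => measurableSet_le (hh j) (hh i)
  have h2 : Measurable fun S : ι → Prop => F (if S i₀ then i₀ else Classical.epsilon S) :=
    Measurable.of_discrete
  exact h2.comp h1

end Selection

/-! ### Nonsmooth hard instances -/

section Piecewise

variable (p g m μ : ℝ)

/-- The slopes of the affine pieces of the nonsmooth hard instances. There is one piece for the
auxiliary direction, one constant piece, and two pieces for each iteration and each bit, which
differ in the sign of the trace. -/
noncomputable def pieceSlope : Coord T → E (2 + 4 * T)
  | .inl true => g • unitVec (.inl true)
  | .inl false => 0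
  | .inr (b, i) => g • unitVec (.inr (false, i)) + (sign b * g) • unitVec (.inr (true, i)) -
      p • unitVec (.inl false)

/-- The affine pieces of the nonsmooth hard instances. -/
noncomputable def piece (c : Coord T) (x : E (2 + 4 * T)) : ℝ :=
  (if c = .inl false then -m else 0) + ⟪pieceSlope p g c, x⟫

/-- The piece that is active at a point. Where it is active, in particular at the origin, the piece
of the auxiliary direction is preferred. -/
noncomputable def activePiece (x : E (2 + 4 * T)) : Coord T :=
  activeIndex (piece p g m) (.inl true) x

/-- The nonsmooth hard instance: a maximum of affine functions plus a multiple of `‖x‖²`. -/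
noncomputable def piecewiseObjective (x : E (2 + 4 * T)) : ℝ :=
  piece p g m (activePiece p g m x) x + μ / 2 * ‖x‖ ^ 2

/-- A subgradient of the nonsmooth hard instance. -/
noncomputable def piecewiseGradient (x : E (2 + 4 * T)) : E (2 + 4 * T) :=
  pieceSlope p g (activePiece p g m x) + μ • x

variable {p g m μ}

lemma piece_star (x : E (2 + 4 * T)) : piece p g m (.inl true) x = g * coord (.inl true) x := by
  simp [piece, pieceSlope, inner_smul_left, inner_unitVec]

lemma piece_floor (x : E (2 + 4 * T)) : piece p g m (.inl false) x = -m := by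
  simp [piece, pieceSlope]

lemma piece_inr (b : Bool) (i : Fin T × Bool) (x : E (2 + 4 * T)) : piece p g m (.inr (b, i)) x =
    g * coord (.inr (false, i)) x + sign b * g * coord (.inr (true, i)) x - p * coord (.inl false)
      x := by
  simp [piece, pieceSlope, inner_add_left, inner_sub_left, inner_smul_left, inner_unitVec]

lemma piece_le_activePiece (c : Coord T) (x : E (2 + 4 * T)) :
    piece p g m c x ≤ piece p g m (activePiece p g m x) x := le_activeIndex _ _ _ _

lemma piece_le_piecewiseObjective (hμ : 0 ≤ μ) (c : Coord T) (x : E (2 + 4 * T)) :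
    piece p g m c x ≤ piecewiseObjective p g m μ x := by
  have h1 := piece_le_activePiece (p := p) (g := g) (m := m) c x
  have h2 : 0 ≤ μ / 2 * ‖x‖ ^ 2 := by positivity
  rw [piecewiseObjective]
  linarith

lemma measurable_piecewiseGradient : Measurable (piecewiseGradient (T := T) p g m μ) := by
  refine Measurable.add ?_ (measurable_id.const_smul μ)
  refine measurable_comp_activeIndex (fun c => ?_) _ _
  unfold piece
  fun_prop

lemma piecewiseGradient_isSubgradient (hμ : 0 ≤ μ) (x : E (2 + 4 * T)) :
    IsSubgradient (piecewiseObjective p g m μ) x (piecewiseGradient p g m μ x) := by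
  intro y
  have h1 := piece_le_activePiece (p := p) (g := g) (m := m) (activePiece p g m x) y
  have h2 : piece p g m (activePiece p g m x) y = piece p g m (activePiece p g m x) x +
      ⟪pieceSlope p g (activePiece p g m x), y - x⟫ := by
    simp only [piece, inner_sub_right]; ring
  have h3 : ‖y‖ ^ 2 = ‖x‖ ^ 2 + 2 * ⟪x, y - x⟫ + ‖y - x‖ ^ 2 := by
    rw [← norm_add_sq_real, add_sub_cancel]
  have h4 : 0 ≤ μ / 2 * ‖y - x‖ ^ 2 := by positivity
  simp only [piecewiseObjective, piecewiseGradient, inner_add_left, inner_smul_left, conj_trivial,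
    h3]
  linarith

lemma norm_pieceSlope_le (hp : 0 ≤ p) (hpg : p ≤ g) (c : Coord T) : ‖pieceSlope p g c‖ ≤ 3 * g := by
  have hg := hp.trans hpg
  match c with
  | .inl true =>
    rw [pieceSlope, norm_smul, norm_unitVec, mul_one, Real.norm_of_nonneg hg]; linarith
  | .inl false => rw [pieceSlope, norm_zero]; positivity
  | .inr (b, i) =>
    rw [pieceSlope]
    refine (norm_sub_le _ _).trans ?_
    have h := norm_add_le (g • unitVec (T := T) (.inr (false, i)))
      ((sign b * g) • unitVec (.inr (true, i)))
    simp only [norm_smul, norm_unitVec, mul_one, norm_mul, Real.norm_eq_abs, abs_sign,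
      abs_of_nonneg hg, one_mul] at h
    rw [norm_smul, norm_unitVec, mul_one, Real.norm_of_nonneg hp]
    linarith

lemma norm_piecewiseGradient_le (hp : 0 ≤ p) (hpg : p ≤ g) (hμ : 0 ≤ μ) (x : E (2 + 4 * T)) :
    ‖piecewiseGradient p g m μ x‖ ≤ 3 * g + μ * ‖x‖ := by
  refine (norm_add_le _ _).trans ?_
  rw [norm_smul, Real.norm_of_nonneg hμ]
  gcongr
  exact norm_pieceSlope_le hp hpg _

/-- A common minimizer of all the affine pieces. -/
noncomputable def piecewiseMinimizer (T : ℕ) (p g m : ℝ) : E (2 + 4 * T) :=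
  (m / p) • unitVec (.inl false) - (m / g) • unitVec (.inl true)

lemma norm_piecewiseMinimizer_le (hp : 0 < p) (hg : 0 < g) (hm : 0 < m) :
    ‖piecewiseMinimizer T p g m‖ ≤ m / p + m / g := by
  refine (norm_sub_le _ _).trans ?_
  rw [norm_smul, norm_smul, norm_unitVec, norm_unitVec, mul_one, mul_one,
    Real.norm_of_nonneg (by positivity), Real.norm_of_nonneg (by positivity)]

lemma norm_sq_piecewiseMinimizer :
    ‖piecewiseMinimizer T p g m‖ ^ 2 = (m / p) ^ 2 + (m / g) ^ 2 := by
  rw [piecewiseMinimizer, norm_sub_sq_real, inner_smul_left, inner_smul_right, inner_unitVec,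
    coord_unitVec, norm_smul, norm_smul, norm_unitVec, norm_unitVec, mul_one, mul_one,
    Real.norm_eq_abs, Real.norm_eq_abs, sq_abs, sq_abs]
  simp

lemma piece_piecewiseMinimizer (hp : 0 < p) (hg : 0 < g) (c : Coord T) :
    piece p g m c (piecewiseMinimizer T p g m) = -m := by
  match c with
  | .inl true => rw [piece_star]; simp [piecewiseMinimizer, coord_unitVec]; field_simp
  | .inl false => exact piece_floor _
  | .inr (b, i) => rw [piece_inr]; simp [piecewiseMinimizer, coord_unitVec]; field_simp

lemma neg_le_piecewiseObjective (hμ : 0 ≤ μ) (x : E (2 + 4 * T)) :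
    -m ≤ piecewiseObjective p g m μ x := by
  rw [← piece_floor (p := p) (g := g) (m := m) x]
  exact piece_le_piecewiseObjective hμ _ x

/-- For given seeds, the values of an algorithm before the call number `k` of the noisy oracle: a
trace can be nonzero only if it was created by the noise of an earlier call, and a value only if its
trace has been visible to the oracle. -/
noncomputable def revealedSubmodule (T : ℕ) (p g : ℝ) (s : ℕ → Bool × Bool) (k : ℕ) :
    Submodule ℝ (E (2 + 4 * T)) where
  carrier := {x |
    (∀ (i : Fin T) b, ((i : ℕ) + 1 < k → b ≠ (s i).1) → coord (.inr (false, i, b)) x = 0) ∧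
    (∀ (i : Fin T) b, ((i : ℕ) < k → b ≠ (s i).1) → coord (.inr (true, i, b)) x = 0) ∧
    g * coord (.inl false) x = -(p * ∑ i : Fin T, coord (.inr (false, i, (s i).1)) x)}
  add_mem' := by
    rintro x y ⟨hx1, hx2, hx3⟩ ⟨hy1, hy2, hy3⟩
    refine ⟨fun i b h => by rw [coord_add, hx1 i b h, hy1 i b h, add_zero],
      fun i b h => by rw [coord_add, hx2 i b h, hy2 i b h, add_zero], ?_⟩
    simp only [coord_add, mul_add, Finset.sum_add_distrib, hx3, hy3]
    ring
  zero_mem' := by simp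
  smul_mem' := by
    rintro a x ⟨hx1, hx2, hx3⟩
    refine ⟨fun i b h => by rw [coord_smul, hx1 i b h, mul_zero],
      fun i b h => by rw [coord_smul, hx2 i b h, mul_zero], ?_⟩
    simp only [coord_smul, mul_left_comm _ a, hx3, ← Finset.mul_sum]
    ring

lemma revealedSubmodule_mono (s : ℕ → Bool × Bool) {k l : ℕ} (hkl : k ≤ l) :
    revealedSubmodule T p g s k ≤ revealedSubmodule T p g s l := fun _ hx =>
  ⟨fun i b h => hx.1 i b fun h' => h (h'.trans_le hkl),
    fun i b h => hx.2.1 i b fun h' => h (h'.trans_le hkl), hx.2.2⟩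

lemma sq_mul_sq_le_of_mem_revealedSubmodule (hp : 0 < p) {s : ℕ → Bool × Bool} {k : ℕ}
    {x : E (2 + 4 * T)} (hx : x ∈ revealedSubmodule T p g s k) :
    (g / p) ^ 2 * coord (.inl false) x ^ 2 ≤
      T * ∑ t : Fin T, coord (.inr (false, t, (s t).1)) x ^ 2 := by
  have h := sq_sum_le_card_mul_sum_sq (s := (Finset.univ : Finset (Fin T)))
    (f := fun t => coord (.inr (false, t, (s t).1)) x)
  rw [Finset.card_univ, Fintype.card_fin] at h
  refine le_trans (le_of_eq ?_) h
  have h1 : ∑ t : Fin T, coord (.inr (false, t, (s t).1)) x = -(g * coord (.inl false) x / p) := by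
    rw [hx.2.2]; field_simp
  rw [h1]
  ring

/-- The piece active at `x` does not depend on bits that are unknown before the call number `t`,
because a nonzero latest trace makes a known piece strictly larger than all unknown ones. -/
lemma activePiece_eq (hg : 0 < g) (hm : 0 < m) {s : ℕ → Bool × Bool} {t : ℕ} (ht : t ≤ T)
    {x : E (2 + 4 * T)} (hx : x ∈ revealedSubmodule T p g s t) (h0 : t = 0 → x = 0)
    (hlatest : ∀ i : Fin T, (i : ℕ) + 1 = t → coord (.inr (true, i, (s i).1)) x ≠ 0) :
    (∃ b, activePiece p g m x = .inl b) ∨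
      ∃ b, ∃ i : Fin T, (i : ℕ) < t ∧ activePiece p g m x = .inr (b, i, (s i).1) := by
  rcases Nat.eq_zero_or_pos t with rfl | htpos
  · refine Or.inl ⟨true, ?_⟩
    rw [activePiece, activeIndex_of_forall_le]
    intro j
    rw [h0 rfl]
    simp only [piece, inner_zero_right]
    split_ifs <;> simp_all [hm.le]
  match hk : activePiece p g m x with
  | .inl b => exact Or.inl ⟨b, rfl⟩
  | .inr (b, i, b') =>
    have hknown : (i : ℕ) < t ∧ b' = (s i).1 := by
      by_contra hcon
      have hcon' : (i : ℕ) < t → b' ≠ (s i).1 := fun h h' => hcon ⟨h, h'⟩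
      set j : Fin T := ⟨t - 1, by omega⟩ with hj
      have hjt : (j : ℕ) + 1 = t := by rw [hj]; show t - 1 + 1 = t; omega
      have h1 := piece_le_activePiece (p := p) (g := g) (m := m) (.inr (true, j, (s j).1)) x
      have h2 := piece_le_activePiece (p := p) (g := g) (m := m) (.inr (false, j, (s j).1)) x
      rw [hk, piece_inr, piece_inr, hx.1 i b' fun h => hcon' (by omega), hx.2.1 i b' hcon',
        hx.1 j _ fun h => absurd h (by omega)] at h1 h2
      simp only [sign, if_true, Bool.false_eq_true, if_false] at h1 h2
      have h4 : g * coord (.inr (true, j, (s j).1)) x = 0 := by linarith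
      exact hlatest j hjt ((mul_eq_zero.1 h4).resolve_left hg.ne')
    exact Or.inr ⟨b, i, hknown.1, by rw [hknown.2]⟩

lemma pieceSlope_inl_mem (s : ℕ → Bool × Bool) (k : ℕ) (b : Bool) :
    pieceSlope p g (.inl b) ∈ revealedSubmodule T p g s k := by
  cases b
  · exact Submodule.zero_mem _
  · refine ⟨fun i b _ => ?_, fun i b _ => ?_, ?_⟩ <;> simp [pieceSlope, coord_unitVec]

lemma pieceSlope_inr_mem (s : ℕ → Bool × Bool) {t : ℕ} (b : Bool) {i : Fin T} (hi : (i : ℕ) < t) :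
    pieceSlope p g (.inr (b, i, (s i).1)) ∈ revealedSubmodule T p g s (t + 1) := by
  refine ⟨fun j c h => ?_, fun j c h => ?_, ?_⟩
  · have : ¬(j = i ∧ c = (s i).1) := by
      rintro ⟨rfl, rfl⟩; exact h (by omega) rfl
    simp [pieceSlope, coord_unitVec, this]
  · have : ¬(j = i ∧ c = (s i).1) := by
      rintro ⟨rfl, rfl⟩; exact h (by omega) rfl
    simp [pieceSlope, coord_unitVec, this]
  · simp only [pieceSlope, coord_add, coord_sub, coord_smul, coord_unitVec]
    rw [Finset.sum_eq_single_of_mem i (Finset.mem_univ _)]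
    · simp; ring
    · intro j _ hj
      simp [hj]

/-- The mean answer at a point reveals nothing about the noise of the current call. -/
lemma piecewiseGradient_mem (hg : 0 < g) (hm : 0 < m) {s : ℕ → Bool × Bool} {t : ℕ} (ht : t ≤ T)
    {x : E (2 + 4 * T)} (hx : x ∈ revealedSubmodule T p g s t) (h0 : t = 0 → x = 0)
    (hlatest : ∀ i : Fin T, (i : ℕ) + 1 = t → coord (.inr (true, i, (s i).1)) x ≠ 0) :
    piecewiseGradient p g m μ x ∈ revealedSubmodule T p g s (t + 1) ∧
      ∀ j : Fin T, (j : ℕ) = t → ∀ b,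
        coord (.inr (true, j, b)) (piecewiseGradient p g m μ x) = 0 := by
  have hx' : μ • x ∈ revealedSubmodule T p g s (t + 1) :=
    Submodule.smul_mem _ _ (revealedSubmodule_mono s (by omega) hx)
  have hx0 : ∀ j : Fin T, (j : ℕ) = t → ∀ b, coord (.inr (true, j, b)) (μ • x) = 0 := by
    intro j hj b
    rw [coord_smul, hx.2.1 j b fun h => absurd h (by omega), mul_zero]
  rw [piecewiseGradient]
  rcases activePiece_eq hg hm ht hx h0 hlatest with ⟨b, hb⟩ | ⟨b, i, hi, hb⟩
  · rw [hb]
    refine ⟨Submodule.add_mem _ (pieceSlope_inl_mem s _ b) hx', fun j hj b' => ?_⟩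
    rw [coord_add, hx0 j hj, add_zero]
    cases b <;> simp [pieceSlope, coord_unitVec]
  · rw [hb]
    refine ⟨Submodule.add_mem _ (pieceSlope_inr_mem s b hi) hx', fun j hj b' => ?_⟩
    have hji : j ≠ i := by rintro rfl; omega
    rw [coord_add, hx0 j hj, add_zero]
    simp [pieceSlope, coord_unitVec, hji]

lemma bitNoise_mem_revealedSubmodule (s : ℕ → Bool × Bool) {t : ℕ} (ht : t < T) :
    bitNoise T true t (s t) ∈ revealedSubmodule T p g s (t + 1) := by
  rw [bitNoise_of_lt true ht]
  refine Submodule.smul_mem _ _ ⟨fun i b _ => ?_, fun i b h => ?_, ?_⟩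
  · simp [coord_unitVec]
  · have : ¬(i = ⟨t, ht⟩ ∧ b = (s t).1) := by
      rintro ⟨rfl, rfl⟩; exact h (by simp) rfl
    simp [coord_unitVec, this]
  · simp [coord_unitVec]

/-- Everything that a first-order iterative algorithm with nonzero latest coefficients computes
stays in the revealed subspace. -/
lemma output_mem_revealedSubmodule (hg : 0 < g) (hm : 0 < m) {δ : ℝ} (hδ : 0 < δ)
    {A : Algorithm (2 + 4 * T)} (hA : A.IsFOILatest 0)
    {hgrad : Measurable (piecewiseGradient (T := T) p g m μ)}
    {hρ : Measurable fun _ : E (2 + 4 * T) => δ} (c : A.Coin) (s : ℕ → Bool × Bool) :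
    A.output (noisyOracle _ _ (bitNoise T true) hgrad hρ) T (c, s) ∈
      revealedSubmodule T p g s T := by
  set O := noisyOracle _ _ (bitNoise T true) hgrad hρ with hO
  -- A sequence of answers is admissible if each of them reveals exactly the trace of its own call.
  have hpoint : ∀ t ≤ T, ∀ h : Fin t → E (2 + 4 * T),
      (∀ i : Fin t, h i ∈ revealedSubmodule T p g s (i + 1) ∧
        ∀ j : Fin T, (j : ℕ) = i → coord (.inr (true, j, (s j).1)) (h i) ≠ 0) →
      A.point t h c ∈ revealedSubmodule T p g s t ∧ (t = 0 → A.point t h c = 0) ∧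
        ∀ i : Fin T, (i : ℕ) + 1 = t → coord (.inr (true, i, (s i).1)) (A.point t h c) ≠ 0 := by
    intro t ht h hh
    obtain ⟨l, hl, hx⟩ := hA t h c
    rw [hx, zero_sub]
    refine ⟨Submodule.neg_mem _ (Submodule.sum_mem _ fun i _ => Submodule.smul_mem _ _
      (revealedSubmodule_mono s i.2 (hh i).1)), ?_, ?_⟩
    · rintro rfl; simp
    · intro i hi
      set i' : Fin t := ⟨i, by omega⟩ with hi'
      have h1 : ∑ j, l j • h j = l i' • h i' + ∑ j ∈ Finset.univ.erase i', l j • h j :=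
        (Finset.add_sum_erase _ _ (Finset.mem_univ _)).symm
      have h2 : coord (.inr (true, i, (s i).1)) (∑ j ∈ Finset.univ.erase i', l j • h j) = 0 := by
        rw [coord_sum]
        refine Finset.sum_eq_zero fun j hj => ?_
        have hj' : (j : ℕ) ≠ i := fun h => (Finset.mem_erase.1 hj).1 (Fin.ext h)
        rw [coord_smul, (hh j).1.2.1 i _ fun h => absurd h (by omega), mul_zero]
      rw [← neg_one_smul ℝ, coord_smul, h1, coord_add, h2, add_zero, coord_smul]
      exact mul_ne_zero (by norm_num) (mul_ne_zero (hl i' hi) ((hh i').2 i rfl))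
  have hans : ∀ t ≤ T, ∀ i : Fin t, A.answers O c s t i ∈ revealedSubmodule T p g s (i + 1) ∧
      ∀ j : Fin T, (j : ℕ) = i → coord (.inr (true, j, (s j).1)) (A.answers O c s t i) ≠ 0 := by
    intro t
    induction t using Nat.strong_induction_on with
    | _ t ih =>
      intro ht i
      have hiT : (i : ℕ) < T := by omega
      have hanswer : A.answers O c s t i = O.out i (A.point i (A.answers O c s i) c) (s i) :=
        Algorithm.answers_apply ..
      rw [hanswer]
      obtain ⟨h1, h2, h3⟩ := hpoint i hiT.le _ (ih i i.2 hiT.le)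
      set x := A.point i (A.answers O c s i) c with hx
      show piecewiseGradient p g m μ x + δ • bitNoise T true i (s i) ∈ _ ∧ ∀ j : Fin T, (j : ℕ) = i
        →
        coord (.inr (true, j, (s j).1)) (piecewiseGradient p g m μ x + δ • bitNoise T true i (s i))
          ≠ 0
      obtain ⟨h4, h5⟩ := piecewiseGradient_mem (μ := μ) hg hm hiT.le h1 h2 h3
      refine ⟨Submodule.add_mem _ h4 (Submodule.smul_mem _ _ (bitNoise_mem_revealedSubmodule s
        hiT)), ?_⟩
      intro j hj
      have hji : j = ⟨i, hiT⟩ := Fin.ext hj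
      rw [coord_add, h5 j hj, zero_add, coord_smul, bitNoise_of_lt true hiT, coord_smul,
        coord_unitVec,
        hji, if_pos rfl, mul_one]
      refine mul_ne_zero hδ.ne' fun h => ?_
      have := abs_sign (s i).2
      rw [h, abs_zero] at this
      exact zero_ne_one this
  exact (hpoint T le_rfl _ (hans T le_rfl)).1

lemma deviation_ge_of_piecewiseObjective (hp : 0 < p) (hg : 0 < g) (hm : 0 < m) (hμ : 0 ≤ μ) {δ : ℝ}
    (hδ : 0 < δ) (hT : 1 ≤ T) {A : Algorithm (2 + 4 * T)} (hmeas : A.IsMeasurable)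
    (hA : A.IsFOILatest 0) {C : Set (E (2 + 4 * T))}
    {hgrad : Measurable (piecewiseGradient (T := T) p g m μ)}
    {hρ : Measurable fun _ : E (2 + 4 * T) => δ} {ε M : ℝ} (hM : 0 < M)
    (hacc : A.IsAccurate (noisyOracle _ _ (bitNoise T true) hgrad hρ) (piecewiseObjective p g m μ)
      C T ε)
    (hε : ε ≤ M / 2) (hinf : sInf (piecewiseObjective p g m μ '' C) ≤ -M) :
    ENNReal.ofReal ((g / p) ^ 2 * M ^ 2 / (8 * T * p ^ 2)) ≤
      A.deviation (noisyOracle _ _ (bitNoise T true) hgrad hρ) T := by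
  have hmem := output_mem_revealedSubmodule hg hm hδ hA (hgrad := hgrad) (hρ := hρ)
  refine deviation_ge_of_selected hT hmeas hM hp hacc hε ?_ ?_ fun c s =>
    sq_mul_sq_le_of_mem_revealedSubmodule hp (hmem c s)
  · rintro ⟨c, s⟩
    have h1 := hmem c s
    set x := A.output (noisyOracle _ _ (bitNoise T true) hgrad hρ) T (c, s)
    set i : Fin T := ⟨0, hT⟩
    have h2 := piece_le_piecewiseObjective (p := p) (g := g) (m := m) hμ (.inr (true, i, !(s i).1))
      x
    rw [piece_inr, h1.1 i _ (by simp), h1.2.1 i _ (by simp)] at h2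
    linarith
  · intro c s t
    exact (hmem c s).1 t _ (by simp)

end Piecewise

/-! ### Lower bounds for nonsmooth objectives -/

theorem deviationLowerBound_lipschitzClass (G : ℝ≥0) (D : ℝ) (hG : 0 < G) (hD : 0 < D) :
    DeviationLowerBound (lipschitzClass G D) IsWholeSpace
        (fun _ x₀ A => A.IsFOILatest x₀) (fun ε _ T => 1 / (T * ε ^ 2)) := by
  have hG' : (0 : ℝ) < G := hG
  set g : ℝ := G / 3 with hgdef
  have hg : 0 < g := by positivity
  refine ⟨g ^ 2 * D ^ 4 / 512, g * D / 4, 6, by positivity, by positivity, ?_⟩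
  intro ε δ T hε hεg hδ hT
  have hT' : (0 : ℝ) < T := by exact_mod_cast hT
  set p : ℝ := 4 * ε / D with hpdef
  set m : ℝ := 2 * ε with hmdef
  have hp : 0 < p := by positivity
  have hm : 0 < m := by positivity
  have hpg : p ≤ g := by rw [hpdef, div_le_iff₀ hD]; linarith
  have hmin : IsMinOn (piecewiseObjective p g m 0) univ (piecewiseMinimizer T p g m) := by
    intro x _
    show piecewiseObjective p g m 0 (piecewiseMinimizer T p g m) ≤ piecewiseObjective p g m 0 x
    refine le_trans (le_of_eq ?_) (neg_le_piecewiseObjective le_rfl x)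
    rw [piecewiseObjective, piece_piecewiseMinimizer hp hg]; simp
  have hval : piecewiseObjective p g m 0 (piecewiseMinimizer T p g m) = -m := by
    rw [piecewiseObjective, piece_piecewiseMinimizer hp hg]; simp
  have hsub := piecewiseGradient_isSubgradient (T := T) (p := p) (g := g) (m := m) (μ := 0) le_rfl
  have hgrad : Measurable (piecewiseGradient (T := T) p g m 0) := measurable_piecewiseGradient
  have hρ : Measurable fun _ : E (2 + 4 * T) => δ := measurable_const
  refine ⟨2 + 4 * T, two_add_four_mul_le hT, piecewiseObjective p g m 0, univ,
    noisyOracle _ _ (bitNoise T true) hgrad hρ, ⟨⟨isClosed_univ, convex_univ, mem_univ _,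
      convexOn_univ_of_isSubgradient fun x => ⟨_, hsub x⟩⟩,
      ⟨univ, isOpen_univ, subset_rfl, lipschitzOnWith_of_isSubgradient fun x _ => ⟨_, hsub x, ?_⟩⟩,
      piecewiseMinimizer T p g m, mem_univ _, hmin, ?_⟩, rfl,
    noisyOracle_isInexact hgrad hρ hsub (fun x => (abs_of_pos hδ).le)
      (norm_bitNoise_le true) (sum_bitNoise true) univ, fun A hA hfoi hacc => ?_⟩
  · have := norm_piecewiseGradient_le (m := m) (μ := 0) hp.le hpg le_rfl x
    linarith
  · rw [zero_sub, norm_neg]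
    refine (norm_piecewiseMinimizer_le hp hg hm).trans ?_
    have h1 : m / p = D / 2 := by rw [hmdef, hpdef]; field_simp; norm_num
    have h2 : m / g ≤ D / 2 := by rw [div_le_iff₀ hg]; linarith
    linarith
  · have h := deviation_ge_of_piecewiseObjective hp hg hm le_rfl hδ hT hA hfoi hm hacc (by linarith)
      (by rw [IsMinOn.sInf_image_eq (mem_univ _) hmin, hval])
    refine (ENNReal.ofReal_le_ofReal (le_of_eq ?_)).trans h
    rw [hpdef, hmdef]
    field_simp
    norm_num

theorem deviationLowerBound_lipschitzStrongClass (G : ℝ≥0) (μ : ℝ) (hG : 0 < G) (hμ : 0 < μ) :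
    DeviationLowerBound (lipschitzStrongClass G μ) IsBallAround
        (fun _ x₀ A => A.IsFOILatest x₀) (fun ε _ T => min (1 / T) ε) := by
  have hG' : (0 : ℝ) < G := hG
  set g : ℝ := G / 6 with hgdef
  have hg : 0 < g := by positivity
  set m : ℝ := g ^ 2 / (2 * μ) with hmdef
  have hm : 0 < m := by positivity
  refine ⟨g ^ 2 / (128 * μ ^ 2), m / 4, 6, by positivity, by positivity, ?_⟩
  intro ε δ T hε hεg hδ hT
  have hT' : (0 : ℝ) < T := by exact_mod_cast hT
  have hsub := piecewiseGradient_isSubgradient (T := T) (p := g) (g := g) (m := m) hμ.le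
  have hgrad : Measurable (piecewiseGradient (T := T) g g m μ) := measurable_piecewiseGradient
  have hρ : Measurable fun _ : E (2 + 4 * T) => δ := measurable_const
  have hmg : m / g = g / (2 * μ) := by rw [hmdef]; field_simp
  -- The radius of the domain: the gradients are bounded by `3 g + 2 μ R = G` on the ball of radius
  -- `2 R`, and the minimizer of the affine pieces has norm at most `g / μ ≤ R`.
  set R : ℝ := 3 * g / (2 * μ) with hR
  have hRpos : 0 < R := by positivity
  set w := piecewiseMinimizer T g g m with hw
  have hwR : w ∈ Metric.closedBall (0 : E (2 + 4 * T)) R := by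
    rw [mem_closedBall_zero_iff]
    refine (norm_piecewiseMinimizer_le hg hg hm).trans ?_
    rw [hmg, hR, ← add_div]
    gcongr
    linarith
  have hval : piecewiseObjective g g m μ w = -(m / 2) := by
    rw [piecewiseObjective, piece_piecewiseMinimizer hg hg, norm_sq_piecewiseMinimizer, hmg, hmdef]
    field_simp
    norm_num
  refine ⟨2 + 4 * T, two_add_four_mul_le hT, piecewiseObjective g g m μ, Metric.closedBall 0 R,
    noisyOracle _ _ (bitNoise T true) hgrad hρ, ⟨⟨Metric.isClosed_closedBall, convex_closedBall _ _,
      Metric.mem_closedBall_self hRpos.le, convexOn_univ_of_isSubgradient fun x => ⟨_, hsub x⟩⟩,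
      ⟨Metric.ball 0 (2 * R), Metric.isOpen_ball, Metric.closedBall_subset_ball (by linarith),
        lipschitzOnWith_of_isSubgradient fun x hx => ⟨_, hsub x, ?_⟩⟩, ?_⟩, ⟨R, hRpos, rfl⟩,
    noisyOracle_isInexact hgrad hρ hsub (fun x => (abs_of_pos hδ).le)
      (norm_bitNoise_le true) (sum_bitNoise true) univ, fun A hA hfoi hacc => ?_⟩
  · rw [mem_ball_zero_iff] at hx
    have h1 := norm_piecewiseGradient_le (m := m) hg.le le_rfl hμ.le x
    have h2 : μ * ‖x‖ ≤ μ * (2 * R) := by gcongr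
    have h3 : μ * (2 * R) = 3 * g := by rw [hR]; field_simp
    linarith
  · rw [strongConvexOn_iff_convex]
    refine (convexOn_univ_of_isSubgradient (f := fun x => piecewiseObjective g g m μ x - μ / 2 *
      ‖x‖ ^ 2)
      fun x => ⟨piecewiseGradient g g m 0 x, ?_⟩).subset (subset_univ _) (convex_closedBall _ _)
    have h := piecewiseGradient_isSubgradient (p := g) (g := g) (m := m) (μ := 0) le_rfl x
    have e : (fun x : E (2 + 4 * T) => piecewiseObjective g g m μ x - μ / 2 * ‖x‖ ^ 2) =
        piecewiseObjective g g m 0 := by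
      funext y
      simp [piecewiseObjective]
    rwa [e]
  · have hinf : sInf (piecewiseObjective g g m μ '' Metric.closedBall (0 : E (2 + 4 * T)) R) ≤
    -(m / 2) := by
      rw [← hval]
      refine csInf_le ⟨-m, ?_⟩ (mem_image_of_mem _ hwR)
      rintro _ ⟨x, -, rfl⟩
      exact neg_le_piecewiseObjective hμ.le x
    have h := deviation_ge_of_piecewiseObjective hg hg hm hμ.le hδ hT hA hfoi (half_pos hm) hacc
      (by linarith) hinf
    refine (ENNReal.ofReal_le_ofReal ?_).trans h
    calc g ^ 2 / (128 * μ ^ 2) * min (1 / (T : ℝ)) ε ≤ g ^ 2 / (128 * μ ^ 2) * (1 / T) := by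
          gcongr
          exact min_le_left _ _
      _ = _ := by rw [hmdef]; field_simp; norm_num

/-! ### Change of measure -/

section ChangeOfMeasure

variable {Ω : Type*} [MeasurableSpace Ω] {P : Measure Ω} [IsProbabilityMeasure P] {R X : Ω → ℝ}

lemma lintegral_likelihood_sub_one_sq_le {a : ℝ} (ha : 0 ≤ a) (hR : Measurable R)
    (hR0 : ∀ ω, 0 ≤ R ω) (hone : ∫⁻ ω, ENNReal.ofReal (R ω) ∂P = 1)
    (hsq : ∫⁻ ω, ENNReal.ofReal (R ω ^ 2) ∂P ≤ ENNReal.ofReal (1 + a)) :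
    ∫⁻ ω, ENNReal.ofReal ((R ω - 1) ^ 2) ∂P ≤ ENNReal.ofReal a := by
  have h1 : ∫⁻ ω, (ENNReal.ofReal ((R ω - 1) ^ 2) + 2 * ENNReal.ofReal (R ω)) ∂P =
      ∫⁻ ω, (ENNReal.ofReal (R ω ^ 2) + 1) ∂P := by
    refine lintegral_congr fun ω => ?_
    rw [← ENNReal.ofReal_one, ← ENNReal.ofReal_ofNat 2, ← ENNReal.ofReal_mul (by norm_num),
      ← ENNReal.ofReal_add (by positivity) (by have := hR0 ω; positivity),
      ← ENNReal.ofReal_add (by positivity) (by positivity)]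
    congr 1
    ring
  rw [lintegral_add_left (by fun_prop), lintegral_const_mul _ (by fun_prop), hone, mul_one,
    lintegral_add_left (by fun_prop), lintegral_const, measure_univ, mul_one] at h1
  have h2 : ∫⁻ ω, ENNReal.ofReal ((R ω - 1) ^ 2) ∂P + 2 ≤ ENNReal.ofReal a + 2 := by
    calc _ = ∫⁻ ω, ENNReal.ofReal (R ω ^ 2) ∂P + 1 := h1
      _ ≤ ENNReal.ofReal (1 + a) + 1 := by gcongr
      _ = _ := by
        rw [ENNReal.ofReal_add zero_le_one ha, ENNReal.ofReal_one, add_comm 1, add_assoc]; norm_num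
  exact (ENNReal.add_le_add_iff_right (by simp)).1 h2

omit [IsProbabilityMeasure P] in
lemma enorm_integral_mul_sq_le {f g : Ω → ℝ} (hf : Measurable f) (hg : Measurable g) :
    ENNReal.ofReal ((∫ ω, f ω * g ω ∂P) ^ 2) ≤
      (∫⁻ ω, ENNReal.ofReal (f ω ^ 2) ∂P) * ∫⁻ ω, ENNReal.ofReal (g ω ^ 2) ∂P := by
  have hsq : ∀ u : ℝ, ENNReal.ofReal (u ^ 2) = ‖u‖ₑ ^ (2 : ℝ) := fun u => by
    rw [ENNReal.rpow_two, ← sq_abs, ENNReal.ofReal_pow (abs_nonneg _), Real.enorm_eq_ofReal_abs]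
  simp only [hsq]
  have h := ENNReal.lintegral_mul_le_Lp_mul_Lq P Real.HolderConjugate.two_two
    hf.enorm.aemeasurable hg.enorm.aemeasurable
  have h2 : ‖∫ ω, f ω * g ω ∂P‖ₑ ≤ ∫⁻ ω, ((fun ω => ‖f ω‖ₑ) * fun ω => ‖g ω‖ₑ) ω ∂P := by
    refine (enorm_integral_le_lintegral_enorm _).trans (le_of_eq ?_)
    simp only [Pi.mul_apply, enorm_mul]
  calc _ ≤ ((∫⁻ ω, ‖f ω‖ₑ ^ (2 : ℝ) ∂P) ^ (1 / 2 : ℝ) * (∫⁻ ω, ‖g ω‖ₑ ^ (2 : ℝ) ∂P) ^ (1 / 2 : ℝ))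
    ^ (2 : ℝ) :=
        ENNReal.rpow_le_rpow (h2.trans h) (by norm_num)
    _ = _ := by
        rw [ENNReal.mul_rpow_of_nonneg _ _ (by norm_num), ← ENNReal.rpow_mul, ← ENNReal.rpow_mul]
        norm_num

/-- The Chapman–Robbins inequality, with the deviation in place of the variance: a change of measure
with `χ²`-divergence at most `a` moves the mean of a random variable by at most the square root of
`a` times its deviation. -/
lemma sq_integral_sub_le_deviation {a : ℝ} (ha : 0 < a) {P' : Measure Ω} [IsProbabilityMeasure P']
    (hR : Measurable R) (hR0 : ∀ ω, 0 ≤ R ω)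
    (hP' : P' = P.withDensity fun ω => ENNReal.ofReal (R ω))
    (hsq : ∫⁻ ω, ENNReal.ofReal (R ω ^ 2) ∂P ≤ ENNReal.ofReal (1 + a))
    (hX : Measurable X) (hi : Integrable X P) (hi' : Integrable X P') :
    ENNReal.ofReal ((∫ ω, X ω ∂P' - ∫ ω, X ω ∂P) ^ 2) ≤
      ENNReal.ofReal a * ∫⁻ ω, ∫⁻ ω', ENNReal.ofReal ((X ω - X ω') ^ 2) ∂P ∂P := by
  have hfin : ∀ᵐ ω ∂P, ENNReal.ofReal (R ω) < ∞ := Filter.Eventually.of_forall fun _ =>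
    ENNReal.ofReal_lt_top
  have hone : ∫⁻ ω, ENNReal.ofReal (R ω) ∂P = 1 := by
    have := measure_univ (μ := P')
    rwa [hP', withDensity_apply _ MeasurableSet.univ, Measure.restrict_univ] at this
  have hRi : Integrable R P := by
    refine ⟨hR.aestronglyMeasurable, ?_⟩
    rw [hasFiniteIntegral_iff_ofReal (Filter.Eventually.of_forall hR0), hone]
    exact ENNReal.one_lt_top
  have hRone : ∫ ω, R ω ∂P = 1 := by
    rw [integral_eq_lintegral_of_nonneg_ae (Filter.Eventually.of_forall hR0)
      hR.aestronglyMeasurable, hone,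
      ENNReal.toReal_one]
  have hXR : Integrable (fun ω => R ω * X ω) P := by
    rw [hP', integrable_withDensity_iff_integrable_smul' hR.ennreal_ofReal hfin] at hi'
    simpa only [ENNReal.toReal_ofReal (hR0 _), smul_eq_mul] using hi'
  have hmean : ∫ ω, X ω ∂P' = ∫ ω, R ω * X ω ∂P := by
    rw [hP', integral_withDensity_eq_integral_toReal_smul hR.ennreal_ofReal hfin]
    simp only [ENNReal.toReal_ofReal (hR0 _), smul_eq_mul]
  -- The difference of the means does not change when `X` is shifted by a constant `y`, and an
  -- independent copy of `X` may play the role of `y`.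
  have key : ∀ y : ℝ, ENNReal.ofReal ((∫ ω, X ω ∂P' - ∫ ω, X ω ∂P) ^ 2) ≤
      ENNReal.ofReal a * ∫⁻ ω, ENNReal.ofReal ((y - X ω) ^ 2) ∂P := by
    intro y
    have e : ∫ ω, X ω ∂P' - ∫ ω, X ω ∂P = ∫ ω, (R ω - 1) * (X ω - y) ∂P := by
      have e1 : ∀ ω, (R ω - 1) * (X ω - y) = R ω * X ω - X ω - y * (R ω - 1) := fun ω => by ring
      have i1 : Integrable (fun ω => R ω - 1) P := hRi.sub (integrable_const 1)
      have i2 : Integrable (fun ω => R ω * X ω - X ω) P := hXR.sub hi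
      simp only [e1]
      rw [integral_sub i2 (i1.const_mul y), integral_sub hXR hi, integral_const_mul,
        integral_sub hRi (integrable_const 1), hRone, hmean]
      simp
    rw [e]
    refine (enorm_integral_mul_sq_le (hR.sub_const 1) (hX.sub_const y)).trans ?_
    have h := lintegral_likelihood_sub_one_sq_le ha.le hR hR0 hone hsq
    simp only [sub_sq_comm y]
    gcongr
  calc _ = ∫⁻ _, ENNReal.ofReal ((∫ ω, X ω ∂P' - ∫ ω, X ω ∂P) ^ 2) ∂P := by simp
    _ ≤ ∫⁻ ω, ENNReal.ofReal a * ∫⁻ ω', ENNReal.ofReal ((X ω - X ω') ^ 2) ∂P ∂P :=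
        lintegral_mono fun ω => key (X ω)
    _ = _ := lintegral_const_mul' _ _ ENNReal.ofReal_ne_top

end ChangeOfMeasure

/-! ### The law of the transcript of a run -/

namespace Algorithm

variable (A : Algorithm n) (O : StochasticOracle n)

/-- The law of the coin and the first `t` answers of the oracle. -/
noncomputable def transcriptLaw (t : ℕ) : Measure (A.Coin × (Fin t → E n)) :=
  (A.runLaw O).map fun ω => (ω.1, A.answers O ω.1 ω.2 t)

variable {A}

lemma measurable_transcript (hA : A.IsMeasurable) (t : ℕ) :
    Measurable fun ω : A.Coin × (ℕ → O.Seed) => (ω.1, A.answers O ω.1 ω.2 t) :=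
  measurable_fst.prodMk (measurable_answers O hA t)

lemma isProbabilityMeasure_transcriptLaw (hA : A.IsMeasurable) (t : ℕ) :
    IsProbabilityMeasure (A.transcriptLaw O t) :=
  Measure.isProbabilityMeasure_map (measurable_transcript O hA t).aemeasurable

lemma measurable_transcript_snoc {t : ℕ} :
    Measurable fun p : (A.Coin × (Fin t → E n)) × E n =>
      ((p.1.1, Fin.snoc (α := fun _ => E n) p.1.2 p.2) : A.Coin × (Fin (t + 1) → E n)) :=
  (measurable_fst.comp measurable_fst).prodMk
    (measurable_snoc.comp ((measurable_snd.comp measurable_fst).prodMk measurable_snd))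

lemma measurable_point (hA : A.IsMeasurable) (t : ℕ) :
    Measurable fun w : A.Coin × (Fin t → E n) => A.point t w.2 w.1 :=
  (hA t).comp measurable_swap

/-- The law of the next answer, conditioned on the transcript, is that of the oracle at the next
query point. -/
lemma lintegral_transcriptLaw_succ (hA : A.IsMeasurable) (t : ℕ)
    {F : A.Coin × (Fin (t + 1) → E n) → ℝ≥0∞} (hF : Measurable F) :
    ∫⁻ w, F w ∂A.transcriptLaw O (t + 1) =
      ∫⁻ w, ∫⁻ u, F (w.1, Fin.snoc (α := fun _ => E n) w.2 (O.out t (A.point t w.2 w.1) u)) ∂O.law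
        ∂A.transcriptLaw O t := by
  have hG : Measurable fun p : (A.Coin × (Fin t → E n)) × O.Seed =>
      F (p.1.1, Fin.snoc (α := fun _ => E n) p.1.2 (O.out t (A.point t p.1.2 p.1.1) p.2)) :=
    hF.comp (measurable_transcript_snoc.comp (measurable_fst.prodMk ((O.measurable_out t).comp
      (((measurable_point hA t).comp measurable_fst).prodMk measurable_snd))))
  have hF' : Measurable fun ω : A.Coin × (ℕ → O.Seed) => F (ω.1, A.answers O ω.1 ω.2 (t + 1)) :=
    hF.comp (measurable_transcript O hA (t + 1))
  rw [transcriptLaw, transcriptLaw, lintegral_map hF (measurable_transcript O hA (t + 1)),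
    lintegral_map hG.lintegral_prod_right' (measurable_transcript O hA t), lintegral_runLaw _ _ hF']
  refine Eq.trans ?_ (lintegral_runLaw A O
    (hG.lintegral_prod_right'.comp (measurable_transcript O hA t))).symm
  refine lintegral_congr fun c => ?_
  refine (lintegral_infinitePi_update O.law t (hF'.comp measurable_prodMk_left)).trans ?_
  refine lintegral_congr fun s => lintegral_congr fun u => ?_
  simp only [Function.comp_apply, answers_succ, answers_update, Function.update_self]

end Algorithm

/-! ### Oracles with two possible answers -/

section SignOracle

variable {δ : ℝ} {σ σ' : E 1 → ℝ}

/-- The oracle in dimension one that answers `δ` with probability `(1 + σ x) / 2`, and `-δ`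
otherwise. -/
noncomputable def signOracle (δ : ℝ) (σ : E 1 → ℝ) (hσ : Measurable σ) : StochasticOracle 1 where
  Seed := unitInterval
  law := volume
  out := fun _ x u => if (u : ℝ) ≤ (1 + σ x) / 2 then EuclideanSpace.single 0 δ
    else EuclideanSpace.single 0 (-δ)
  measurable_out := fun _ => Measurable.ite (measurableSet_le
    (measurable_subtype_coe.comp measurable_snd) (((hσ.comp measurable_fst).const_add 1).div_const
      2))
    measurable_const measurable_const

lemma volume_unitInterval_le {q : ℝ} (h0 : 0 ≤ q) (h1 : q ≤ 1) :
    volume {u : unitInterval | (u : ℝ) ≤ q} = ENNReal.ofReal q :=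
  unitInterval.volume_Iic ⟨q, h0, h1⟩

lemma volume_unitInterval_not_le {q : ℝ} (h0 : 0 ≤ q) (h1 : q ≤ 1) :
    volume {u : unitInterval | (u : ℝ) ≤ q}ᶜ = ENNReal.ofReal (1 - q) := by
  rw [prob_compl_eq_one_sub (measurableSet_le measurable_subtype_coe measurable_const),
    volume_unitInterval_le h0 h1, ENNReal.ofReal_sub _ h0, ENNReal.ofReal_one]

lemma lintegral_signOracle (hσ : Measurable σ) {x : E 1} (hx : |σ x| ≤ 1) (t : ℕ) (F : E 1 → ℝ≥0∞) :
    ∫⁻ u, F ((signOracle δ σ hσ).out t x u) ∂(signOracle δ σ hσ).law =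
      ENNReal.ofReal ((1 + σ x) / 2) * F (EuclideanSpace.single 0 δ) +
        ENNReal.ofReal ((1 - σ x) / 2) * F (EuclideanSpace.single 0 (-δ)) := by
  obtain ⟨h1, h2⟩ := abs_le.1 hx
  show ∫⁻ u : unitInterval, F (if (u : ℝ) ≤ (1 + σ x) / 2 then EuclideanSpace.single 0 δ
    else EuclideanSpace.single 0 (-δ)) = _
  have hS : MeasurableSet {u : unitInterval | (u : ℝ) ≤ (1 + σ x) / 2} :=
    measurableSet_le measurable_subtype_coe measurable_const
  rw [← lintegral_add_compl _ hS,
    setLIntegral_congr_fun (g := fun _ => F (EuclideanSpace.single 0 δ)) hS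
      (fun u hu => congrArg F (if_pos (show (u : ℝ) ≤ (1 + σ x) / 2 from hu))),
    setLIntegral_congr_fun (g := fun _ => F (EuclideanSpace.single 0 (-δ))) hS.compl
      (fun u hu => congrArg F (if_neg (show ¬(u : ℝ) ≤ (1 + σ x) / 2 from hu))),
    setLIntegral_const, setLIntegral_const, volume_unitInterval_le (by linarith) (by linarith),
    volume_unitInterval_not_le (by linarith) (by linarith), mul_comm, mul_comm (F _)]
  congr 3
  ring

lemma integral_signOracle (hσ : Measurable σ) {x : E 1} (hx : |σ x| ≤ 1) (t : ℕ) :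
    Integrable ((signOracle δ σ hσ).out t x) (signOracle δ σ hσ).law ∧
    ∫ u, (signOracle δ σ hσ).out t x u ∂(signOracle δ σ hσ).law =
      EuclideanSpace.single 0 (δ * σ x) := by
  obtain ⟨h1, h2⟩ := abs_le.1 hx
  have hS : MeasurableSet {u : unitInterval | (u : ℝ) ≤ (1 + σ x) / 2} :=
    measurableSet_le measurable_subtype_coe measurable_const
  have hout : (fun u : unitInterval => if (u : ℝ) ≤ (1 + σ x) / 2 then
    (EuclideanSpace.single 0 δ : E 1)
      else EuclideanSpace.single 0 (-δ)) = fun u => EuclideanSpace.single 0 (-δ) +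
      {u : unitInterval | (u : ℝ) ≤ (1 + σ x) / 2}.indicator
        (fun _ => (EuclideanSpace.single 0 (2 * δ) : E 1)) u := by
    funext u
    have h : (EuclideanSpace.single 0 δ : E 1) = EuclideanSpace.single 0 (-δ) +
        EuclideanSpace.single 0 (2 * δ) := by
      ext i
      obtain rfl := Subsingleton.elim i 0
      simp
      ring
    by_cases hu : (u : ℝ) ≤ (1 + σ x) / 2
    · rw [indicator_of_mem (by exact hu), ← h, if_pos hu]
    · rw [indicator_of_notMem (by exact hu), add_zero, if_neg hu]
  have hi := (integrable_const (μ := (volume : Measure unitInterval))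
    (EuclideanSpace.single 0 (2 * δ) : E 1)).indicator hS
  show Integrable (fun u : unitInterval => if (u : ℝ) ≤ (1 + σ x) / 2 then
    (EuclideanSpace.single 0 δ : E 1) else EuclideanSpace.single 0 (-δ)) ∧
    ∫ u : unitInterval, (if (u : ℝ) ≤ (1 + σ x) / 2 then (EuclideanSpace.single 0 δ : E 1)
      else EuclideanSpace.single 0 (-δ)) = _
  rw [hout]
  refine ⟨(integrable_const _).add hi, (integral_add (integrable_const _) hi).trans ?_⟩
  rw [integral_const, integral_indicator_const _ hS, measureReal_def, measureReal_def,
    volume_unitInterval_le (by linarith) (by linarith), ENNReal.toReal_ofReal (by linarith),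
      measure_univ,
    ENNReal.toReal_one, one_smul]
  ext i
  obtain rfl := Subsingleton.elim i 0
  simp
  ring

lemma signOracle_isInexact (hσ : Measurable σ) (hσ1 : ∀ x, |σ x| ≤ 1) {f : E 1 → ℝ}
    (hsub : ∀ x, IsSubgradient f x (EuclideanSpace.single 0 (δ * σ x))) (S : Set (E 1)) :
    (signOracle δ σ hσ).IsInexact f S δ := by
  intro t x _
  obtain ⟨h1, h2⟩ := integral_signOracle (δ := δ) hσ (hσ1 x) t
  refine ⟨h1, by rw [h2]; exact hsub x, ?_⟩
  have hsingle : ∀ a b : ℝ, (EuclideanSpace.single 0 a : E 1) - EuclideanSpace.single 0 b =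
      EuclideanSpace.single 0 (a - b) := fun a b => by
    ext i
    obtain rfl := Subsingleton.elim i 0
    simp
  rw [h2, lintegral_signOracle (δ := δ) hσ (hσ1 x) t
    (fun g => ‖g - EuclideanSpace.single 0 (δ * σ x)‖ₑ ^ 2), hsingle, hsingle, enorm_sq_eq_ofReal,
      enorm_sq_eq_ofReal, PiLp.norm_single,
    PiLp.norm_single, Real.norm_eq_abs, Real.norm_eq_abs, sq_abs, sq_abs]
  obtain ⟨h3, h4⟩ := abs_le.1 (hσ1 x)
  have h5 : 0 ≤ (1 + σ x) / 2 := by linarith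
  have h6 : 0 ≤ (1 - σ x) / 2 := by linarith
  rw [← ENNReal.ofReal_mul h5, ← ENNReal.ofReal_mul h6, ← ENNReal.ofReal_add (by positivity)
    (by positivity)]
  refine ENNReal.ofReal_le_ofReal ?_
  nlinarith [sq_nonneg (δ * σ x)]

/-- The likelihood ratio of one answer `g`, for biases `s'` and `s`. The quotient `g 0 / δ` is the
sign of the answer; the formula is not meant for vectors `g` other than the two answers. -/
noncomputable def signRatio (δ s s' : ℝ) (g : E 1) : ℝ := (1 + g 0 / δ * s') / (1 + g 0 / δ * s)

/-- The likelihood ratio of a transcript for two oracles with biases `σ'` and `σ` in `(-1, 1)`. The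
absolute value changes nothing on transcripts that can occur, and makes the ratio nonnegative on all
others. -/
noncomputable def likelihood (A : Algorithm 1) (δ : ℝ) (σ σ' : E 1 → ℝ) :
    (t : ℕ) → A.Coin × (Fin t → E 1) → ℝ
  | 0, _ => 1
  | t + 1, w => likelihood A δ σ σ' t (w.1, Fin.init w.2) *
      |signRatio δ (σ (A.point t (Fin.init w.2) w.1)) (σ' (A.point t (Fin.init w.2) w.1))
        (w.2 (Fin.last t))|

variable {A : Algorithm 1}

lemma likelihood_snoc (t : ℕ) (c : A.Coin) (h : Fin t → E 1) (g : E 1) :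
    likelihood A δ σ σ' (t + 1) (c, Fin.snoc (α := fun _ => E 1) h g) =
      likelihood A δ σ σ' t (c, h) * |signRatio δ (σ (A.point t h c)) (σ' (A.point t h c)) g| := by
  rw [likelihood]
  simp only [Fin.init_snoc, Fin.snoc_last]

lemma likelihood_nonneg (t : ℕ) (w : A.Coin × (Fin t → E 1)) : 0 ≤ likelihood A δ σ σ' t w := by
  induction t with
  | zero => exact zero_le_one
  | succ t ih => exact mul_nonneg (ih _) (abs_nonneg _)

lemma measurable_likelihood (hA : A.IsMeasurable) (hσ : Measurable σ) (hσ' : Measurable σ')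
    (t : ℕ) : Measurable (likelihood A δ σ σ' t) := by
  induction t with
  | zero => exact measurable_const
  | succ t ih =>
    have h1 : Measurable fun w : A.Coin × (Fin (t + 1) → E 1) =>
        ((w.1, Fin.init w.2) : A.Coin × (Fin t → E 1)) :=
      measurable_fst.prodMk (measurable_pi_lambda _ fun i =>
        (measurable_pi_apply i.castSucc).comp measurable_snd)
    have h2 : Measurable fun w : A.Coin × (Fin (t + 1) → E 1) => A.point t (Fin.init w.2) w.1 :=
      (Algorithm.measurable_point hA t).comp h1
    have h3 : Measurable fun w : A.Coin × (Fin (t + 1) → E 1) => w.2 (Fin.last t) 0 / δ := by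
      have : Measurable fun w : A.Coin × (Fin (t + 1) → E 1) => w.2 (Fin.last t) :=
        (measurable_pi_apply _).comp measurable_snd
      fun_prop
    refine (ih.comp h1).mul (Measurable.abs ?_)
    unfold signRatio
    exact ((h3.mul (hσ'.comp h2)).const_add 1).div ((h3.mul (hσ.comp h2)).const_add 1)

lemma signRatio_single (hδ : δ ≠ 0) (s s' : ℝ) :
    signRatio δ s s' (EuclideanSpace.single 0 δ) = (1 + s') / (1 + s) := by
  simp [signRatio, hδ]

lemma signRatio_single_neg (hδ : δ ≠ 0) (s s' : ℝ) :
    signRatio δ s s' (EuclideanSpace.single 0 (-δ)) = (1 - s') / (1 - s) := by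
  simp [signRatio, hδ, sub_eq_add_neg]

lemma transcriptLaw_signOracle_eq_withDensity (hA : A.IsMeasurable) (hδ : δ ≠ 0) (hσ : Measurable σ)
    (hσ' : Measurable σ') (h1 : ∀ x, |σ x| ≤ 1 / 2) (h1' : ∀ x, |σ' x| ≤ 1 / 2) (t : ℕ) :
    A.transcriptLaw (signOracle δ σ' hσ') t = (A.transcriptLaw (signOracle δ σ hσ) t).withDensity
      fun w => ENNReal.ofReal (likelihood A δ σ σ' t w) := by
  induction t with
  | zero =>
    simp only [likelihood, ENNReal.ofReal_one, Algorithm.transcriptLaw]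
    exact (withDensity_one (μ := _)).symm
  | succ t ih =>
    have hm := fun t => (measurable_likelihood (δ := δ) hA hσ hσ' t).ennreal_ofReal
    refine Measure.ext_of_lintegral _ fun F hF => ?_
    have hside : ∀ (O : StochasticOracle 1) (g : E 1), Measurable fun w : A.Coin × (Fin t → E 1) =>
        F (w.1, Fin.snoc (α := fun _ => E 1) w.2 g) := fun O g =>
      hF.comp (Algorithm.measurable_transcript_snoc.comp (measurable_id.prodMk measurable_const))
    rw [lintegral_withDensity_eq_lintegral_mul _ (hm _) hF,
      Algorithm.lintegral_transcriptLaw_succ _ hA t hF,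
      Algorithm.lintegral_transcriptLaw_succ _ hA t ((hm _).mul hF)]
    have hle : ∀ x, |σ x| ≤ 1 := fun x => (h1 x).trans (by norm_num)
    have hle' : ∀ x, |σ' x| ≤ 1 := fun x => (h1' x).trans (by norm_num)
    have e' := fun w : A.Coin × (Fin t → E 1) => lintegral_signOracle (δ := δ) hσ'
      (hle' (A.point t w.2 w.1)) t fun g => F (w.1, Fin.snoc (α := fun _ => E 1) w.2 g)
    have e := fun w : A.Coin × (Fin t → E 1) => lintegral_signOracle (δ := δ) hσ
      (hle (A.point t w.2 w.1)) t fun g => ((fun w => ENNReal.ofReal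
        (likelihood A δ σ σ' (t + 1) w)) * F)
        (w.1, Fin.snoc (α := fun _ => E 1) w.2 g)
    simp only [e', e]
    have hp := Algorithm.measurable_point hA t
    rw [ih, lintegral_withDensity_eq_lintegral_mul _ (hm _)]
    · refine lintegral_congr fun w => ?_
      simp only [Pi.mul_apply, likelihood_snoc, signRatio_single hδ, signRatio_single_neg hδ]
      set x := A.point t w.2 w.1
      obtain ⟨h2, h3⟩ := abs_le.1 (h1 x)
      obtain ⟨h2', h3'⟩ := abs_le.1 (h1' x)
      have hl := likelihood_nonneg (δ := δ) (σ := σ) (σ' := σ') t w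
      rw [abs_of_nonneg (div_nonneg (by linarith) (by linarith)),
        abs_of_nonneg (div_nonneg (by linarith) (by linarith)), mul_add, ← mul_assoc, ← mul_assoc,
        ← mul_assoc, ← mul_assoc, ← ENNReal.ofReal_mul hl, ← ENNReal.ofReal_mul hl,
        ← ENNReal.ofReal_mul (by linarith), ← ENNReal.ofReal_mul (by linarith)]
      have h4 : 1 + σ x ≠ 0 := by linarith
      have h5 : 1 - σ x ≠ 0 := by linarith
      congr 3 <;> field_simp
    · exact ((((hσ'.comp hp).const_add 1).div_const 2).ennreal_ofReal.mul
      (hside (signOracle δ σ hσ) _)).add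
        ((((hσ'.comp hp).const_sub 1).div_const 2).ennreal_ofReal.mul (hside (signOracle δ σ hσ) _))

/-- The `χ²`-divergence of the transcripts: each answer contributes a factor `1 + 2 d²`. -/
lemma lintegral_likelihood_sq_le (hA : A.IsMeasurable) (hδ : δ ≠ 0) (hσ : Measurable σ)
    (hσ' : Measurable σ') (h1 : ∀ x, |σ x| ≤ 1 / 2) {d : ℝ} (hd : ∀ x, |σ' x - σ x| ≤ d) (t : ℕ) :
    ∫⁻ w, ENNReal.ofReal (likelihood A δ σ σ' t w ^ 2) ∂A.transcriptLaw (signOracle δ σ hσ) t ≤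
      ENNReal.ofReal ((1 + 2 * d ^ 2) ^ t) := by
  induction t with
  | zero =>
    have := Algorithm.isProbabilityMeasure_transcriptLaw (signOracle δ σ hσ) hA 0
    simp [likelihood]
  | succ t ih =>
    have hm := ((measurable_likelihood (δ := δ) hA hσ hσ' (t + 1)).pow_const 2).ennreal_ofReal
    have hle : ∀ x, |σ x| ≤ 1 := fun x => (h1 x).trans (by norm_num)
    have e := fun w : A.Coin × (Fin t → E 1) => lintegral_signOracle (δ := δ) hσ
      (hle (A.point t w.2 w.1)) t fun g => ENNReal.ofReal (likelihood A δ σ σ' (t + 1)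
        (w.1, Fin.snoc (α := fun _ => E 1) w.2 g) ^ 2)
    rw [Algorithm.lintegral_transcriptLaw_succ _ hA t hm]
    simp only [e]
    calc _ ≤ ∫⁻ w, ENNReal.ofReal (1 + 2 * d ^ 2) * ENNReal.ofReal (likelihood A δ σ σ' t w ^ 2)
          ∂A.transcriptLaw (signOracle δ σ hσ) t := by
          refine lintegral_mono fun w => ?_
          simp only [likelihood_snoc, signRatio_single hδ, signRatio_single_neg hδ, mul_pow, sq_abs]
          set x := A.point t w.2 w.1
          obtain ⟨h2, h3⟩ := abs_le.1 (h1 x)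
          have h4 : 0 < 1 + σ x := by linarith
          have h5 : 0 < 1 - σ x := by linarith
          rw [← ENNReal.ofReal_mul (by linarith), ← ENNReal.ofReal_mul (by linarith),
            ← ENNReal.ofReal_mul (by positivity), ← ENNReal.ofReal_add (by positivity)
              (by positivity)]
          refine ENNReal.ofReal_le_ofReal ?_
          have e2 : (1 + σ x) / 2 * (likelihood A δ σ σ' t w ^ 2 * ((1 + σ' x) / (1 + σ x)) ^ 2) +
              (1 - σ x) / 2 * (likelihood A δ σ σ' t w ^ 2 * ((1 - σ' x) / (1 - σ x)) ^ 2) =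
              (1 + (σ' x - σ x) ^ 2 / ((1 + σ x) * (1 - σ x))) * likelihood A δ σ σ' t w ^ 2 := by
            field_simp
            ring
          rw [e2]
          have h6 : (σ' x - σ x) ^ 2 ≤ d ^ 2 := by
            rw [← sq_abs]; have := hd x; gcongr
          have h7 : (σ' x - σ x) ^ 2 / ((1 + σ x) * (1 - σ x)) ≤ 2 * d ^ 2 := by
            rw [div_le_iff₀ (by positivity)]
            have h8 : 1 / 2 ≤ (1 + σ x) * (1 - σ x) := by nlinarith
            nlinarith [sq_nonneg d]
          gcongr
      _ ≤ ENNReal.ofReal (1 + 2 * d ^ 2) * ENNReal.ofReal ((1 + 2 * d ^ 2) ^ t) := by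
          rw [lintegral_const_mul' _ _ ENNReal.ofReal_ne_top]
          gcongr
      _ = _ := by rw [← ENNReal.ofReal_mul (by positivity), ← pow_succ']

end SignOracle

/-! ### The information-theoretic lower bound -/

/-- The expected gap of a hyperbola objective controls the distance of the mean to the minimizer, up
to the radius `r` of the smoothing. -/
lemma integral_sub_le_of_hyperbola_gap {Ω : Type*} [MeasurableSpace Ω] {P : Measure Ω}
    [IsProbabilityMeasure P] {X : Ω → ℝ} (hX : Measurable X) {p r a ε : ℝ} (hp : 0 < p) (hr : 0 < r)
    (hε : 0 < ε)
    (h : ∫⁻ ω, ENNReal.ofReal (p * (√(r ^ 2 + (X ω - a) ^ 2) - r)) ∂P ≤ ENNReal.ofReal ε) :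
    Integrable X P ∧ |∫ ω, X ω ∂P - a| ≤ r + ε / p := by
  have h1 : ∫⁻ ω, ‖X ω - a‖ₑ ∂P ≤ ENNReal.ofReal (r + ε / p) := by
    calc ∫⁻ ω, ‖X ω - a‖ₑ ∂P
        ≤ ∫⁻ ω, (ENNReal.ofReal r +
            ENNReal.ofReal p⁻¹ * ENNReal.ofReal (p * (√(r ^ 2 + (X ω - a) ^ 2) - r))) ∂P := by
          refine lintegral_mono fun ω => ?_
          have h2 := abs_le_sqrt_sq_add_sq (r := r) (X ω - a)
          have h3 := le_sqrt_sq_add_sq r (X ω - a)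
          rw [Real.enorm_eq_ofReal_abs, ← ENNReal.ofReal_mul (by positivity),
            inv_mul_cancel_left₀ hp.ne', ← ENNReal.ofReal_add hr.le (by linarith)]
          exact ENNReal.ofReal_le_ofReal (by linarith)
      _ ≤ ENNReal.ofReal r + ENNReal.ofReal p⁻¹ * ENNReal.ofReal ε := by
          rw [lintegral_add_left measurable_const, lintegral_const, measure_univ, mul_one,
            lintegral_const_mul' _ _ ENNReal.ofReal_ne_top]
          gcongr
      _ = _ := by
          rw [← ENNReal.ofReal_mul (by positivity), ← ENNReal.ofReal_add hr.le (by positivity)]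
          congr 1
          ring
  have hi : Integrable (fun ω => X ω - a) P :=
    ⟨(hX.sub_const a).aestronglyMeasurable, h1.trans_lt ENNReal.ofReal_lt_top⟩
  have hiX : Integrable X P :=
    (hi.add (integrable_const a)).congr (Filter.Eventually.of_forall fun _ => sub_add_cancel _ _)
  refine ⟨hiX, ?_⟩
  have e : ∫ ω, X ω ∂P - a = ∫ ω, (X ω - a) ∂P := by
    rw [integral_sub hiX (integrable_const a)]; simp
  have h4 := (enorm_integral_le_lintegral_enorm (μ := P) fun ω => X ω - a).trans h1
  rw [e, ← ENNReal.ofReal_le_ofReal_iff (by positivity), ← Real.enorm_eq_ofReal_abs]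
  exact h4

lemma mean_output_close {A : Algorithm 1} (hA : A.IsMeasurable) (O : StochasticOracle 1)
    {p r a ε : ℝ} (hp : 0 < p) (hr : 0 < r) (hε : 0 < ε) {T : ℕ}
    (hacc : A.IsAccurate O (hyperbolaObjective 0 p r a) univ T ε) :
    Integrable (fun w => A.point T w.2 w.1 0) (A.transcriptLaw O T) ∧
      |∫ w, A.point T w.2 w.1 0 ∂A.transcriptLaw O T - a| ≤ r + ε / p := by
  have hX : Measurable fun w : A.Coin × (Fin T → E 1) => A.point T w.2 w.1 0 := by
    have := Algorithm.measurable_point hA T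
    fun_prop
  have hF : Measurable fun w : A.Coin × (Fin T → E 1) =>
      ENNReal.ofReal (p * (√(r ^ 2 + (A.point T w.2 w.1 0 - a) ^ 2) - r)) :=
    (((((hX.sub_const a).pow_const 2).const_add _).sqrt.sub_const r).const_mul p).ennreal_ofReal
  have := Algorithm.isProbabilityMeasure_transcriptLaw O hA T
  refine integral_sub_le_of_hyperbola_gap hX hp hr hε ?_
  have h := hacc.2
  simp only [hyperbolaObjective_gap 0 hp hr] at h
  rw [Algorithm.transcriptLaw, lintegral_map hF (Algorithm.measurable_transcript O hA T)]
  exact h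

lemma one_add_pow_le {y : ℝ} (hy : 0 ≤ y) {T : ℕ} (h : T * y ≤ 1) :
    (1 + y) ^ T ≤ 1 + 2 * (T * y) := by
  have h0 : 0 ≤ T * y := by positivity
  calc (1 + y) ^ T ≤ Real.exp y ^ T := by
        gcongr
        linarith [Real.add_one_le_exp y]
    _ = Real.exp (T * y) := by rw [← Real.exp_nat_mul]
    _ ≤ 1 + T * y + (T * y) ^ 2 := by
        have := Real.abs_exp_sub_one_sub_id_le (x := T * y) (by rwa [abs_of_nonneg h0])
        linarith [le_abs_self (Real.exp (T * y) - 1 - T * y)]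
    _ ≤ _ := by nlinarith

/-- Moving the bias of the oracle by at most `d` moves the mean output by at most `2 d √T` times the
square root of the deviation. -/
lemma sq_mean_output_sub_le {A : Algorithm 1} (hA : A.IsMeasurable) {δ d : ℝ} (hδ : δ ≠ 0)
    {σ σ' : E 1 → ℝ} (hσ : Measurable σ) (hσ' : Measurable σ') (h1 : ∀ x, |σ x| ≤ 1 / 2)
    (h1' : ∀ x, |σ' x| ≤ 1 / 2) (hd0 : 0 < d) (hd : ∀ x, |σ' x - σ x| ≤ d) {T : ℕ} (hT : 1 ≤ T)
    (hTd : T * (2 * d ^ 2) ≤ 1)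
    (hi : Integrable (fun w => A.point T w.2 w.1 0) (A.transcriptLaw (signOracle δ σ hσ) T))
    (hi' : Integrable (fun w => A.point T w.2 w.1 0) (A.transcriptLaw (signOracle δ σ' hσ') T)) :
    ENNReal.ofReal ((∫ w, A.point T w.2 w.1 0 ∂A.transcriptLaw (signOracle δ σ' hσ') T -
      ∫ w, A.point T w.2 w.1 0 ∂A.transcriptLaw (signOracle δ σ hσ) T) ^ 2) ≤
      ENNReal.ofReal (4 * T * d ^ 2) * A.deviation (signOracle δ σ hσ) T := by
  have hT' : (0 : ℝ) < T := by exact_mod_cast hT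
  have hX : Measurable fun w : A.Coin × (Fin T → E 1) => A.point T w.2 w.1 0 := by
    have := Algorithm.measurable_point hA T
    fun_prop
  have := Algorithm.isProbabilityMeasure_transcriptLaw (signOracle δ σ hσ) hA T
  have := Algorithm.isProbabilityMeasure_transcriptLaw (signOracle δ σ' hσ') hA T
  have hsq := (lintegral_likelihood_sq_le hA hδ hσ hσ' h1 hd T).trans
    (ENNReal.ofReal_le_ofReal (one_add_pow_le (by positivity) hTd))
  refine (sq_integral_sub_le_deviation (a := 2 * (T * (2 * d ^ 2))) (by positivity)
    (measurable_likelihood hA hσ hσ' T) (likelihood_nonneg T)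
    (transcriptLaw_signOracle_eq_withDensity hA hδ hσ hσ' h1 h1' T) hsq hX hi hi').trans
    (le_of_eq ?_)
  have hm := Algorithm.measurable_transcript (signOracle δ σ hσ) hA T
  have hJ : Measurable fun p : (A.Coin × (Fin T → E 1)) × (A.Coin × (Fin T → E 1)) =>
      ENNReal.ofReal ((A.point T p.1.2 p.1.1 0 - A.point T p.2.2 p.2.1 0) ^ 2) :=
    (((hX.comp measurable_fst).sub (hX.comp measurable_snd)).pow_const 2).ennreal_ofReal
  rw [Algorithm.deviation_eq _ hA, Algorithm.transcriptLaw, lintegral_map hJ.lintegral_prod_right'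
    hm]
  congr 2
  · ring
  · funext ω
    refine (lintegral_map (hJ.comp measurable_prodMk_left) hm).trans ?_
    refine lintegral_congr fun ω' => ?_
    rw [enorm_sq_eq_ofReal, EuclideanSpace.real_norm_sq_eq]
    simp [Algorithm.output]

/-- On a fine grid of parameters, some step moves the mean output by at least the average step. -/
lemma exists_step_of_abs_sub_le {mean : ℝ → ℝ} {D : ℝ} {N : ℕ} (hN : 0 < N)
    (h : ∀ θ ∈ Icc (-1 : ℝ) 1, |mean θ - θ * D| ≤ D / 2) :
    ∃ θ θ' : ℝ, θ ∈ Icc (-1 : ℝ) 1 ∧ θ' ∈ Icc (-1 : ℝ) 1 ∧ θ' = θ + 2 / N ∧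
      D / N ≤ mean θ' - mean θ := by
  have hN0 : (0 : ℝ) < N := by exact_mod_cast hN
  have hmem : ∀ k ≤ N, (-1 + 2 * k / N : ℝ) ∈ Icc (-1 : ℝ) 1 := by
    intro k hk
    have hk' : (k : ℝ) ≤ N := by exact_mod_cast hk
    have h1 : 2 * (k : ℝ) / N ≤ 2 := by rw [div_le_iff₀ hN0]; linarith
    have h2 : 0 ≤ 2 * (k : ℝ) / N := by positivity
    exact ⟨by linarith, by linarith⟩
  obtain ⟨k, hk, hstep⟩ : ∃ k ∈ Finset.range N,
      D / N ≤ mean (-1 + 2 * (k + 1 : ℕ) / N) - mean (-1 + 2 * k / N) := by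
    refine Finset.exists_le_of_sum_le ⟨0, Finset.mem_range.2 hN⟩ ?_
    rw [Finset.sum_range_sub (fun k : ℕ => mean (-1 + 2 * k / N)), Finset.sum_const,
      Finset.card_range, nsmul_eq_mul, mul_div_cancel₀ _ hN0.ne']
    have h1 := (abs_le.1 (h _ (hmem N le_rfl))).1
    have h2 := (abs_le.1 (h _ (hmem 0 (Nat.zero_le _)))).2
    have e1 : (-1 + 2 * N / N : ℝ) = 1 := by field_simp; norm_num
    have e2 : (-1 + 2 * (0 : ℕ) / N : ℝ) = -1 := by simp
    rw [e1] at h1 ⊢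
    rw [e2] at h2 ⊢
    linarith
  rw [Finset.mem_range] at hk
  exact ⟨_, _, hmem k hk.le, hmem (k + 1) hk, by push_cast; ring, hstep⟩

theorem informationLowerBound_smoothClass (L : ℝ≥0) (D : ℝ) (hL : 0 < L) (hD : 0 < D) :
    InformationLowerBound (smoothClass L D) (fun ε δ T => δ ^ 2 / (T * ε ^ 2)) := by
  have hL' : (0 : ℝ) < L := hL
  refine ⟨D ^ 4 / 4096, L * D ^ 2 / 16, 1 / (4 * L), by positivity, by positivity, by positivity,
    ?_⟩
  intro ε δ T hε hεL hδ hεδ hT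
  have hT' : (0 : ℝ) < T := by exact_mod_cast hT
  set p : ℝ := 4 * ε / D with hpdef
  set r : ℝ := D / 4 with hrdef
  have hp : 0 < p := by positivity
  have hr : 0 < r := by positivity
  have hpr : p / r ≤ L := by
    rw [hpdef, hrdef, div_div_eq_mul_div, div_le_iff₀ hD, div_mul_eq_mul_div, div_le_iff₀ hD]
    linarith
  have hpδ : p / δ ≤ 1 / 2 := by
    have h1 : ε ^ 2 ≤ (D * δ / 8) ^ 2 := by
      calc ε ^ 2 = ε * ε := sq ε
        _ ≤ L * D ^ 2 / 16 * (1 / (4 * L) * δ ^ 2) := by gcongr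
        _ = _ := by field_simp; norm_num
    have h2 : ε ≤ D * δ / 8 := le_of_sq_le_sq h1 (by positivity)
    rw [hpdef, div_le_iff₀ hδ, div_le_iff₀ hD]
    linarith
  set σ : ℝ → E 1 → ℝ := fun θ x => p / δ * hyperbolaSlope r (x 0 - θ * D) with hσdef
  have hσ : ∀ θ, Measurable (σ θ) := fun θ => (measurable_hyperbolaSlope_coord 0).const_mul _
  have hσ1 : ∀ θ x, |σ θ x| ≤ 1 / 2 := fun θ x => by
    rw [hσdef, abs_mul, abs_of_pos (by positivity)]
    exact (mul_le_of_le_one_right (by positivity) (abs_hyperbolaSlope_le hr _)).trans hpδ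
  refine ⟨fun θ => hyperbolaObjective 0 p r (θ * D), fun θ => signOracle δ (σ θ) (hσ θ),
    fun θ hθ => ⟨hyperbolaObjective_mem_smoothClass 0 hp hr hpr ?_,
      signOracle_isInexact (hσ θ) (fun x => (hσ1 θ x).trans (by norm_num)) (fun x => ?_) univ⟩,
    fun A hA hacc => ?_⟩
  · rw [abs_mul, abs_of_pos hD]
    exact mul_le_of_le_one_left hD.le (abs_le.2 hθ)
  · have h := hyperbolaGradient_isSubgradient 0 hp hr (a := θ * D) x
    have e : hyperbolaGradient 0 p r (θ * D) x = EuclideanSpace.single 0 (δ * σ θ x) := by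
      ext i
      obtain rfl := Subsingleton.elim i 0
      simp [hyperbolaGradient, hσdef]
      field_simp
    rwa [e] at h
  -- The mean output is close to the minimizer.
  set mean : ℝ → ℝ := fun θ => ∫ w, A.point T w.2 w.1 0 ∂A.transcriptLaw
    (signOracle δ (σ θ) (hσ θ)) T with hmean
  have hclose : ∀ θ ∈ Icc (-1 : ℝ) 1,
      Integrable (fun w => A.point T w.2 w.1 0) (A.transcriptLaw (signOracle δ (σ θ) (hσ θ)) T) ∧
      |mean θ - θ * D| ≤ D / 2 := by
    intro θ hθ
    have h3 : r + ε / p = D / 2 := by rw [hrdef, hpdef]; field_simp; norm_num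
    rw [← h3]
    exact mean_output_close hA (signOracle δ (σ θ) (hσ θ)) hp hr hε (hacc θ hθ)
  -- The grid is so fine that the transcripts for neighbouring parameters are nearly identically
  -- distributed.
  obtain ⟨N, hN⟩ := exists_nat_ge (2 * T * (32 * ε / (D * δ)) ^ 2 + 1)
  have hN1 : (1 : ℝ) ≤ N := le_trans (by have : 0 ≤ 2 * T * (32 * ε / (D * δ)) ^ 2 := by positivity
                                         linarith) hN
  have hN0 : (0 : ℝ) < N := by linarith
  obtain ⟨θ, θ', hk0, hk1, hθθ', hstep⟩ := exists_step_of_abs_sub_le (N := N)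
    (by exact_mod_cast hN0)
    fun θ hθ => (hclose θ hθ).2
  set d : ℝ := 32 * ε / (D * δ * N) with hddef
  have hd : ∀ x, |σ θ' x - σ θ x| ≤ d := by
    intro x
    have h1 := abs_hyperbolaSlope_sub_le hr (x 0 - θ' * D) (x 0 - θ * D)
    have e1 : x 0 - θ' * D - (x 0 - θ * D) = -(2 / N * D) := by
      rw [hθθ']; ring
    rw [e1, abs_neg, abs_of_pos (show 0 < 2 / (N : ℝ) * D by positivity)] at h1
    rw [hσdef]
    simp only
    rw [← mul_sub, abs_mul, abs_of_pos (div_pos hp hδ)]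
    refine (mul_le_mul_of_nonneg_left h1 (div_pos hp hδ).le).trans (le_of_eq ?_)
    rw [hddef, hpdef, hrdef]
    field_simp
    norm_num
  have hTd : T * (2 * d ^ 2) ≤ 1 := by
    have e : T * (2 * d ^ 2) = 2 * T * (32 * ε / (D * δ)) ^ 2 / N ^ 2 := by
      rw [hddef]; field_simp
    rw [e, div_le_one (by positivity)]
    nlinarith
  refine ⟨θ, hk0, ?_⟩
  have h := sq_mean_output_sub_le hA hδ.ne' (hσ θ) (hσ θ') (hσ1 _) (hσ1 _)
    (by positivity) hd hT hTd (hclose _ hk0).1 (hclose _ hk1).1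
  have h2 : ENNReal.ofReal ((D / N) ^ 2) ≤
      ENNReal.ofReal (4 * T * d ^ 2) * A.deviation (signOracle δ (σ θ) (hσ θ)) T := by
    refine le_trans (ENNReal.ofReal_le_ofReal ?_) h
    gcongr
  have e : D ^ 4 / 4096 * (δ ^ 2 / (T * ε ^ 2)) = (D / N) ^ 2 / (4 * T * d ^ 2) := by
    rw [hddef]
    field_simp
    norm_num
  show ENNReal.ofReal (D ^ 4 / 4096 * (δ ^ 2 / (T * ε ^ 2))) ≤ _
  rw [e, ENNReal.ofReal_div_of_pos (by positivity)]
  exact ENNReal.div_le_of_le_mul' h2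

end Repro

theorem theorem1 :
    -- smooth functions: `Θ(δ² / (T ε²))`, and the information-theoretic lower bound
    (∀ (L : NNReal) (D : ℝ), 0 < L → 0 < D →
      Repro.DeviationLowerBound (Repro.smoothClass L D) Repro.IsWholeSpace
        (fun _ x₀ A => A.IsFOI x₀) (fun ε δ T => δ ^ 2 / (T * ε ^ 2)) ∧
      Repro.InformationLowerBound (Repro.smoothClass L D) (fun ε δ T => δ ^ 2 / (T * ε ^ 2)) ∧
      Repro.DeviationUpperBound (Repro.smoothClass L D) (fun _ x₀ A => A.IsFOI x₀)
        (fun ε => 1 / ε ^ 2) (fun a ε T _ => a / (ε * T)) (fun _ => 1)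
        (fun ε δ T => δ ^ 2 / (T * ε ^ 2))) ∧
    -- smooth and strongly convex functions: `Θ(δ² / T ∧ ε)`
    (∀ (L : NNReal) (μ D : ℝ), 0 < μ → μ ≤ L → 0 < D →
      Repro.DeviationLowerBound (Repro.smoothStrongClass L μ D) Repro.IsWholeSpace
        (fun _ x₀ A => A.IsFOI x₀) (fun ε δ T => min (δ ^ 2 / T) ε) ∧
      Repro.DeviationUpperBound (Repro.smoothStrongClass L μ D) (fun _ x₀ A => A.IsFOI x₀)
        (fun ε => 1 / ε) (fun a _ _ t => 2 / (μ * (t + a))) (fun t => t)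
        (fun ε δ T => min (δ ^ 2 / T) ε)) ∧
    -- Lipschitz functions: `Θ(1 / (T ε²))`
    (∀ (G : NNReal) (D : ℝ), 0 < G → 0 < D →
      Repro.DeviationLowerBound (Repro.lipschitzClass G D) Repro.IsWholeSpace
        (fun _ x₀ A => A.IsFOILatest x₀) (fun ε _ T => 1 / (T * ε ^ 2)) ∧
      Repro.DeviationUpperBound (Repro.lipschitzClass G D) (fun _ x₀ A => A.IsFOILatest x₀)
        (fun ε => 1 / ε ^ 2) (fun a ε T _ => a / (ε * T)) (fun _ => 1)
        (fun ε _ T => 1 / (T * ε ^ 2))) ∧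
    -- Lipschitz and strongly convex functions: `Θ(1 / T ∧ ε)`
    (∀ (G : NNReal) (μ : ℝ), 0 < G → 0 < μ →
      Repro.DeviationLowerBound (Repro.lipschitzStrongClass G μ) Repro.IsBallAround
        (fun _ x₀ A => A.IsFOILatest x₀) (fun ε _ T => min (1 / T) ε) ∧
      Repro.DeviationUpperBound (Repro.lipschitzStrongClass G μ) (fun _ x₀ A => A.IsFOILatest x₀)
        (fun ε => 1 / ε) (fun a _ _ t => 2 / (μ * (t + a))) (fun t => t)
        (fun ε _ T => min (1 / T) ε)) := by
  exact ⟨fun L D hL hD => ⟨Repro.deviationLowerBound_smoothClass L D hL hD,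
      Repro.informationLowerBound_smoothClass L D hL hD,
      Repro.deviationUpperBound_smoothClass L D hL hD⟩,
    fun L μ D hμ hμL hD => ⟨Repro.deviationLowerBound_smoothStrongClass L μ D hμ hμL hD,
      Repro.deviationUpperBound_smoothStrongClass L μ D hμ hμL⟩,
    fun G D hG hD => ⟨Repro.deviationLowerBound_lipschitzClass G D hG hD,
      Repro.deviationUpperBound_lipschitzClass G D hG hD⟩,
    fun G μ hG hμ => ⟨Repro.deviationLowerBound_lipschitzStrongClass G μ hG hμ,
      Repro.deviationUpperBound_lipschitzStrongClass G μ hG hμ⟩⟩
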